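/- For $n\ge 0$ let $\mathfrak L_n(x_1,\dots,x_n)=Li_{1,\dots,1}(x_1,\dots,x_n)=\sum_{0<k_1<\dots<k_n}\frac{x_1^{k_1}\cdots x_n^{k_n}}{k_1\cdots k_n}$ (so $\mathfrak L_0=1$), a series that converges absolutely when $|x_j\cdots x_n|<1$ for all $j$, in particular when all $|x_i|<1$. Let $S_n'\subset\mathbb C^n$ be the complement of the hyperplanes $\{x_i=0\}$ and of the divisors $\mathcal D_{jk}=\{x_j\cdots x_k=1\}$, $1\le j\le k\le n$, and let $D_n=\{x:|x_i-\frac12|<\frac12 \text{ for all } i\}\subset S_n'$. Let $1\le s\le n$, let $b\in D_n$, let $p$ be a path in $S_n'$ from $b$ to $x$, and let $q_s$ be a loop in $S_n'$ based at $x$ that turns around $\mathcal D_{sn}=\{x_s\cdots x_n=1\}$ once and around no other component of $\mathbb C^n\setminus S_n'$, normalized so that $\int_{q_s}d\log(1-x_s\cdots x_n)=2\pi i$. Precisely: there are a path $\gamma$ in $S_n'$ from $b$ to a point $z$, along which $|x_i|<1$ and $|x_i\cdots x_n|<1$ for all $i<s$, and a loop $c$ in $S'_n$ based at $z$, along which $x_1,\dots,x_{n-1}$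 are constant and which satisfies $$|1-x_s\cdots x_n|<1,\qquad |1-x_s\cdots x_n|<|1-x_s\cdots x_k|\ (s\le k<n),\qquad |1-x_s\cdots x_n|<|1-(x_j\cdots x_{s-1})^{-1}|\ (1\le j<s),$$ such that $q_s$ is homotopic in $S'_n$ (with fixed end points) to the loop that runs through $p^{-1},\gamma,c,\gamma^{-1},p$ in this order. Put $$\mathbf y(s)=\Bigl(\frac{1-x_sx_{s+1}}{1-x_s},\dots,\frac{1-x_s\cdots x_n}{1-x_s\cdots x_{n-1}}\Bigr)\in\mathbb C^{n-s}.$$ Then $\mathfrak L_n$ can be continued analytically from its power series at $b$ along $p$ and along $p$ followed by $q_s$; $\mathfrak L_{s-1}$ can be continued from its power series along the path $(x_1,\dots,x_{s-1})$ traced by $p$; $\mathfrak L_{n-s}$ can be continued from its power series at $\mathbf y(s)(z)$ (where the series converges) along the image under $\mathbf y(s)$ of the path $\gamma^{-1}$ followed by $p$; and, with these branches near $x$ and $\Theta(q_s)\mathfrak L_n$ denoting the branch along $p$ followed by $q_s$, $$(\Theta(q_s)-\mathrm{id})\,\mathfrak L_n(x)=-2\pi i\,\mathfrak L_{s-1}(x_1,\dots,x_{s-1})\cdot\mathfrak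 L_{n-s}(\mathbf y(s)).$$ -/

import Mathlib

open Filter Topology

namespace MultiLog

/-- The product `x_j x_{j+1} ⋯ x_k` of consecutive coordinates of `x = (x_1, …, x_n)`.
The indices `j`, `k` count from `1`, so that `x_j` is the value of `x` at the element
`j - 1` of `Fin n`. -/
def seg {n : ℕ} (x : Fin n → ℂ) (j k : ℕ) : ℂ :=
  ∏ i : Fin n with j ≤ i.val + 1 ∧ i.val + 1 ≤ k, x i

/-- The power series of the multiple polylogarithm `Li_{m_1,…,m_n}(x_1,…,x_n)`: the sum over
`0 < k_1 < k_2 < ⋯ < k_n` of `x_1^{k_1} ⋯ x_n^{k_n} / (k_1^{m_1} ⋯ k_n^{m_n})`. It converges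
absolutely when `|x_i| < 1` for all `i`; for positive exponents it does so, more generally, when
`|x_j ⋯ x_n| < 1` for all `j`. -/
noncomputable def polylogSeries {n : ℕ} (m : Fin n → ℕ) (x : Fin n → ℂ) : ℂ :=
  ∑' k : {k : Fin n → ℕ // StrictMono k ∧ ∀ i, 0 < k i},
    ∏ i, x i ^ k.1 i / (k.1 i : ℂ) ^ m i

/-- The power series of the multiple logarithm `𝔏_n = Li_{1,…,1}`; for `n = 0` it is `1`. -/
noncomputable def multiLog (n : ℕ) (x : Fin n → ℂ) : ℂ :=
  polylogSeries (fun _ => 1) x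

/-- `S'_n`: the complement in `ℂⁿ` of the hyperplanes `x_i = 0` and of the divisors
`D_{jk} = {x_j ⋯ x_k = 1}`, `1 ≤ j ≤ k ≤ n`. -/
def regularSet (n : ℕ) : Set (Fin n → ℂ) :=
  {x | (∀ i, x i ≠ 0) ∧ ∀ j k, 1 ≤ j → j ≤ k → k ≤ n → seg x j k ≠ 1}

/-- `D_n`: the polydisc `|x_i - 1/2| < 1/2`, in which base points are chosen. It is convex,
lies in `S'_n` and has the origin in its closure. -/
def baseDomain (n : ℕ) : Set (Fin n → ℂ) :=
  {x | ∀ i, ‖x i - 1 / 2‖ < 1 / 2}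

/-- `F t`, for `t` in the unit interval, is a family of analytic germs along the path `γ`, each
of which is, near its parameter, the source of the neighbouring ones. -/
def IsContinuation {E : Type*} [NormedAddCommGroup E] [NormedSpace ℂ E]
    (γ : unitInterval → E) (F : unitInterval → E → ℂ) : Prop :=
  (∀ t, AnalyticAt ℂ (F t) (γ t)) ∧ ∀ t, ∀ᶠ t' in 𝓝 t, F t' =ᶠ[𝓝 (γ t')] F t

/-- Analytic continuation along the path `γ` takes the germ of `f` at `γ 0` to the germ of `g`
at `γ 1`. -/
def ContinuesTo {E : Type*} [NormedAddCommGroup E] [NormedSpace ℂ E]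
    (f : E → ℂ) (γ : unitInterval → E) (g : E → ℂ) : Prop :=
  ∃ F : unitInterval → E → ℂ, IsContinuation γ F ∧ F 0 =ᶠ[𝓝 (γ 0)] f ∧ F 1 =ᶠ[𝓝 (γ 1)] g

/-- `∫ d log f = w` along a path, for a continuous nowhere vanishing `f`: a continuous
logarithm of `f` along the path increases by `w`. -/
def LogIncrement (f : unitInterval → ℂ) (w : ℂ) : Prop :=
  ∃ θ : C(unitInterval, ℂ), (∀ t, Complex.exp (θ t) = f t) ∧ θ 1 - θ 0 = w

/-- The point `y(s) = ((1 - x_s x_{s+1})/(1 - x_s), …, (1 - x_s ⋯ x_n)/(1 - x_s ⋯ x_{n-1}))`. -/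
noncomputable def yPoint {n : ℕ} (s : ℕ) (x : Fin n → ℂ) : Fin (n - s) → ℂ :=
  fun i => (1 - seg x s (s + i.val + 1)) / (1 - seg x s (s + i.val))

/-- The region in which one approaches `D_{sn}` from the base point: the coordinates `x_i` and
the products `x_i ⋯ x_n`, `i < s`, stay in the unit disc (so that none of the divisors `D_{in}`
with `i < s`, and `D_{ik}` with `i ≤ k < s`, is met or turned around). -/
def approachRegion (n s : ℕ) : Set (Fin n → ℂ) :=
  {x | (∀ i : Fin n, i.val + 1 < s → ‖x i‖ < 1) ∧
    ∀ j, 1 ≤ j → j < s → ‖seg x j n‖ < 1}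

/-- A tube around `D_{sn}`: in the complex line through `x` in the direction of the last
coordinate, with the coordinate `u = x_s ⋯ x_n`, the point `u = 1` of `D_{sn}` is strictly
closer to `x` than it is to any other component of the complement of `S'_n`. These
components cut the line at `u = 0`, at `u = x_s ⋯ x_k` (this is `D_{k+1,n}`), and at
`u = (x_j ⋯ x_{s-1})⁻¹` (this is `D_{jn}`). -/
def tube (n s : ℕ) : Set (Fin n → ℂ) :=
  {x | ‖1 - seg x s n‖ < 1 ∧
    (∀ k, s ≤ k → k < n → ‖1 - seg x s n‖ < ‖1 - seg x s k‖) ∧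
    ∀ j, 1 ≤ j → j < s → ‖1 - seg x s n‖ < ‖1 - (seg x j (s - 1))⁻¹‖}

/-- The loop `q` at `x` turns around the component `D_{sn}` of the complement of `S'_n` and
around no other component. Here `p` is the path from the base point to `x` and `γ` is the path
along which `D_{sn}` is approached: up to homotopy in `S'_n`, the loop `q`, transported to the
base point along `p`, is a small loop `c` around `D_{sn}` in the complex line of the last
coordinate, preceded by `γ` and followed by `γ` reversed. The number of turns of `c`
is fixed separately, through `∫ d log (1 - x_s ⋯ x_n)`. -/
def TurnsAroundOnly {n : ℕ} (s : ℕ) {b x z : regularSet n}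
    (p : Path b x) (γ : Path b z) (q : Path x x) : Prop :=
  (∀ t, (γ t : Fin n → ℂ) ∈ approachRegion n s) ∧
  ∃ c : Path z z,
    (∀ t, (c t : Fin n → ℂ) ∈ tube n s) ∧
    (∀ t, ∀ i : Fin n, i.val + 1 < n → (c t : Fin n → ℂ) i = (z : Fin n → ℂ) i) ∧
    q.Homotopic (p.symm.trans ((γ.trans (c.trans γ.symm)).trans p))

end MultiLog

/-! Write `s = a + 1` and `n = a + k + 1`. The partial derivatives of `𝔏_n` are combinations, with
rational coefficients, of `𝔏_{n-1}` at points where two neighbouring coordinates are multiplied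
together or the first one is dropped (`one_sub_mul_partialDeriv_multiLog`). This merging maps `S'_n`
to `S'_{n-1}`. By induction on `n` the differential of `𝔏_n` continues along every path in `S'_n`,
and its primitive does too (`exists_continuesTo_multiLog`). The monodromy theorem
(`Continuable.eventuallyEq_of_homotopic`) then replaces `p` followed by `q` with `γ`, `c` and
`γ⁻¹p`. An identity of germs at `z` persists under continuation along `γ⁻¹p`, so only the effect of
`c` at `z` has to be computed.

On the complex line in the direction of the last coordinate take the parameter `u = x_s ⋯ x_n`.
There the continued `𝔏_n` has the form `P(u) log(1 - u) + Q(u)`, where `P` and `Q` are holomorphic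
on a disc around `u = 1` that contains the loop, and `P = -𝔏_a(x_1, …, x_a) 𝔏_k(y(s))`
(`eventually_log_expansion`). One turn adds `2πi` to the logarithm and hence `2πi P` to the
function.

The expansion is proved by induction on `k`. For `k = 0` the derivative in `u` is `𝔏_a` with its
last argument multiplied by `u`, divided by `1 - u`; the simple pole at `u = 1` produces the
coefficient `-𝔏_a`. For `k > 0` the derivative is the continued `𝔏_{n-1}` at the merged point,
divided by `τ - u` with `τ = x_s ⋯ x_{n-1}`. The coefficient `P` satisfies the same equation
relative to its predecessor (`DiscAdmissible.deriv_logCoeff`), and `P(1) = 0` because the last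
coordinate of `y(s)` vanishes at `u = 1`; so integration creates no new pole.

To obtain an identity of germs in all `n` variables, the loop is moved in parallel to every point
near `z` (`eventually_sub_eq_mul_logCoeff`). -/

namespace MultiLog

/-! ### Osgood's lemma by Cauchy integrals with values in Banach spaces -/

section Osgood

open Metric Complex

/-- A continuous map to a Banach space which becomes holomorphic after composition with each
member of a separating family of continuous linear maps is analytic. -/
theorem analyticAt_of_separating {ι : Type*} {B F : Type*} [NormedAddCommGroup B]
    [NormedSpace ℂ B] [CompleteSpace B] [NormedAddCommGroup F] [NormedSpace ℂ F] [CompleteSpace F]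
    (T : ι → B →L[ℂ] F) (hT : ∀ u v, (∀ i, T i u = T i v) → u = v)
    {g : ℂ → B} {a : ℂ} {R : ℝ} (hR : 0 < R) (hg : ContinuousOn g (closedBall a R))
    (hd : ∀ i, DifferentiableOn ℂ (fun z => T i (g z)) (ball a R)) : AnalyticAt ℂ g a := by
  have hci : CircleIntegrable g a R :=
    (hg.mono sphere_subset_closedBall).circleIntegrable hR.le
  lift R to NNReal using hR.le
  -- The Cauchy integral of a function continuous on the circle is analytic inside. The maps `T i`
  -- commute with the integral, so Cauchy's formula for each `T i ∘ g` identifies the integral with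
  -- `g`.
  have h := (hasFPowerSeriesOn_cauchy_integral (f := g) hci (by exact_mod_cast hR)).analyticAt
  refine h.congr ?_
  filter_upwards [ball_mem_nhds a hR] with z hz
  refine hT _ _ fun i => ?_
  have hcont : ContinuousOn (fun w => (w - z)⁻¹ • g w) (sphere a R) := by
    refine ContinuousOn.smul (ContinuousOn.inv₀ (by fun_prop) ?_) (hg.mono sphere_subset_closedBall)
    intro w hw h0
    rw [sub_eq_zero] at h0
    subst h0
    rw [mem_sphere] at hw
    rw [mem_ball] at hz
    exact hz.ne hw
  have hint := (hcont.circleIntegrable hR.le).out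
  have hcomm : T i (∮ w in C(a, R), (w - z)⁻¹ • g w) =
      ∮ w in C(a, R), (w - z)⁻¹ • T i (g w) := by
    simp only [circleIntegral]
    rw [← ContinuousLinearMap.intervalIntegral_comp_comm _ hint]
    simp only [map_smul]
  rw [map_smul, hcomm]
  have hdc : DiffContOnCl ℂ (fun z => T i (g z)) (ball a R) := by
    refine ⟨hd i, ?_⟩
    rw [closure_ball _ hR.ne']
    exact (T i).continuous.comp_continuousOn hg
  simpa using hdc.two_pi_i_inv_smul_circleIntegral_sub_inv_smul hz

section CircleKernel

variable {F : Type*} [NormedAddCommGroup F] {a : ℂ} {R : ℝ}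

/-- Extension by zero of a function on a circle. -/
noncomputable def circleExtend (ψ : sphere a R → F) (w : ℂ) : F :=
  open Classical in if h : w ∈ sphere a R then ψ ⟨w, h⟩ else 0

theorem circleExtend_of_mem (ψ : sphere a R → F) {w : ℂ} (h : w ∈ sphere a R) :
    circleExtend ψ w = ψ ⟨w, h⟩ := dif_pos h

theorem continuousOn_circleExtend {ψ : sphere a R → F} (hψ : Continuous ψ) :
    ContinuousOn (circleExtend ψ) (sphere a R) := by
  rw [continuousOn_iff_continuous_domRestrict]
  convert hψ using 1
  ext w
  exact circleExtend_of_mem ψ w.2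

variable [NormedSpace ℂ F]

theorem circleIntegrable_circleExtend (hR : 0 ≤ R) (φ : C(sphere a R, ℂ)) (ψ : C(sphere a R, F)) :
    CircleIntegrable (circleExtend fun w => φ w • ψ w) a R :=
  (continuousOn_circleExtend (by fun_prop)).circleIntegrable hR

/-- The integral over a circle of the product of two functions, as a bilinear map. -/
noncomputable def circlePairing (hR : 0 ≤ R) :
    C(sphere a R, ℂ) →L[ℂ] C(sphere a R, F) →L[ℂ] F :=
  LinearMap.mkContinuous₂
    (LinearMap.mk₂ ℂ (fun φ ψ => ∮ w in C(a, R), circleExtend (fun w => φ w • ψ w) w)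
      (fun φ φ' ψ => by
        rw [← circleIntegral.integral_add (circleIntegrable_circleExtend hR _ _)
          (circleIntegrable_circleExtend hR _ _)]
        refine circleIntegral.integral_congr hR fun w hw => ?_
        simp [circleExtend_of_mem _ hw, add_smul])
      (fun c φ ψ => by
        rw [← circleIntegral.integral_smul]
        refine circleIntegral.integral_congr hR fun w hw => ?_
        simp [circleExtend_of_mem _ hw, mul_smul])
      (fun φ ψ ψ' => by
        rw [← circleIntegral.integral_add (circleIntegrable_circleExtend hR _ _)
          (circleIntegrable_circleExtend hR _ _)]
        refine circleIntegral.integral_congr hR fun w hw => ?_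
        simp [circleExtend_of_mem _ hw])
      (fun c φ ψ => by
        rw [← circleIntegral.integral_smul]
        refine circleIntegral.integral_congr hR fun w hw => ?_
        simp [circleExtend_of_mem _ hw, smul_comm _ c]))
    (2 * Real.pi * R) (fun φ ψ => by
      rw [mul_assoc (2 * Real.pi * R)]
      refine circleIntegral.norm_integral_le_of_norm_le_const hR fun w hw => ?_
      rw [circleExtend_of_mem _ hw, norm_smul]
      gcongr
      · exact φ.norm_coe_le_norm _
      · exact ψ.norm_coe_le_norm _)

theorem circlePairing_apply (hR : 0 ≤ R) (φ : C(sphere a R, ℂ)) (ψ : C(sphere a R, F)) :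
    circlePairing hR φ ψ = ∮ w in C(a, R), circleExtend (fun w => φ w • ψ w) w := rfl

theorem sub_ne_zero_of_mem_sphere {z : ℂ} (hz : z ∈ ball a R) (w : sphere a R) :
    (w : ℂ) - z ≠ 0 := by
  intro h0
  have hw := w.2
  rw [sub_eq_zero.1 h0, mem_sphere] at hw
  exact (mem_ball.1 hz).ne hw

/-- The Cauchy kernel `1 / (w - z)` as a function of `w` on a circle around `a`. -/
noncomputable def cauchyKernel (a : ℂ) (R : ℝ) (z : ℂ) : C(sphere a R, ℂ) :=
  open Classical in
  if h : z ∈ ball a R then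
    ⟨fun w => ((w : ℂ) - z)⁻¹, Continuous.inv₀ (by fun_prop) (sub_ne_zero_of_mem_sphere h)⟩
  else 0

theorem cauchyKernel_apply {z : ℂ} (h : z ∈ ball a R) (w : sphere a R) :
    cauchyKernel a R z w = ((w : ℂ) - z)⁻¹ := by
  simp [cauchyKernel, h]

/-- Evaluations at the points of the circle separate continuous functions, and each of them turns
the kernel into the holomorphic function `1 / (w - z)` of `z`. -/
theorem analyticAt_cauchyKernel (hR : 0 < R) : AnalyticAt ℂ (cauchyKernel a R) a := by
  have hsub : closedBall a (R / 2) ⊆ ball a R := closedBall_subset_ball (by linarith)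
  refine analyticAt_of_separating (fun w : sphere a R => ContinuousMap.evalCLM ℂ w)
    (fun u v h => ContinuousMap.ext h) (half_pos hR) ?_ fun w => ?_
  · rw [continuousOn_iff_continuous_domRestrict]
    refine ContinuousMap.continuous_of_continuous_uncurry _ ?_
    have : (Function.uncurry fun (x : closedBall a (R / 2)) y =>
        ((closedBall a (R / 2)).domRestrict (cauchyKernel a R) x) y) =
        fun q : closedBall a (R / 2) × sphere a R => ((q.2 : ℂ) - q.1)⁻¹ := by
      ext ⟨x, y⟩
      exact cauchyKernel_apply (hsub x.2) y
    rw [this]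
    exact Continuous.inv₀ (by fun_prop) fun q => sub_ne_zero_of_mem_sphere (hsub q.1.2) _
  · have : ∀ z ∈ ball a (R / 2), ContinuousMap.evalCLM ℂ w (cauchyKernel a R z) =
        ((w : ℂ) - z)⁻¹ := fun z hz => cauchyKernel_apply (hsub (ball_subset_closedBall hz)) w
    refine DifferentiableOn.congr ?_ this
    exact DifferentiableOn.inv (by fun_prop) fun z hz =>
      sub_ne_zero_of_mem_sphere (hsub (ball_subset_closedBall hz)) w

end CircleKernel

/-- **Osgood's lemma**: a continuous separately holomorphic function is analytic. -/
theorem analyticAt_of_separately (n : ℕ) : ∀ {F : Type} [NormedAddCommGroup F] [NormedSpace ℂ F]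
    [CompleteSpace F] {f : (Fin n → ℂ) → F} {x₀ : Fin n → ℂ} {U : Set (Fin n → ℂ)},
    U ∈ 𝓝 x₀ → ContinuousOn f U →
    (∀ x ∈ U, ∀ i, DifferentiableAt ℂ (fun t => f (Function.update x i t)) (x i)) →
    AnalyticAt ℂ f x₀ := by
  induction n with
  | zero =>
    intro F _ _ _ f x₀ U _ _ _
    have : f = fun _ => f x₀ := funext fun x => by rw [Subsingleton.elim x x₀]
    rw [this]
    exact analyticAt_const
  | succ n ih =>
    intro F _ _ _ f x₀ U hU hf hd
    obtain ⟨R, hR, hRU⟩ := nhds_basis_closedBall.mem_iff.1 hU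
    set a := x₀ 0
    set e₀ := Fin.tail x₀
    have hmem : ∀ w ∈ closedBall a R, ∀ e ∈ closedBall e₀ R,
        (Fin.cons w e : Fin (n + 1) → ℂ) ∈ closedBall x₀ R := by
      intro w hw e he
      rw [mem_closedBall, dist_pi_le_iff hR.le] at he ⊢
      refine Fin.cases hw fun i => ?_
      exact he i
    classical
    -- The restriction of `f` to the circle in the first variable is a point of a Banach space,
    -- depending on the other variables. The induction hypothesis is applied to it, which is why the
    -- target space is arbitrary in the statement.
    let Φ : (Fin n → ℂ) → C(sphere a R, F) := fun e =>
      if h : e ∈ closedBall e₀ R then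
        ⟨fun w => f (Fin.cons w e), by
          have hc : Continuous fun w : sphere a R => (Fin.cons (w : ℂ) e : Fin (n + 1) → ℂ) := by
            refine continuous_pi (Fin.cases ?_ fun i => ?_)
            · simpa using continuous_subtype_val
            · simpa using continuous_const
          exact (hf.mono hRU).comp_continuous hc
            fun w => hmem _ (sphere_subset_closedBall w.2) _ h⟩
      else 0
    have hΦ : ∀ e ∈ closedBall e₀ R, ∀ w, Φ e w = f (Fin.cons (w : ℂ) e) := by
      intro e he w
      simp only [Φ, dif_pos he, ContinuousMap.coe_mk]
    have hΦc : ContinuousOn Φ (closedBall e₀ R) := by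
      rw [continuousOn_iff_continuous_domRestrict]
      refine ContinuousMap.continuous_of_continuous_uncurry _ ?_
      have : (Function.uncurry fun (x : closedBall e₀ R) y => ((closedBall e₀ R).domRestrict Φ x) y) =
          fun q : closedBall e₀ R × sphere a R =>
            f (Fin.cons (q.2 : ℂ) (q.1 : Fin n → ℂ) : Fin (n + 1) → ℂ) := by
        ext ⟨x, y⟩
        exact hΦ _ x.2 y
      rw [this]
      have hc : Continuous fun q : closedBall e₀ R × sphere a R =>
          (Fin.cons (q.2 : ℂ) (q.1 : Fin n → ℂ) : Fin (n + 1) → ℂ) := by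
        refine continuous_pi (Fin.cases ?_ fun i => ?_)
        · simp only [Fin.cons_zero]; fun_prop
        · simp only [Fin.cons_succ]
          exact (continuous_apply i).comp (continuous_subtype_val.comp continuous_fst)
      exact (hf.mono hRU).comp_continuous hc
        fun q => hmem _ (sphere_subset_closedBall q.2.2) _ q.1.2
    have hΦa : AnalyticAt ℂ Φ e₀ := by
      refine ih (ball_mem_nhds e₀ hR) (hΦc.mono ball_subset_closedBall) fun e he i => ?_
      have hcu : Continuous fun t => Function.update e i t := by fun_prop
      have hnh : (fun t => Function.update e i t) ⁻¹' ball e₀ R ∈ 𝓝 (e i) :=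
        hcu.continuousAt.preimage_mem_nhds
          (isOpen_ball.mem_nhds (by rwa [Function.update_eq_self]))
      obtain ⟨ρ, hρ, hρU⟩ := nhds_basis_closedBall.mem_iff.1 hnh
      refine (analyticAt_of_separating (fun w : sphere a R => ContinuousMap.evalCLM ℂ w)
        (fun u v h => ContinuousMap.ext h) hρ
        (hΦc.comp hcu.continuousOn fun t ht => ball_subset_closedBall (hρU ht))
        fun w t ht => ?_).differentiableAt
      have ht' := hρU (ball_subset_closedBall ht)
      have hy := hRU (hmem w (sphere_subset_closedBall w.2) _ (ball_subset_closedBall ht'))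
      have h1 := hd _ hy i.succ
      simp only [Fin.cons_succ, Function.update_self] at h1
      refine (h1.congr_of_eventuallyEq ?_).differentiableWithinAt
      filter_upwards [isOpen_ball.mem_nhds ht] with t' ht'
      have := hΦ _ (ball_subset_closedBall (hρU (ball_subset_closedBall ht'))) w
      change Φ (Function.update e i t') w = _
      rw [this, Fin.cons_update, Fin.cons_update, Function.update_idem]
    have hK := analyticAt_cauchyKernel (a := a) hR
    have h0 : AnalyticAt ℂ (fun x : Fin (n + 1) → ℂ => x 0) x₀ :=
      (ContinuousLinearMap.proj (R := ℂ) (φ := fun _ : Fin (n + 1) => ℂ) 0).analyticAt x₀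
    have ht : AnalyticAt ℂ (fun x : Fin (n + 1) → ℂ => Fin.tail x) x₀ :=
      (ContinuousLinearMap.pi fun i : Fin n =>
        ContinuousLinearMap.proj (R := ℂ) (φ := fun _ : Fin (n + 1) => ℂ) i.succ).analyticAt x₀
    -- Cauchy's formula in the first variable: `f` is a continuous bilinear pairing of an analytic
    -- function of the first variable with an analytic function of the others.
    have key : AnalyticAt ℂ (fun x : Fin (n + 1) → ℂ => (2 * Real.pi * I : ℂ)⁻¹ •
        circlePairing hR.le (cauchyKernel a R (x 0)) (Φ (Fin.tail x))) x₀ := by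
      have hK' : AnalyticAt ℂ (fun x : Fin (n + 1) → ℂ => cauchyKernel a R (x 0)) x₀ :=
        hK.comp_of_eq h0 rfl
      have hΦ' : AnalyticAt ℂ (fun x : Fin (n + 1) → ℂ => Φ (Fin.tail x)) x₀ :=
        hΦa.comp_of_eq ht rfl
      exact analyticAt_const.smul (((circlePairing hR.le).analyticAt_bilinear
        (cauchyKernel a R (x₀ 0), Φ (Fin.tail x₀))).comp₂ hK' hΦ')
    refine key.congr ?_
    filter_upwards [ball_mem_nhds x₀ hR] with x hx
    have hx0 : x 0 ∈ ball a R := (dist_le_pi_dist x x₀ 0).trans_lt hx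
    have hxt : Fin.tail x ∈ closedBall e₀ R := by
      rw [mem_closedBall, dist_pi_le_iff hR.le]
      exact fun i => (dist_le_pi_dist x x₀ i.succ).trans hx.le
    have hdc : DiffContOnCl ℂ (fun w => f (Fin.cons w (Fin.tail x))) (ball a R) := by
      have hc : Continuous fun w : ℂ => (Fin.cons w (Fin.tail x) : Fin (n + 1) → ℂ) := by
        refine continuous_pi (Fin.cases ?_ fun i => ?_)
        · simpa using continuous_id'
        · simpa using continuous_const
      constructor
      · intro w hw
        have h1 := hd _ (hRU (hmem w (ball_subset_closedBall hw) _ hxt)) 0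
        simp only [Fin.cons_zero, Fin.update_cons_zero] at h1
        exact h1.differentiableWithinAt
      · rw [closure_ball _ hR.ne']
        exact (hf.mono hRU).comp hc.continuousOn fun w hw => hmem w hw _ hxt
    have hcf := hdc.two_pi_i_inv_smul_circleIntegral_sub_inv_smul hx0
    rw [Fin.cons_self_tail] at hcf
    rw [← hcf, circlePairing_apply]
    congr 1
    refine circleIntegral.integral_congr hR.le fun w hw => ?_
    simp only [circleExtend_of_mem _ hw, cauchyKernel_apply hx0, hΦ _ hxt]

end Osgood

/-! ### Families of analytic germs and the identity principle -/

section Germs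

open unitInterval

variable {X E F : Type*} [TopologicalSpace X] [NormedAddCommGroup E] [NormedSpace ℂ E]
  [NormedAddCommGroup F] [NormedSpace ℂ F]

/-- The set where `p` holds is clopen. This is the passage from local to global in the identity
principle and in the monodromy theorem. -/
theorem forall_of_eventually_iff [PreconnectedSpace X] {p : X → Prop}
    (h : ∀ t, ∀ᶠ t' in 𝓝 t, (p t' ↔ p t)) {t₀ : X} (h₀ : p t₀) (t : X) : p t := by
  have ho : IsOpen {t | p t} := isOpen_iff_eventually.2 fun t ht => (h t).mono fun _ h' => h'.2 ht
  have hc : IsOpen {t | p t}ᶜ :=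
    isOpen_iff_eventually.2 fun t ht => (h t).mono fun _ h' hp => ht (h'.1 hp)
  have := (show IsClopen {t | p t} from ⟨isOpen_compl_iff.1 hc, ho⟩).eq_univ ⟨t₀, h₀⟩
  exact this.symm.subset (Set.mem_univ t)

/-- A family of analytic germs along a map `γ` from an arbitrary parameter space, each of which
is the source of the neighbouring ones. -/
def GermContinuation (γ : X → E) (G : X → E → F) : Prop :=
  (∀ t, AnalyticAt ℂ (G t) (γ t)) ∧ ∀ t, ∀ᶠ t' in 𝓝 t, G t' =ᶠ[𝓝 (γ t')] G t

theorem GermContinuation.comp {Y : Type*} [TopologicalSpace Y] {γ : X → E} {G : X → E → F}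
    (h : GermContinuation γ G) {φ : Y → X} (hφ : Continuous φ) :
    GermContinuation (fun t => γ (φ t)) fun t => G (φ t) :=
  ⟨fun t => h.1 (φ t), fun t => hφ.continuousAt.eventually (h.2 (φ t))⟩

theorem GermContinuation.const {γ : X → E} {f : E → F} (h : ∀ t, AnalyticAt ℂ f (γ t)) :
    GermContinuation γ fun _ => f :=
  ⟨h, fun _ => Eventually.of_forall fun _ => EventuallyEq.rfl⟩

theorem eventuallyEq_iff_of_ball {f g : E → F} {a : E} {r : ℝ}
    (hf : ∀ v ∈ Metric.ball a r, AnalyticAt ℂ f v) (hg : ∀ v ∈ Metric.ball a r, AnalyticAt ℂ g v)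
    {u v : E} (hu : u ∈ Metric.ball a r) (hv : v ∈ Metric.ball a r) :
    f =ᶠ[𝓝 u] g ↔ f =ᶠ[𝓝 v] g := by
  have hpre : IsPreconnected (Metric.ball a r) := (convex_ball a r).isPreconnected
  have key : ∀ {u v}, u ∈ Metric.ball a r → v ∈ Metric.ball a r → f =ᶠ[𝓝 u] g → f =ᶠ[𝓝 v] g :=
    fun hu hv h => (AnalyticOnNhd.eqOn_of_preconnected_of_eventuallyEq hf hg hpre hu h).eventuallyEq_of_mem
      (Metric.isOpen_ball.mem_nhds hv)
  exact ⟨key hu hv, key hv hu⟩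

theorem exists_ball_analyticAt [CompleteSpace F] {f : E → F} {a : E} (hf : AnalyticAt ℂ f a) :
    ∃ r > 0, ∀ v ∈ Metric.ball a r, AnalyticAt ℂ f v :=
  Metric.eventually_nhds_iff_ball.1 hf.eventually_analyticAt

/-- The identity principle along a connected family of points. -/
theorem GermContinuation.eventuallyEq [CompleteSpace F] [PreconnectedSpace X] {γ : X → E}
    (hγ : Continuous γ) {G G' : X → E → F} (h : GermContinuation γ G)
    (h' : GermContinuation γ G') {t₀ : X} (h₀ : G t₀ =ᶠ[𝓝 (γ t₀)] G' t₀) (t : X) :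
    G t =ᶠ[𝓝 (γ t)] G' t := by
  refine forall_of_eventually_iff (p := fun t => G t =ᶠ[𝓝 (γ t)] G' t) (fun t => ?_) h₀ t
  obtain ⟨r, hr, hr'⟩ := exists_ball_analyticAt (h.1 t)
  obtain ⟨s, hs, hs'⟩ := exists_ball_analyticAt (h'.1 t)
  have hmin : 0 < min r s := lt_min hr hs
  filter_upwards [h.2 t, h'.2 t, hγ.continuousAt.eventually (Metric.ball_mem_nhds (γ t) hmin)]
    with t' h1 h2 h3
  have := eventuallyEq_iff_of_ball
    (fun v hv => hr' v (Metric.ball_subset_ball (min_le_left r s) hv))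
    (fun v hv => hs' v (Metric.ball_subset_ball (min_le_right r s) hv))
    h3 (Metric.mem_ball_self hmin)
  rw [← this]
  exact ⟨fun h => h1.symm.trans (h.trans h2), fun h => h1.trans (h.trans h2.symm)⟩

/-- Continuation along nearby curves, starting from the same germ, gives the same germs. -/
theorem GermContinuation.eventuallyEq_nearby [CompleteSpace F] [PreconnectedSpace X]
    [LocallyConnectedSpace X] {V : Type*} [TopologicalSpace V] {v₀ : V} {H : V → X → E}
    (hH : ∀ t, ContinuousAt (Function.uncurry H) (v₀, t))
    (hHc : ∀ᶠ v in 𝓝 v₀, Continuous (H v)) {G : V → X → E → F}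
    (hG : ∀ᶠ v in 𝓝 v₀, GermContinuation (H v) (G v)) {t₀ : X}
    (h₀ : ∀ᶠ v in 𝓝 v₀, G v t₀ =ᶠ[𝓝 (H v t₀)] G v₀ t₀) (t : X) :
    ∀ᶠ v in 𝓝 v₀, G v t =ᶠ[𝓝 (H v t)] G v₀ t := by
  refine forall_of_eventually_iff
    (p := fun t => ∀ᶠ v in 𝓝 v₀, G v t =ᶠ[𝓝 (H v t)] G v₀ t) (fun t => ?_) h₀ t
  have hG₀ := hG.self_of_nhds
  obtain ⟨r, hr, hr'⟩ := exists_ball_analyticAt (hG₀.1 t)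
  have hball : ∀ᶠ q in 𝓝 (v₀, t), Function.uncurry H q ∈ Metric.ball (H v₀ t) r :=
    (hH t).eventually (Metric.ball_mem_nhds _ hr)
  rw [nhds_prod_eq, eventually_prod_iff] at hball
  obtain ⟨pv, hpv, pt, hpt, hball⟩ := hball
  -- For parameters in the connected set `J` the nearby curves stay in a ball on which the one
  -- function `G v₀ t` is analytic. It continues itself along them, so agreement at one parameter in
  -- `J` spreads to all others.
  obtain ⟨J, hJt, hJo, htJ, hJc⟩ :=
    locallyConnectedSpace_iff_subsets_isOpen_isConnected.1 ‹_› t _ (hpt.and (hG₀.2 t))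
  have key : ∀ t₁ ∈ J, ∀ t₂ ∈ J, (∀ᶠ v in 𝓝 v₀, G v t₁ =ᶠ[𝓝 (H v t₁)] G v₀ t₁) →
      ∀ᶠ v in 𝓝 v₀, G v t₂ =ᶠ[𝓝 (H v t₂)] G v₀ t₂ := by
    intro t₁ h₁ t₂ h₂ hp
    have hcont : ∀ s, Tendsto (fun v => H v s) (𝓝 v₀) (𝓝 (H v₀ s)) := fun s =>
      (hH s).tendsto.comp (f := fun v => (v, s)) ((Continuous.prodMk_left s).tendsto v₀)
    have e : ∀ s ∈ J, ∀ᶠ v in 𝓝 v₀, G v₀ s =ᶠ[𝓝 (H v s)] G v₀ t := fun s hs =>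
      (hcont s).eventually (eventually_eventually_nhds.2 (hJt hs).2)
    filter_upwards [hp, e t₁ h₁, e t₂ h₂, hpv, hHc, hG] with v h1 h2 h3 h4 h5 h6
    have : PreconnectedSpace J := Subtype.preconnectedSpace hJc.isPreconnected
    have hc := GermContinuation.eventuallyEq (X := J) (γ := fun s => H v s) (by fun_prop)
      (h6.comp continuous_subtype_val)
      (GermContinuation.const (f := G v₀ t) fun s => hr' _ (hball h4 (hJt s.2).1))
      (t₀ := ⟨t₁, h₁⟩) (h1.trans h2) ⟨t₂, h₂⟩
    exact hc.trans h3.symm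
  filter_upwards [hJo.mem_nhds htJ] with t' ht'
  exact ⟨key t' ht' t htJ, key t htJ t' ht'⟩

end Germs

/-! ### Continuation along paths and the monodromy theorem -/

section Continuation

open unitInterval

variable {X E : Type*} [TopologicalSpace X] [NormedAddCommGroup E] [NormedSpace ℂ E]

theorem locallyConnectedSpace_unitInterval : LocallyConnectedSpace I := by
  have : LocallyPathConnectedSpace I := (convex_Icc (0 : ℝ) 1).locallyPathConnectedSpace
  infer_instance

theorem ContinuesTo.congr_left {f f' g : E → ℂ} {γ : I → E} (h : ContinuesTo f γ g)
    (hf : f =ᶠ[𝓝 (γ 0)] f') : ContinuesTo f' γ g := by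
  obtain ⟨G, hG, h0, h1⟩ := h
  exact ⟨G, hG, h0.trans hf, h1⟩

theorem ContinuesTo.congr_right {f g g' : E → ℂ} {γ : I → E} (h : ContinuesTo f γ g)
    (hg : g =ᶠ[𝓝 (γ 1)] g') : ContinuesTo f γ g' := by
  obtain ⟨G, hG, h0, h1⟩ := h
  exact ⟨G, hG, h0, h1.trans hg⟩

theorem ContinuesTo.analyticAt_right {f g : E → ℂ} {γ : I → E} (h : ContinuesTo f γ g) :
    AnalyticAt ℂ g (γ 1) := by
  obtain ⟨G, hG, -, h1⟩ := h
  exact (hG.1 1).congr h1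

theorem ContinuesTo.const {f : E → ℂ} {γ : I → E} (h : ∀ t, AnalyticAt ℂ f (γ t)) :
    ContinuesTo f γ f :=
  ⟨fun _ => f, GermContinuation.const h, EventuallyEq.rfl, EventuallyEq.rfl⟩

theorem ContinuesTo.unique {f g g' : E → ℂ} {γ : I → E} (hγ : Continuous γ)
    (h : ContinuesTo f γ g) (h' : ContinuesTo f γ g') : g =ᶠ[𝓝 (γ 1)] g' := by
  obtain ⟨G, hG, h0, h1⟩ := h
  obtain ⟨G', hG', h0', h1'⟩ := h'
  exact h1.symm.trans ((GermContinuation.eventuallyEq hγ hG hG' (h0.trans h0'.symm) 1).trans h1')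

theorem ContinuesTo.map₂ {f₁ f₂ g₁ g₂ : E → ℂ} {γ : I → E} (op : ℂ → ℂ → ℂ)
    (hop : ∀ {u v : E → ℂ} {x : E}, AnalyticAt ℂ u x → AnalyticAt ℂ v x →
      AnalyticAt ℂ (fun y => op (u y) (v y)) x)
    (h₁ : ContinuesTo f₁ γ g₁) (h₂ : ContinuesTo f₂ γ g₂) :
    ContinuesTo (fun v => op (f₁ v) (f₂ v)) γ (fun v => op (g₁ v) (g₂ v)) := by
  obtain ⟨G₁, hG₁, h0₁, h1₁⟩ := h₁
  obtain ⟨G₂, hG₂, h0₂, h1₂⟩ := h₂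
  refine ⟨fun t v => op (G₁ t v) (G₂ t v), ⟨fun t => hop (hG₁.1 t) (hG₂.1 t), fun t => ?_⟩,
    h0₁.comp₂ op h0₂, h1₁.comp₂ op h1₂⟩
  filter_upwards [hG₁.2 t, hG₂.2 t] with t' h h' using h.comp₂ op h'

theorem ContinuesTo.sub {f₁ f₂ g₁ g₂ : E → ℂ} {γ : I → E}
    (h₁ : ContinuesTo f₁ γ g₁) (h₂ : ContinuesTo f₂ γ g₂) :
    ContinuesTo (fun v => f₁ v - f₂ v) γ (fun v => g₁ v - g₂ v) :=
  h₁.map₂ (· - ·) (fun hu hv => hu.sub hv) h₂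

theorem ContinuesTo.mul {f₁ f₂ g₁ g₂ : E → ℂ} {γ : I → E}
    (h₁ : ContinuesTo f₁ γ g₁) (h₂ : ContinuesTo f₂ γ g₂) :
    ContinuesTo (fun v => f₁ v * f₂ v) γ (fun v => g₁ v * g₂ v) :=
  h₁.map₂ (· * ·) (fun hu hv => hu.mul hv) h₂

theorem IsContinuation.comp_analytic {E' : Type*} [NormedAddCommGroup E'] [NormedSpace ℂ E']
    {G : I → E' → ℂ} {γ : I → E} {φ : E → E'} (h : IsContinuation (fun t => φ (γ t)) G)
    (hφ : ∀ t, AnalyticAt ℂ φ (γ t)) : IsContinuation γ fun t v => G t (φ v) := by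
  refine ⟨fun t => (h.1 t).comp (hφ t), fun t => ?_⟩
  filter_upwards [h.2 t] with t' ht'
  exact (hφ t').continuousAt.eventually ht'

/-- A continuation along the image of a path under an analytic map can be pulled back. -/
theorem ContinuesTo.comp_analytic {E' : Type*} [NormedAddCommGroup E'] [NormedSpace ℂ E']
    {f g : E' → ℂ} {γ : I → E} {φ : E → E'} (h : ContinuesTo f (fun t => φ (γ t)) g)
    (hφ : ∀ t, AnalyticAt ℂ φ (γ t)) : ContinuesTo (fun v => f (φ v)) γ (fun v => g (φ v)) := by
  obtain ⟨G, hG, h0, h1⟩ := h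
  exact ⟨_, hG.comp_analytic hφ, (hφ 0).continuousAt.eventually h0,
    (hφ 1).continuousAt.eventually h1⟩

theorem ContinuesTo.exists_of_trans {f g : E → ℂ} {φ : X → E} {a b c : X} {p : Path a b}
    {q : Path b c} (h : ContinuesTo f (fun t => φ ((p.trans q) t)) g) :
    ∃ k, ContinuesTo f (fun t => φ (p t)) k ∧ ContinuesTo k (fun t => φ (q t)) g := by
  obtain ⟨G, hG, h0, h1⟩ := h
  let l : I → I := fun t => ⟨(t : ℝ) / 2, by have := t.2.1; positivity,
    by have := t.2.2; linarith⟩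
  let r : I → I := fun t => ⟨((t : ℝ) + 1) / 2, by have := t.2.1; positivity,
    by have := t.2.2; linarith⟩
  have hl : Continuous l := by fun_prop
  have hr : Continuous r := by fun_prop
  have hpl : ∀ t, (p.trans q) (l t) = p t := by
    intro t
    have h : ((l t : I) : ℝ) ≤ 1 / 2 := by
      have := t.2.2
      change (t : ℝ) / 2 ≤ 1 / 2
      linarith
    rw [Path.trans_apply, dif_pos h]
    congr 1
    ext
    change 2 * ((t : ℝ) / 2) = t
    ring
  have hqr : ∀ t, (p.trans q) (r t) = q t := by
    intro t
    rw [Path.trans_apply]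
    by_cases h : ((r t : I) : ℝ) ≤ 1 / 2
    · have h1 : ((t : ℝ) + 1) / 2 ≤ 1 / 2 := h
      have h2 : t = 0 := by
        ext
        have := t.2.1
        change (t : ℝ) = 0
        linarith
      rw [dif_pos h, show q t = q 0 by rw [h2], q.source]
      refine Eq.trans (congrArg p ?_) p.target
      ext
      change 2 * (((t : ℝ) + 1) / 2) = 1
      rw [h2]
      norm_num
    · rw [dif_neg h]
      congr 1
      ext
      change 2 * (((t : ℝ) + 1) / 2) - 1 = t
      ring
  have hl0 : l 0 = 0 := by ext; simp [l]
  have hr1 : r 1 = 1 := by ext; norm_num [r]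
  have hlr : l 1 = r 0 := by ext; simp [l, r]
  have hGl := GermContinuation.comp hG hl
  have hGr := GermContinuation.comp hG hr
  simp only [hpl] at hGl
  simp only [hqr] at hGr
  refine ⟨G (l 1), ⟨_, hGl, ?_, EventuallyEq.rfl⟩, ⟨_, hGr, ?_, ?_⟩⟩
  · simpa [hl0] using h0
  · simp [hlr]
  · simpa [hr1] using h1

/-- The germ of `f` at `φ b` can be continued along the images of all paths that begin at `b`. -/
def Continuable (φ : X → E) (f : E → ℂ) (b : X) : Prop :=
  ∀ (x : X) (p : Path b x), ∃ g, ContinuesTo f (fun t => φ (p t)) g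

/-- A continuation along `p.trans q` exists by hypothesis; its second half is the one sought,
because uniqueness along `p` identifies the germ in the middle with `g`. -/
theorem Continuable.move {φ : X → E} (hφ : Continuous φ) {f g : E → ℂ} {b x : X}
    (h : Continuable φ f b) {p : Path b x} (hp : ContinuesTo f (fun t => φ (p t)) g) :
    Continuable φ g x := by
  intro y q
  obtain ⟨k, hk⟩ := h y (p.trans q)
  obtain ⟨m, hm, hm'⟩ := hk.exists_of_trans
  refine ⟨k, hm'.congr_left ?_⟩
  have := hm.unique (by fun_prop) hp
  simpa using this

/-- No gluing of families is needed: some continuation along the concatenation exists, and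
uniqueness on each half identifies its end germ with `k`. -/
theorem Continuable.trans {φ : X → E} (hφ : Continuous φ) {f g k : E → ℂ} {b x y : X}
    (h : Continuable φ f b) {p : Path b x} {q : Path x y}
    (hp : ContinuesTo f (fun t => φ (p t)) g) (hq : ContinuesTo g (fun t => φ (q t)) k) :
    ContinuesTo f (fun t => φ ((p.trans q) t)) k := by
  obtain ⟨k', hk⟩ := h y (p.trans q)
  obtain ⟨m, hm, hm'⟩ := hk.exists_of_trans
  have h1 := hm.unique (by fun_prop) hp
  simp only [Path.target] at h1
  have h2 := (hm'.congr_left (by simpa using h1)).unique (by fun_prop) hq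
  exact hk.congr_right (by simpa using h2)

/-- A nearby starting point is joined to `b` by a short path along which `f` stays analytic and
hence continues itself. -/
theorem Continuable.eventually [LocallyPathConnectedSpace X] {φ : X → E} (hφ : Continuous φ)
    {f : E → ℂ} {b : X} (h : Continuable φ f b) (hf : AnalyticAt ℂ f (φ b)) :
    ∀ᶠ x in 𝓝 b, Continuable φ f x := by
  have hN : ∀ᶠ x in 𝓝 b, AnalyticAt ℂ f (φ x) :=
    hφ.continuousAt.eventually hf.eventually_analyticAt
  obtain ⟨U, ⟨hU, hUc⟩, hUN⟩ := (path_connected_basis b).mem_iff.1 hN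
  filter_upwards [hU] with x hx
  obtain ⟨p, hp⟩ := hUc.joinedIn b (mem_of_mem_nhds hU) x hx
  exact h.move hφ (ContinuesTo.const (γ := fun t => φ (p t)) fun t => hUN (hp t))

/-- **Monodromy theorem**: continuation along homotopic paths leads to the same germ. -/
theorem Continuable.eventuallyEq_of_homotopic {φ : X → E} (hφ : Continuous φ) {f g g' : E → ℂ}
    {b x : X} (h : Continuable φ f b) {p q : Path b x} (hpq : p.Homotopic q)
    (hp : ContinuesTo f (fun t => φ (p t)) g) (hq : ContinuesTo f (fun t => φ (q t)) g') :
    g =ᶠ[𝓝 (φ x)] g' := by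
  obtain ⟨H⟩ := hpq
  have := locallyConnectedSpace_unitInterval
  choose k hk using fun s : I => h x (H.eval s)
  choose G hG hG0 hG1 using hk
  have hcont : Continuous (Function.uncurry fun (s : I) (t : I) => φ (H.eval s t)) :=
    hφ.comp H.continuous
  -- The end germ is locally constant in the homotopy parameter.
  have key : ∀ s : I, ∀ᶠ s' in 𝓝 s, G s' 1 =ᶠ[𝓝 (φ x)] G s 1 := by
    intro s
    have := GermContinuation.eventuallyEq_nearby (v₀ := s) (H := fun s t => φ (H.eval s t))
      (G := G) (fun t => hcont.continuousAt)
      (Eventually.of_forall fun v => by fun_prop) (Eventually.of_forall hG) (t₀ := 0)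
      (Eventually.of_forall fun v => by
        have h1 := hG0 v
        have h2 := hG0 s
        simp only [Path.source] at h1 h2 ⊢
        exact h1.trans h2.symm) 1
    simpa using this
  have e0 : (fun t => φ (H.eval 0 t)) = fun t => φ (p t) := by simp
  have e1 : (fun t => φ (H.eval 1 t)) = fun t => φ (q t) := by simp
  have h0 : G 0 1 =ᶠ[𝓝 (φ x)] g := by
    have hc : ContinuesTo f (fun t => φ (H.eval 0 t)) (G 0 1) :=
      ⟨G 0, hG 0, hG0 0, EventuallyEq.rfl⟩
    rw [e0] at hc
    simpa using hc.unique (by fun_prop) hp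
  have h1 : G 1 1 =ᶠ[𝓝 (φ x)] g' := by
    have hc : ContinuesTo f (fun t => φ (H.eval 1 t)) (G 1 1) :=
      ⟨G 1, hG 1, hG0 1, EventuallyEq.rfl⟩
    rw [e1] at hc
    simpa using hc.unique (by fun_prop) hq
  have := forall_of_eventually_iff (p := fun s => G s 1 =ᶠ[𝓝 (φ x)] g)
    (fun s => (key s).mono fun s' hs' => ⟨fun h => hs'.symm.trans h, fun h => hs'.trans h⟩) h0 1
  exact this.symm.trans h1

/-! ### Continuation of primitives of closed one-forms -/

section Primitive

variable {n : ℕ} {γ : I → Fin n → ℂ} {ω : I → (Fin n → ℂ) → (Fin n → ℂ) →L[ℂ] ℂ}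

/-- Complex differentiability near the point gives continuity and separate holomorphy, so Osgood's
lemma applies. -/
theorem analyticAt_of_eventually_hasFDerivAt {f : (Fin n → ℂ) → ℂ}
    {f' : (Fin n → ℂ) → (Fin n → ℂ) →L[ℂ] ℂ} {x : Fin n → ℂ}
    (h : ∀ᶠ v in 𝓝 x, HasFDerivAt f (f' v) v) : AnalyticAt ℂ f x := by
  refine analyticAt_of_separately n h
    (fun v hv => HasFDerivAt.continuousAt hv |>.continuousWithinAt) fun v hv i => ?_
  have hv' : HasFDerivAt f (f' v) (Function.update v i (v i)) := by
    rw [Function.update_eq_self]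
    exact hv
  exact (hv'.comp (v i) (hasFDerivAt_update v (v i))).differentiableAt

/-- A closed holomorphic 1-form has a primitive near every point. -/
theorem exists_primitive_of_closed {η : (Fin n → ℂ) → (Fin n → ℂ) →L[ℂ] ℂ} {x : Fin n → ℂ}
    (hη : AnalyticAt ℂ η x) (hc : ∀ᶠ v in 𝓝 x, ∀ a b, fderiv ℂ η v a b = fderiv ℂ η v b a) :
    ∃ P : (Fin n → ℂ) → ℂ, ∃ r > 0, ∀ v ∈ Metric.ball x r,
      AnalyticAt ℂ P v ∧ HasFDerivAt P (η v) v := by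
  obtain ⟨r, hr, hr'⟩ := Metric.eventually_nhds_iff_ball.1 (hη.eventually_analyticAt.and hc)
  -- The Poincaré lemma on a ball. It takes a real derivative of `η`, and the primitive it yields
  -- has the complex derivative `η`.
  obtain ⟨P, hP⟩ := (convex_ball x r).exists_forall_hasFDerivWithinAt_of_hasFDerivWithinAt_symmetric
    (ω := η) (dω := fun v => (fderiv ℂ η v).restrictScalars ℝ)
    (fun v hv => (hr' v hv).1.differentiableAt.hasFDerivAt.restrictScalars ℝ |>.hasFDerivWithinAt)
    fun v hv a _ b _ => (hr' v hv).2 a b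
  replace hP : ∀ v ∈ Metric.ball x r, HasFDerivAt P (η v) v := fun v hv =>
    (hP v hv).hasFDerivAt (Metric.isOpen_ball.mem_nhds hv)
  exact ⟨P, r, hr, fun v hv => ⟨analyticAt_of_eventually_hasFDerivAt
    (mem_of_superset (Metric.isOpen_ball.mem_nhds hv) hP), hP v hv⟩⟩

/-- The antisymmetric part of the derivative of `ω t` is itself a continued family of analytic
germs. At the start it vanishes by the symmetry of second derivatives of `f`, hence it vanishes
along the whole path. -/
theorem GermContinuation.closed (hγ : Continuous γ) (hω : GermContinuation γ ω)
    {f : (Fin n → ℂ) → ℂ} (hf : AnalyticAt ℂ f (γ 0)) (h0 : fderiv ℂ f =ᶠ[𝓝 (γ 0)] ω 0) (t : I) :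
    ∀ᶠ v in 𝓝 (γ t), ∀ a b, fderiv ℂ (ω t) v a b = fderiv ℂ (ω t) v b a := by
  let L : ((Fin n → ℂ) →L[ℂ] (Fin n → ℂ) →L[ℂ] ℂ) →L[ℂ] (Fin n → ℂ) →L[ℂ] (Fin n → ℂ) →L[ℂ] ℂ :=
    (ContinuousLinearMap.flipₗᵢ ℂ (Fin n → ℂ) (Fin n → ℂ) ℂ).toContinuousLinearEquiv
  let D : I → (Fin n → ℂ) → (Fin n → ℂ) →L[ℂ] (Fin n → ℂ) →L[ℂ] ℂ :=
    fun t v => fderiv ℂ (ω t) v - L (fderiv ℂ (ω t) v)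
  have hD : GermContinuation γ D := by
    refine ⟨fun t => ?_, fun t => ?_⟩
    · have hL := ContinuousLinearMap.analyticAt (𝕜 := ℂ)
        (E := (Fin n → ℂ) →L[ℂ] (Fin n → ℂ) →L[ℂ] ℂ)
        (F := (Fin n → ℂ) →L[ℂ] (Fin n → ℂ) →L[ℂ] ℂ) L (fderiv ℂ (ω t) (γ t))
      have hc : AnalyticAt ℂ (fun v => L (fderiv ℂ (ω t) v)) (γ t) := hL.comp (hω.1 t).fderiv
      exact (hω.1 t).fderiv.sub hc
    · filter_upwards [hω.2 t] with t' ht'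
      filter_upwards [ht'.fderiv (𝕜 := ℂ)] with v hv
      simp only [D, hv]
  have hD0 : D 0 =ᶠ[𝓝 (γ 0)] fun _ => 0 := by
    filter_upwards [hf.eventually_analyticAt, h0.fderiv (𝕜 := ℂ)] with v hv hv'
    have hs := (hv.contDiffAt (n := ⊤)).isSymmSndFDerivAt le_top
    ext a b
    simp only [D, ← hv', L]
    simp [hs.eq a b]
  filter_upwards [GermContinuation.eventuallyEq hγ hD
    (GermContinuation.const fun _ => analyticAt_const) hD0 t] with v hv a b
  have := congrArg (fun T => T a b) hv
  simpa [D, L, sub_eq_zero] using this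

/-- If the differential of a germ can be continued along a path, so can the germ. -/
theorem exists_continuesTo_of_fderiv (hγ : Continuous γ) (hω : GermContinuation γ ω)
    {f : (Fin n → ℂ) → ℂ} (hf : AnalyticAt ℂ f (γ 0)) (h0 : fderiv ℂ f =ᶠ[𝓝 (γ 0)] ω 0) :
    ∃ g, ContinuesTo f γ g := by
  have hloc : ∀ t, ∃ P : (Fin n → ℂ) → ℂ, ∃ U : Set I, IsOpen U ∧ t ∈ U ∧ ∀ s ∈ U,
      AnalyticAt ℂ P (γ s) ∧ fderiv ℂ P =ᶠ[𝓝 (γ s)] ω s := by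
    intro t
    obtain ⟨P, r, hr, hP⟩ := exists_primitive_of_closed (hω.1 t) (hω.closed hγ hf h0 t)
    obtain ⟨U, hU, hUo, htU⟩ := mem_nhds_iff.1
      ((hω.2 t).and (hγ.continuousAt.eventually (Metric.ball_mem_nhds (γ t) hr)))
    refine ⟨P, U, hUo, htU, fun s hs => ⟨(hP _ (hU hs).2).1, ?_⟩⟩
    filter_upwards [(hU hs).1, Metric.isOpen_ball.mem_nhds (hU hs).2] with v hv hv'
    rw [(hP v hv').2.fderiv, hv]
  choose P U hUo hU hP using hloc
  obtain ⟨τ, hτ0, hτm, ⟨N, hN⟩, hτ⟩ := exists_monotone_Icc_subset_open_cover_unitInterval hUo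
    fun t _ => Set.mem_iUnion.2 ⟨t, hU t⟩
  -- The path is stopped at `τ k`, so that every partial continuation is a family over the whole
  -- interval; since `τ N = 1`, the `N`-th one belongs to the full path.
  have main : ∀ k, ∃ G : I → (Fin n → ℂ) → ℂ, IsContinuation (fun s => γ (min s (τ k))) G ∧
      (∀ s, fderiv ℂ (G s) =ᶠ[𝓝 (γ (min s (τ k)))] ω (min s (τ k))) ∧
      G 0 =ᶠ[𝓝 (γ 0)] f := by
    intro k
    induction k with
    | zero =>
      have hmin : ∀ s : I, min s (τ 0) = 0 := fun s => by
        rw [hτ0]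
        exact min_eq_right s.2.1
      refine ⟨fun _ => f, GermContinuation.const fun s => ?_, fun s => ?_, EventuallyEq.rfl⟩
      · rwa [hmin]
      · rwa [hmin]
    | succ k ih =>
      obtain ⟨G, hG, hGω, hG0⟩ := ih
      obtain ⟨i, hi⟩ := hτ k
      have hle : τ k ≤ τ (k + 1) := hτm (Nat.le_succ k)
      have hGk := hG.1 (τ k)
      have hGωk := hGω (τ k)
      simp only [min_self] at hGk hGωk
      -- With this constant the new primitive has the value of the old germ at `γ (τ k)`; having
      -- equal differentials, the two agree nearby.
      set c := G (τ k) (γ (τ k)) - P i (γ (τ k))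
      let h : (Fin n → ℂ) → ℂ := fun v => P i v + c
      have hPi : ∀ s, τ k ≤ s → min s (τ (k + 1)) ∈ U i := fun s hs =>
        hi ⟨le_min hs hle, min_le_right _ _⟩
      have hk := hP i (τ k) (hi ⟨le_rfl, hle⟩)
      have hjoin : h =ᶠ[𝓝 (γ (τ k))] G (τ k) := by
        obtain ⟨r, hr, hr'⟩ := Metric.eventually_nhds_iff_ball.1
          ((hk.1.eventually_analyticAt.and hGk.eventually_analyticAt).and (hk.2.and hGωk))
        refine mem_of_superset (Metric.ball_mem_nhds _ hr) fun v hv => ?_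
        refine (convex_ball (γ (τ k)) r).eqOn_of_fderivWithin_eq (𝕜 := ℂ)
          (fun u hu => ((hr' u hu).1.1.differentiableAt.add_const c).differentiableWithinAt)
          (fun u hu => (hr' u hu).1.2.differentiableAt.differentiableWithinAt)
          Metric.isOpen_ball.uniqueDiffOn (fun u hu => ?_) (Metric.mem_ball_self hr) ?_ hv
        · rw [fderivWithin_of_isOpen Metric.isOpen_ball hu,
            fderivWithin_of_isOpen Metric.isOpen_ball hu, fderiv_add_const, (hr' u hu).2.1,
            (hr' u hu).2.2]
        · simp [c]
      classical
      refine ⟨fun s => if s ≤ τ k then G s else h, ⟨fun s => ?_, fun s => ?_⟩, fun s => ?_, ?_⟩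
      · by_cases hs : s ≤ τ k
        · have := hG.1 s
          simp only [min_eq_left hs, min_eq_left (hs.trans hle), if_pos hs] at this ⊢
          exact this
        · simp only [if_neg hs]
          exact (hP i _ (hPi s (le_of_not_ge hs))).1.add analyticAt_const
      · rcases lt_trichotomy s (τ k) with hs | hs | hs
        · filter_upwards [hG.2 s, Iio_mem_nhds hs] with s' h1 (h2 : s' < τ k)
          simp only [min_eq_left h2.le, min_eq_left (h2.le.trans hle), if_pos hs.le,
            if_pos h2.le] at h1 ⊢
          exact h1
        · have hcont : Continuous fun s' => γ (min s' (τ (k + 1))) := by fun_prop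
          have hev : ∀ᶠ s' in 𝓝 s, h =ᶠ[𝓝 (γ (min s' (τ (k + 1))))] G (τ k) := by
            refine hcont.continuousAt.eventually (p := fun v => h =ᶠ[𝓝 v] G (τ k)) ?_
            simp only [hs, min_eq_left hle]
            exact eventually_eventually_nhds.2 hjoin
          filter_upwards [hG.2 s, hev] with s' h1 h2
          rw [if_pos hs.le, hs]
          by_cases h3 : s' ≤ τ k
          · simp only [min_eq_left h3, min_eq_left (h3.trans hle), if_pos h3, hs] at h1 ⊢
            exact h1
          · rw [if_neg h3]
            exact h2
        · filter_upwards [Ioi_mem_nhds hs] with s' (h2 : τ k < s')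
          rw [if_neg hs.not_ge, if_neg h2.not_ge]
      · by_cases hs : s ≤ τ k
        · have := hGω s
          simp only [min_eq_left hs, min_eq_left (hs.trans hle), if_pos hs] at this ⊢
          exact this
        · simp only [if_neg hs]
          have := (hP i _ (hPi s (le_of_not_ge hs))).2
          filter_upwards [this] with v hv
          rw [← hv, fderiv_add_const]
      · have h0k : (0 : I) ≤ τ k := (τ k).2.1
        simpa only [if_pos h0k] using hG0
  obtain ⟨G, hG, -, hG0⟩ := main N
  have hmin : ∀ s : I, min s (τ N) = s := fun s => by
    rw [hN N le_rfl]
    exact min_eq_left s.2.2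
  simp only [hmin] at hG
  exact ⟨G 1, G, hG, hG0, EventuallyEq.rfl⟩

end Primitive

end Continuation

/-! ### Products of consecutive coordinates -/

section Segments

variable {n : ℕ}

/-- The `i`-th coordinate of a vector, counted from `0`, and `1` beyond the end. -/
def coord (x : Fin n → ℂ) (i : ℕ) : ℂ := if h : i < n then x ⟨i, h⟩ else 1

@[simp] theorem coord_val (x : Fin n → ℂ) (i : Fin n) : coord x i = x i := by simp [coord]

theorem coord_of_lt (x : Fin n → ℂ) {i : ℕ} (h : i < n) : coord x i = x ⟨i, h⟩ := dif_pos h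

theorem coord_of_le (x : Fin n → ℂ) {i : ℕ} (h : n ≤ i) : coord x i = 1 := dif_neg h.not_gt

/-- Because `coord` is `1` past the end, the product runs over an interval of natural numbers that
need not respect `n`. With lower index `a + 1`, the numbers `a` and `b` become the break points that
bound the segment. -/
theorem seg_succ (x : Fin n → ℂ) (a b : ℕ) : seg x (a + 1) b = ∏ i ∈ Finset.Ico a b, coord x i := by
  have h1 : seg x (a + 1) b =
      ∏ i ∈ (Finset.univ.filter fun i : Fin n => a + 1 ≤ i.val + 1 ∧ i.val + 1 ≤ b).map
        Fin.valEmbedding, coord x i := by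
    rw [Finset.prod_map]
    exact Finset.prod_congr rfl fun i _ => (coord_val x i).symm
  rw [h1]
  refine Finset.prod_subset (fun i hi => ?_) fun i hi hi' => ?_
  · simp only [Finset.mem_map, Finset.mem_filter, Finset.mem_univ, true_and] at hi
    obtain ⟨j, hj, rfl⟩ := hi
    simp only [Fin.valEmbedding_apply, Finset.mem_Ico]
    omega
  · refine coord_of_le x (not_lt.1 fun hn => hi' ?_)
    simp only [Finset.mem_map, Finset.mem_filter, Finset.mem_univ, true_and]
    rw [Finset.mem_Ico] at hi
    exact ⟨⟨i, hn⟩, by simp; omega, rfl⟩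

theorem seg_self (x : Fin n → ℂ) (a : ℕ) : seg x (a + 1) a = 1 := by simp [seg_succ]

theorem seg_mul_coord (x : Fin n → ℂ) {a b : ℕ} (h : a ≤ b) :
    seg x (a + 1) (b + 1) = seg x (a + 1) b * coord x b := by
  rw [seg_succ, seg_succ, Finset.prod_Ico_succ_top h]

theorem seg_mul_seg (x : Fin n → ℂ) {a b c : ℕ} (h : a ≤ b) (h' : b ≤ c) :
    seg x (a + 1) b * seg x (b + 1) c = seg x (a + 1) c := by
  simp only [seg_succ]
  exact Finset.prod_Ico_consecutive _ h h'

theorem seg_tail (x : Fin (n + 1) → ℂ) (a b : ℕ) :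
    seg x (a + 2) (b + 1) = seg (Fin.tail x) (a + 1) b := by
  rw [show a + 2 = a + 1 + 1 from rfl, seg_succ, seg_succ, ← Finset.prod_Ico_add']
  refine Finset.prod_congr rfl fun i _ => ?_
  simp only [coord, Fin.tail, add_lt_add_iff_right]
  rfl

theorem prod_eq_seg (x : Fin n → ℂ) : ∏ i, x i = seg x 1 n := by
  rw [show 1 = 0 + 1 from rfl, seg_succ, ← Finset.range_eq_Ico, Finset.prod_range]
  simp

theorem analyticAt_seg (a b : ℕ) (x : Fin n → ℂ) : AnalyticAt ℂ (fun x => seg x a b) x := by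
  refine Finset.analyticAt_fun_prod _ fun i _ => ?_
  exact (ContinuousLinearMap.proj (R := ℂ) (φ := fun _ : Fin n => ℂ) i).analyticAt x

@[fun_prop] theorem continuous_seg (a b : ℕ) : Continuous fun x : Fin n → ℂ => seg x a b := by
  unfold seg
  fun_prop

/-- The domain of absolute convergence of the multiple logarithm. -/
def convDomain (n : ℕ) : Set (Fin n → ℂ) := {x | ∀ a < n, ‖seg x (a + 1) n‖ < 1}

theorem isOpen_convDomain (n : ℕ) : IsOpen (convDomain n) := by
  have : convDomain n = ⋂ a : Fin n, {x | ‖seg x (a.val + 1) n‖ < 1} := by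
    ext x
    simp [convDomain, Fin.forall_iff]
  rw [this]
  exact isOpen_iInter_of_finite fun a => isOpen_lt (by fun_prop) continuous_const

end Segments

/-! ### Convergence and partial derivatives of the power series -/

section Series

/-- Taking the power `k 0` out of every factor leaves a monomial in the remaining coordinates with
exponents `k i.succ - k 0`. Iterated, this writes the monomial as a product of powers of the tail
products `x_j ⋯ x_n`, with the gaps of `k` as exponents; the gaps up to the index `i` add up to `k
i`. -/
theorem norm_prod_pow_le {ρ : ℝ} (hρ : 0 ≤ ρ) (hρ1 : ρ ≤ 1) : ∀ {n : ℕ} (x : Fin n → ℂ)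
    (k : Fin n → ℕ), Monotone k → (∀ a < n, ‖seg x (a + 1) n‖ ≤ ρ) →
    ‖∏ i, x i ^ k i‖ ≤ 1 ∧ ∀ i, ‖∏ i, x i ^ k i‖ ≤ ρ ^ k i := by
  intro n
  induction n with
  | zero => intro x k _ _; simp
  | succ n ih =>
    intro x k hk hx
    have hle : ∀ i : Fin n, k 0 ≤ k i.succ := fun i => hk (Fin.zero_le _)
    have key : ∏ i, x i ^ k i =
        (∏ i, x i) ^ k 0 * ∏ i, Fin.tail x i ^ (k i.succ - k 0) := by
      rw [Fin.prod_univ_succ, Fin.prod_univ_succ (f := x), mul_pow, mul_assoc,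
        ← Finset.prod_pow, ← Finset.prod_mul_distrib]
      congr 1
      refine Finset.prod_congr rfl fun i _ => ?_
      rw [Fin.tail, ← pow_add, Nat.add_sub_cancel' (hle i)]
    obtain ⟨h1, h2⟩ := ih (Fin.tail x) (fun i => k i.succ - k 0)
      (fun i j hij => Nat.sub_le_sub_right (hk (Fin.succ_le_succ_iff.2 hij)) _) (fun a ha => by
        rw [← seg_tail]
        exact hx (a + 1) (by omega))
    have h3 : ‖∏ i, x i‖ ≤ ρ := by
      rw [prod_eq_seg]
      exact hx 0 (by omega)
    have h4 : ‖∏ i, x i‖ ^ k 0 ≤ ρ ^ k 0 := pow_le_pow_left₀ (norm_nonneg _) h3 _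
    have h5 : ‖∏ i, x i ^ k i‖ ≤ ρ ^ k 0 := by
      rw [key, norm_mul, norm_pow]
      exact (mul_le_mul h4 h1 (norm_nonneg _) (by positivity)).trans (mul_one _).le
    refine ⟨h5.trans (pow_le_one₀ hρ hρ1), Fin.cases h5 fun i => ?_⟩
    rw [key, norm_mul, norm_pow]
    refine (mul_le_mul h4 (h2 i) (norm_nonneg _) (by positivity)).trans_eq ?_
    rw [← pow_add, Nat.add_sub_cancel' (hle i)]

theorem summable_prod_pow {r : ℝ} (hr : 0 ≤ r) (hr1 : r < 1) (n : ℕ) :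
    Summable fun k : Fin n → ℕ => ∏ i, r ^ k i := by
  induction n with
  | zero => exact Summable.of_finite
  | succ n ih =>
    have h := (summable_geometric_of_lt_one hr hr1).mul_of_nonneg ih
      (fun k => by positivity) (fun k => Finset.prod_nonneg fun i _ => by positivity)
    rw [← (Fin.consEquiv fun _ : Fin (n + 1) => ℕ).summable_iff]
    refine h.congr fun q => ?_
    simp [Fin.consEquiv, Fin.prod_univ_succ]

/-- The exponents that occur in the power series of the multiple logarithm. -/
abbrev Exponent (n : ℕ) := {k : Fin n → ℕ // StrictMono k ∧ ∀ i, 0 < k i}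

/-- The exponents below `K`. -/
noncomputable def exponentsBelow (n K : ℕ) : Finset (Fin n → ℕ) :=
  open Classical in
  (Fintype.piFinset fun _ => Finset.range K).filter fun k => StrictMono k ∧ ∀ i, 0 < k i

theorem mem_exponentsBelow {n K : ℕ} {k : Fin n → ℕ} :
    k ∈ exponentsBelow n K ↔ (∀ i, k i < K) ∧ StrictMono k ∧ ∀ i, 0 < k i := by
  simp [exponentsBelow]

/-- The partial sum of the multiple logarithm over the exponents below `K`. -/
noncomputable def partialLog : (n K : ℕ) → (Fin n → ℂ) → ℂ
  | 0, _, _ => 1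
  | n + 1, K, x =>
    ∑ l ∈ Finset.range K, x (Fin.last n) ^ l / (l : ℂ) * partialLog n l (Fin.init x)

theorem strictMono_snoc {n : ℕ} {k : Fin n → ℕ} {l : ℕ} :
    StrictMono (Fin.snoc k l : Fin (n + 1) → ℕ) ↔ (∀ i, k i < l) ∧ StrictMono k := by
  constructor
  · intro h
    refine ⟨fun i => ?_, fun i j hij => ?_⟩
    · simpa using h (Fin.castSucc_lt_last i)
    · simpa using h (Fin.castSucc_lt_castSucc_iff.2 hij)
  · rintro ⟨h1, h2⟩ i j hij
    induction j using Fin.lastCases with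
    | last =>
      induction i using Fin.lastCases with
      | last => exact absurd hij (lt_irrefl _)
      | cast i => simpa using h1 i
    | cast j =>
      induction i using Fin.lastCases with
      | last => exact absurd (hij.trans (Fin.castSucc_lt_last j)) (lt_irrefl _)
      | cast i => simpa using h2 (Fin.castSucc_lt_castSucc_iff.1 hij)

theorem partialLog_eq_sum (n K : ℕ) (x : Fin n → ℂ) :
    partialLog n K x = ∑ k ∈ exponentsBelow n K, ∏ i, x i ^ k i / (k i : ℂ) := by
  induction n generalizing K with
  | zero =>
    have : exponentsBelow 0 K = {Fin.elim0} := by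
      ext k
      simp [mem_exponentsBelow, Subsingleton.elim k Fin.elim0, Subsingleton.strictMono]
    simp [this, partialLog]
  | succ n ih =>
    -- The recursive sum includes `l = 0`, where division by zero makes the term vanish.
    have h0 : partialLog (n + 1) K x = ∑ l ∈ (Finset.range K).filter (0 < ·),
        x (Fin.last n) ^ l / (l : ℂ) * partialLog n l (Fin.init x) := by
      rw [partialLog, Finset.sum_filter_of_ne]
      intro l _ hl
      refine Nat.pos_of_ne_zero fun h => hl ?_
      simp [h]
    rw [h0]
    simp only [ih, Finset.mul_sum]
    rw [Finset.sum_sigma']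
    refine Finset.sum_bij' (fun q _ => (Fin.snoc q.2 q.1 : Fin (n + 1) → ℕ))
      (fun k _ => ⟨k (Fin.last n), Fin.init k⟩) ?_ ?_ ?_ ?_ ?_
    · rintro ⟨l, k⟩ h
      simp only [Finset.mem_sigma, Finset.mem_filter, Finset.mem_range, mem_exponentsBelow] at h
      obtain ⟨⟨h1, h2⟩, h3, h4, h5⟩ := h
      refine mem_exponentsBelow.2 ⟨Fin.lastCases (by simpa using h1) fun i => ?_,
        strictMono_snoc.2 ⟨h3, h4⟩, Fin.lastCases (by simpa using h2) fun i => by simpa using h5 i⟩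
      simpa using (h3 i).trans h1
    · intro k h
      obtain ⟨h1, h2, h3⟩ := mem_exponentsBelow.1 h
      simp only [Finset.mem_sigma, Finset.mem_filter, Finset.mem_range, mem_exponentsBelow]
      exact ⟨⟨h1 _, h3 _⟩, fun i => h2 (Fin.castSucc_lt_last i),
        fun i j hij => h2 (Fin.castSucc_lt_castSucc_iff.2 hij), fun i => h3 _⟩
    · rintro ⟨l, k⟩ _
      simp
    · intro k _
      simp
    · rintro ⟨l, k⟩ _
      rw [Fin.prod_univ_castSucc]
      simp [Fin.init, mul_comm]

/-- On a neighbourhood of each point of the domain of convergence, the terms of the series are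
dominated by a summable family. -/
theorem exists_summable_bound {n : ℕ} {x : Fin n → ℂ} (hx : x ∈ convDomain n) :
    ∃ u : Exponent n → ℝ, Summable u ∧ ∃ U ∈ 𝓝 x, ∀ k : Exponent n, ∀ v ∈ U,
      ‖∏ i, v i ^ k.1 i / (k.1 i : ℂ)‖ ≤ u k := by
  obtain ⟨ρ, hρ0, hρ1, hρ⟩ : ∃ ρ : ℝ, 0 < ρ ∧ ρ < 1 ∧ ∀ a < n, ‖seg x (a + 1) n‖ < ρ := by
    have : ∀ᶠ ρ in 𝓝[<] (1 : ℝ), 0 < ρ ∧ ρ < 1 ∧ ∀ a : Fin n, ‖seg x (a.val + 1) n‖ < ρ := by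
      have h1 : ∀ᶠ ρ in 𝓝[<] (1 : ℝ), 0 < ρ := nhdsWithin_le_nhds (lt_mem_nhds one_pos)
      have h2 : ∀ᶠ ρ in 𝓝[<] (1 : ℝ), ρ < 1 := self_mem_nhdsWithin
      exact h1.and (h2.and (eventually_all.2 fun a =>
        nhdsWithin_le_nhds (lt_mem_nhds (hx a a.2))))
    obtain ⟨ρ, h1, h2, h3⟩ := this.exists
    exact ⟨ρ, h1, h2, fun a ha => h3 ⟨a, ha⟩⟩
  rcases Nat.eq_zero_or_pos n with rfl | hn
  · exact ⟨fun _ => 1, Summable.of_finite, Set.univ, univ_mem, fun k v _ => by simp⟩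
  -- The monomial is bounded by `ρ ^ k i` for each of the `n` indices `i`, hence by the geometric
  -- mean of these bounds, which is `∏ r ^ k i`. The latter is summable over all exponents.
  set r : ℝ := ρ ^ ((n : ℝ)⁻¹)
  have hr : r ^ n = ρ := Real.rpow_inv_natCast_pow hρ0.le hn.ne'
  have hr0 : 0 ≤ r := by positivity
  have hr1 : r < 1 := by
    refine lt_of_not_ge fun h => hρ1.not_ge ?_
    rw [← hr]
    exact one_le_pow₀ h
  refine ⟨fun k => ∏ i, r ^ k.1 i, (summable_prod_pow hr0 hr1 n).comp_injective
    Subtype.val_injective, {v | ∀ a : Fin n, ‖seg v (a.val + 1) n‖ < ρ}, ?_, ?_⟩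
  · refine eventually_all.2 fun a => ?_
    have hc : Continuous fun v : Fin n → ℂ => ‖seg v (a.val + 1) n‖ := by fun_prop
    exact hc.continuousAt.eventually (gt_mem_nhds (hρ a a.2))
  · rintro ⟨k, hk, hk0⟩ v hv
    have hb := (norm_prod_pow_le hρ0.le hρ1.le v k hk.monotone
      fun a ha => (hv ⟨a, ha⟩).le).2
    have h1 : ‖∏ i, v i ^ k i / (k i : ℂ)‖ ≤ ‖∏ i, v i ^ k i‖ := by
      rw [norm_prod, norm_prod]
      refine Finset.prod_le_prod (fun i _ => norm_nonneg _) fun i _ => ?_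
      rw [norm_div]
      refine div_le_self (norm_nonneg _) ?_
      rw [Complex.norm_natCast]
      exact_mod_cast hk0 i
    refine h1.trans (le_of_pow_le_pow_left₀ hn.ne' (Finset.prod_nonneg fun i _ => by positivity) ?_)
    calc ‖∏ i, v i ^ k i‖ ^ n = ∏ _i : Fin n, ‖∏ i, v i ^ k i‖ := by simp
      _ ≤ ∏ i, ρ ^ k i := Finset.prod_le_prod (fun i _ => norm_nonneg _) fun i _ => hb i
      _ = (∏ i, r ^ k i) ^ n := by
        rw [← Finset.prod_pow]
        refine Finset.prod_congr rfl fun i _ => ?_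
        rw [← hr, ← pow_mul, ← pow_mul, mul_comm]

/-- The Weierstrass test with the local bounds of `exists_summable_bound`; the sets of exponents
below `K` exhaust all exponents. -/
theorem tendstoLocallyUniformlyOn_partialLog (n : ℕ) :
    TendstoLocallyUniformlyOn (partialLog n) (multiLog n) atTop (convDomain n) := by
  classical
  intro w hw x hx
  obtain ⟨u, hu, U, hU, hb⟩ := exists_summable_bound hx
  let T : ℕ → Finset (Exponent n) := fun K => Finset.subtype _ (exponentsBelow n K)
  have hT : Tendsto T atTop atTop := by
    refine tendsto_atTop_finset_of_monotone (fun K K' h k hk => ?_) fun k => ?_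
    · simp only [T, Finset.mem_subtype, mem_exponentsBelow] at hk ⊢
      exact ⟨fun i => (hk.1 i).trans_le h, hk.2⟩
    · refine ⟨∑ i, k.1 i + 1, ?_⟩
      simp only [T, Finset.mem_subtype, mem_exponentsBelow]
      exact ⟨fun i => Nat.lt_succ_of_le (Finset.single_le_sum (fun _ _ => Nat.zero_le _)
        (Finset.mem_univ i)), k.2⟩
  have h := (tendstoUniformlyOn_tsum hu hb)
  have hsum : ∀ K v, ∑ k ∈ T K, ∏ i, v i ^ k.1 i / (k.1 i : ℂ) = partialLog n K v := by
    intro K v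
    rw [partialLog_eq_sum, Finset.sum_subtype_of_mem
      (fun k : Fin n → ℕ => ∏ i, v i ^ k i / (k i : ℂ))]
    intro k hk
    exact (mem_exponentsBelow.1 hk).2
  have hlim : ∀ v, multiLog n v = ∑' k : Exponent n, ∏ i, v i ^ k.1 i / (k.1 i : ℂ) := by
    intro v
    simp [multiLog, polylogSeries]
  refine ⟨U, mem_nhdsWithin_of_mem_nhds hU, ?_⟩
  filter_upwards [hT.eventually (h w hw)] with K hK v hv
  rw [hlim, ← hsum]
  exact hK v hv

theorem tendsto_partialLog {n : ℕ} {x : Fin n → ℂ} (hx : x ∈ convDomain n) :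
    Tendsto (fun K => partialLog n K x) atTop (𝓝 (multiLog n x)) :=
  (tendstoLocallyUniformlyOn_partialLog n).tendsto_at hx

theorem differentiable_partialLog (n K : ℕ) : Differentiable ℂ (partialLog n K) := by
  have : partialLog n K = fun x => ∑ k ∈ exponentsBelow n K, ∏ i, x i ^ k i / (k i : ℂ) :=
    funext fun x => partialLog_eq_sum n K x
  rw [this]
  fun_prop

theorem differentiable_partialLog_update (n K : ℕ) (x : Fin n → ℂ) (j : Fin n) :
    Differentiable ℂ fun t => partialLog n K (Function.update x j t) := fun t =>
  (differentiable_partialLog n K _).comp t (hasFDerivAt_update x t).differentiableAt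

theorem isOpen_update_convDomain {n : ℕ} (x : Fin n → ℂ) (j : Fin n) :
    IsOpen {t | Function.update x j t ∈ convDomain n} := by
  have hc : Continuous fun t => Function.update x j t := by fun_prop
  exact (isOpen_convDomain n).preimage hc

theorem tendstoLocallyUniformlyOn_partialLog_update {n : ℕ} (x : Fin n → ℂ) (j : Fin n) :
    TendstoLocallyUniformlyOn (fun K t => partialLog n K (Function.update x j t))
      (fun t => multiLog n (Function.update x j t)) atTop
      {t | Function.update x j t ∈ convDomain n} := by
  have hc : Continuous fun t => Function.update x j t := by fun_prop
  exact (tendstoLocallyUniformlyOn_partialLog n).comp (fun t => Function.update x j t)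
    (fun t ht => ht) hc.continuousOn

/-- Locally uniform limits of polynomials are continuous and separately holomorphic, so Osgood's
lemma applies. -/
theorem analyticAt_multiLog {n : ℕ} {x : Fin n → ℂ} (hx : x ∈ convDomain n) :
    AnalyticAt ℂ (multiLog n) x := by
  refine analyticAt_of_separately n ((isOpen_convDomain n).mem_nhds hx) ?_ fun v hv i => ?_
  · exact (tendstoLocallyUniformlyOn_partialLog n).continuousOn
      (Frequently.of_forall fun K => (differentiable_partialLog n K).continuous.continuousOn)
  · refine ((tendstoLocallyUniformlyOn_partialLog_update v i).differentiableOn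
      (Eventually.of_forall fun K => (differentiable_partialLog_update n K v i).differentiableOn)
      (isOpen_update_convDomain v i)).differentiableAt ((isOpen_update_convDomain v i).mem_nhds ?_)
    simpa using hv

/-- The partial derivative in the direction of the `j`-th coordinate. -/
noncomputable def partialDeriv {n : ℕ} (f : (Fin n → ℂ) → ℂ) (j : Fin n) (x : Fin n → ℂ) : ℂ :=
  deriv (fun t => f (Function.update x j t)) (x j)

theorem tendsto_partialDeriv_partialLog {n : ℕ} {x : Fin n → ℂ} (hx : x ∈ convDomain n)
    (j : Fin n) : Tendsto (fun K => partialDeriv (partialLog n K) j x) atTop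
      (𝓝 (partialDeriv (multiLog n) j x)) :=
  ((tendstoLocallyUniformlyOn_partialLog_update x j).deriv
    (Eventually.of_forall fun K => (differentiable_partialLog_update n K x j).differentiableOn)
    (isOpen_update_convDomain x j)).tendsto_at (by simpa using hx)

/-- Multiply the coordinates `x_{j-1}` and `x_j` (counted from `0`) to a single one; for `j = 0`,
drop the first coordinate. -/
def merge {n : ℕ} (j : ℕ) (x : Fin (n + 1) → ℂ) : Fin n → ℂ := fun k =>
  if k.val + 1 < j then x k.castSucc
  else if k.val + 1 = j then x k.castSucc * x k.succ else x k.succ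

theorem init_merge {n : ℕ} (j : ℕ) (x : Fin (n + 2) → ℂ) :
    Fin.init (merge j x) = merge j (Fin.init x) := by
  ext k
  simp [Fin.init, merge]

theorem merge_last {n j : ℕ} (hj : j ≤ n) (x : Fin (n + 2) → ℂ) :
    merge j x (Fin.last n) = x (Fin.last (n + 1)) := by
  simp [merge, show ¬ n + 1 < j by omega, show ¬ n + 1 = j by omega]

theorem init_merge_last {n : ℕ} (x : Fin (n + 2) → ℂ) :
    Fin.init (merge (n + 1) x) = Fin.init (Fin.init x) := by
  ext k
  simp [Fin.init, merge]

theorem merge_last_last {n : ℕ} (x : Fin (n + 2) → ℂ) :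
    merge (n + 1) x (Fin.last n) = x (Fin.last n).castSucc * x (Fin.last (n + 1)) := by
  simp [merge]

/-- Differentiation cancels `1 / l` and leaves `∑ y ^ (l - 1) * partialLog n l`. Multiplication by
`1 - y` is a summation by parts: the increments of `partialLog n l` in `l`, multiplied by `y ^ l`,
are the terms of the sum at the merged point, and a boundary term at the upper end remains. -/
theorem one_sub_mul_partialDeriv_last (n K : ℕ) (x : Fin (n + 1) → ℂ) :
    (1 - x (Fin.last n)) * partialDeriv (partialLog (n + 1) K) (Fin.last n) x =
      partialLog n K (merge n x) - x (Fin.last n) ^ (K - 1) * partialLog n K (Fin.init x) := by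
  set y := x (Fin.last n)
  have hd : partialDeriv (partialLog (n + 1) K) (Fin.last n) x =
      ∑ l ∈ Finset.range K, l * y ^ (l - 1) / (l : ℂ) * partialLog n l (Fin.init x) := by
    have : HasDerivAt (fun t => partialLog (n + 1) K (Function.update x (Fin.last n) t))
        (∑ l ∈ Finset.range K, l * y ^ (l - 1) / (l : ℂ) * partialLog n l (Fin.init x)) y := by
      simp only [partialLog, Function.update_self, Fin.init_update_last]
      exact HasDerivAt.fun_sum fun l _ => ((hasDerivAt_pow l y).div_const _).mul_const _
    exact this.deriv
  rw [hd]
  clear hd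
  have hterm : ∀ K : ℕ, ((K + 1 : ℕ) : ℂ) * y ^ (K + 1 - 1) / ((K + 1 : ℕ) : ℂ) = y ^ K := by
    intro K
    rw [Nat.add_sub_cancel, mul_div_cancel_left₀]
    exact_mod_cast Nat.succ_ne_zero K
  cases n with
  | zero =>
    simp only [partialLog, mul_one]
    induction K with
    -- For `K = 0` the exponent `K - 1` truncates to `0`, and both sides vanish.
    | zero => simp
    | succ K ih =>
      rw [Finset.sum_range_succ, mul_add, ih]
      cases K with
      | zero => simp
      | succ K =>
        rw [hterm]
        simp only [Nat.add_sub_cancel]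
        ring
  | succ n =>
    have hm : ∀ K, partialLog (n + 1) K (merge (n + 1) x) = ∑ l ∈ Finset.range K,
        (x (Fin.last n).castSucc * y) ^ l / (l : ℂ) * partialLog n l (Fin.init (Fin.init x)) := by
      intro K
      simp only [partialLog, init_merge_last, merge_last_last, y]
    induction K with
    | zero => simp [partialLog]
    | succ K ih =>
      rw [Finset.sum_range_succ, mul_add, ih]
      cases K with
      | zero => simp [partialLog]
      | succ K =>
        rw [hterm, hm, hm, Finset.sum_range_succ _ (K + 1)]
        have : partialLog (n + 1) (K + 1 + 1) (Fin.init x) = partialLog (n + 1) (K + 1) (Fin.init x)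
            + x (Fin.last n).castSucc ^ (K + 1) / ((K + 1 : ℕ) : ℂ) *
              partialLog n (K + 1) (Fin.init (Fin.init x)) := by
          simp only [partialLog]
          rw [Finset.sum_range_succ _ (K + 1)]
          rfl
        rw [this]
        simp only [Nat.add_sub_cancel]
        ring

/-- The partial derivatives of the partial sums. -/
theorem one_sub_mul_partialDeriv_partialLog (n K : ℕ) (j : Fin (n + 1)) (x : Fin (n + 1) → ℂ)
    (hx : x j ≠ 0) : (1 - x j) * partialDeriv (partialLog (n + 1) K) j x =
      partialLog n K (merge j x) -
        if j = Fin.last n then x j ^ (K - 1) * partialLog n K (Fin.init x)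
        else (x j)⁻¹ * partialLog n K (merge (j + 1) x) := by
  induction n generalizing K with
  | zero =>
    obtain rfl : j = Fin.last 0 := Fin.ext (by simp)
    rw [if_pos rfl]
    exact one_sub_mul_partialDeriv_last 0 K x
  | succ n ih =>
    induction j using Fin.lastCases with
    | last =>
      rw [if_pos rfl]
      exact one_sub_mul_partialDeriv_last (n + 1) K x
    | cast j =>
      have hd : partialDeriv (partialLog (n + 2) K) j.castSucc x =
          ∑ l ∈ Finset.range K, x (Fin.last (n + 1)) ^ l / (l : ℂ) *
            partialDeriv (partialLog (n + 1) l) j (Fin.init x) := by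
        have : HasDerivAt (fun t => partialLog (n + 2) K (Function.update x j.castSucc t))
            (∑ l ∈ Finset.range K, x (Fin.last (n + 1)) ^ l / (l : ℂ) *
              partialDeriv (partialLog (n + 1) l) j (Fin.init x)) (x j.castSucc) := by
          rw [show partialLog (n + 2) K = fun x => ∑ l ∈ Finset.range K,
            x (Fin.last (n + 1)) ^ l / (l : ℂ) * partialLog (n + 1) l (Fin.init x) from rfl]
          simp only [Fin.init_update_castSucc,
            Function.update_of_ne (Fin.castSucc_lt_last j).ne']
          exact HasDerivAt.fun_sum fun l _ => (differentiable_partialLog_update (n + 1) l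
            (Fin.init x) j (x j.castSucc)).hasDerivAt.const_mul _
        exact this.deriv
      have hjn : j.val ≤ n := by omega
      have hm : ∀ i ≤ n, partialLog (n + 1) K (merge i x) = ∑ l ∈ Finset.range K,
          x (Fin.last (n + 1)) ^ l / (l : ℂ) * partialLog n l (merge i (Fin.init x)) := by
        intro i hi
        simp only [partialLog, merge_last hi, init_merge i]
      rw [hd, Finset.mul_sum, if_neg (Fin.castSucc_lt_last j).ne, Fin.val_castSucc, hm _ hjn]
      have hterm : ∀ l ∈ Finset.range K, (1 - x j.castSucc) * (x (Fin.last (n + 1)) ^ l / (l : ℂ) *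
          partialDeriv (partialLog (n + 1) l) j (Fin.init x)) =
          x (Fin.last (n + 1)) ^ l / (l : ℂ) * partialLog n l (merge j (Fin.init x)) -
          x (Fin.last (n + 1)) ^ l / (l : ℂ) * (if j = Fin.last n then
            x j.castSucc ^ (l - 1) * partialLog n l (Fin.init (Fin.init x))
            else (x j.castSucc)⁻¹ * partialLog n l (merge (j + 1) (Fin.init x))) := by
        intro l _
        rw [mul_left_comm, ← mul_sub]
        congr 1
        exact ih l j (Fin.init x) hx
      rw [Finset.sum_congr rfl hterm, Finset.sum_sub_distrib]
      congr 1
      -- If `j` is next to last, the boundary term `x_j ^ (l - 1)` combines with `x_last ^ l` to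
      -- `(x_j)⁻¹` times a power of the merged coordinate. Otherwise both terms keep their shape
      -- under the outer sum.
      by_cases hj : j = Fin.last n
      · subst hj
        simp only [if_true, Fin.val_last]
        rw [show partialLog (n + 1) K (merge (n + 1) x) = ∑ l ∈ Finset.range K,
          (x (Fin.last n).castSucc * x (Fin.last (n + 1))) ^ l / (l : ℂ) *
            partialLog n l (Fin.init (Fin.init x)) by
          simp only [partialLog, init_merge_last, merge_last_last], Finset.mul_sum]
        refine Finset.sum_congr rfl fun l _ => ?_
        rcases l with _ | l
        · simp
        · rw [Nat.add_sub_cancel, mul_pow, pow_succ (x (Fin.last n).castSucc)]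
          field_simp
      · have hj' : j.val + 1 ≤ n := by
          have : j.val ≠ n := fun h => hj (Fin.ext h)
          omega
        simp only [if_neg hj]
        rw [hm _ hj', Finset.mul_sum]
        exact Finset.sum_congr rfl fun l _ => by ring

/-- The limit of the identity for partial sums; the point is that the boundary term for the last
variable tends to zero. -/
theorem one_sub_mul_partialDeriv_multiLog {n : ℕ} (j : Fin (n + 1)) {x : Fin (n + 1) → ℂ}
    (hx : x ∈ convDomain (n + 1)) (hm : ∀ i ≤ n, merge i x ∈ convDomain n) (hx0 : x j ≠ 0) :
    (1 - x j) * partialDeriv (multiLog (n + 1)) j x = multiLog n (merge j x) -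
      if j = Fin.last n then 0 else (x j)⁻¹ * multiLog n (merge (j + 1) x) := by
  have h1 := (tendsto_partialDeriv_partialLog hx j).const_mul (1 - x j)
  refine tendsto_nhds_unique h1 ?_
  simp only [one_sub_mul_partialDeriv_partialLog _ _ _ _ hx0]
  refine (tendsto_partialLog (hm j (by omega))).sub ?_
  by_cases hj : j = Fin.last n
  · simp only [if_pos hj]
    subst hj
    set y := x (Fin.last n)
    have hopen := (isOpen_update_convDomain x (Fin.last n)).mem_nhds (x := y) (by simpa [y] using hx)
    -- Some `c > 1` keeps the point with last coordinate `c * y` in the open domain of convergence.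
    -- The terms of the convergent series there tend to zero, and the boundary term is such a term
    -- times `y⁻¹ * K * c⁻¹ ^ K`. Convergence of `partialLog n K (Fin.init x)` is not required.
    have hcont : Tendsto (fun c : ℝ => (c : ℂ) * y) (𝓝[>] 1) (𝓝 y) := by
      have : Continuous fun c : ℝ => (c : ℂ) * y := by fun_prop
      simpa using (this.tendsto 1).mono_left nhdsWithin_le_nhds
    obtain ⟨c, hc, hc1⟩ := ((hcont.eventually hopen).and self_mem_nhdsWithin).exists
    have hc1 : 1 < c := hc1
    have hc0 : 0 < c := one_pos.trans hc1
    have hlim := tendsto_partialLog hc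
    have hdiff := (hlim.comp (tendsto_add_atTop_nat 1)).sub hlim
    rw [sub_self] at hdiff
    have hterm : ∀ K : ℕ, partialLog (n + 1) (K + 1) (Function.update x (Fin.last n) (c * y)) -
        partialLog (n + 1) K (Function.update x (Fin.last n) (c * y)) =
        (c * y) ^ K / (K : ℂ) * partialLog n K (Fin.init x) := by
      intro K
      simp only [partialLog, Function.update_self, Fin.init_update_last]
      rw [Finset.sum_range_succ]
      ring
    simp only [Function.comp_apply, hterm] at hdiff
    have hgeo : Tendsto (fun K : ℕ => (((K : ℝ) * (c⁻¹) ^ K : ℝ) : ℂ)) atTop (𝓝 0) := by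
      have := tendsto_self_mul_const_pow_of_lt_one (inv_nonneg.2 hc0.le) (inv_lt_one_of_one_lt₀ hc1)
      exact_mod_cast (Complex.continuous_ofReal.tendsto 0).comp this
    have hprod := (hdiff.mul hgeo).const_mul y⁻¹
    simp only [mul_zero] at hprod
    refine hprod.congr' ?_
    filter_upwards [eventually_ge_atTop 1] with K hK
    obtain ⟨k, rfl⟩ : ∃ k, K = k + 1 := ⟨K - 1, by omega⟩
    have hK0 : ((k + 1 : ℕ) : ℂ) ≠ 0 := by exact_mod_cast Nat.succ_ne_zero k
    have hcc : (c : ℂ) ≠ 0 := by exact_mod_cast hc0.ne'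
    have hy : y ≠ 0 := hx0
    rw [Nat.add_sub_cancel]
    push_cast at hK0 ⊢
    rw [mul_pow, inv_pow, pow_succ' y]
    field_simp
  · simp only [if_neg hj]
    have : j.val ≠ n := fun h => hj (Fin.ext h)
    exact (tendsto_partialLog (hm (j + 1) (by omega))).const_mul _

end Series

/-! ### Merging coordinates and its effect on the divisors -/

section Merge

variable {n : ℕ}

theorem coord_merge {j : ℕ} (hj : j ≤ n) (x : Fin (n + 1) → ℂ) (k : ℕ) :
    coord (merge j x) k = if k + 1 < j then coord x k
      else if k + 1 = j then coord x k * coord x (k + 1) else coord x (k + 1) := by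
  by_cases hk : k < n
  · rw [coord_of_lt _ hk, coord_of_lt _ (show k < n + 1 by omega),
      coord_of_lt _ (show k + 1 < n + 1 by omega)]
    rfl
  · rw [coord_of_le _ (by omega), if_neg (by omega), if_neg (by omega), coord_of_le _ (by omega)]

/-- The position from which the coordinates of `merge j x` after the `a`-th are taken. -/
def mergeShift (j a : ℕ) : ℕ := if a < j then a else a + 1

/-- Merging deletes the break point `j` between coordinates, and `mergeShift j` is the increasing
map that skips `j`. So segments of the merged vector are segments of the original, and the divisors
pull back to divisors. -/
theorem seg_merge {j : ℕ} (hj : j ≤ n) (x : Fin (n + 1) → ℂ) {a b : ℕ} (hab : a ≤ b) :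
    seg (merge j x) (a + 1) b = seg x (mergeShift j a + 1) (mergeShift j b) := by
  induction b, hab using Nat.le_induction with
  | base => rw [seg_self, seg_self]
  | succ b hab ih =>
    have h1 : mergeShift j a ≤ mergeShift j b := by unfold mergeShift; split_ifs <;> omega
    have h2 : mergeShift j b ≤ mergeShift j (b + 1) := by unfold mergeShift; split_ifs <;> omega
    rw [seg_mul_coord _ hab, ih, ← seg_mul_seg x h1 h2]
    congr 1
    rw [coord_merge hj, seg_succ]
    unfold mergeShift
    rcases lt_trichotomy (b + 1) j with h | h | h
    · rw [if_pos h, if_pos (by omega), if_pos h]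
      simp
    · rw [if_neg h.not_lt, if_pos h, if_pos (by omega), if_neg h.not_lt,
        Finset.prod_Ico_succ_top (by omega), Finset.prod_Ico_succ_top (by omega)]
      simp
    · rw [if_neg h.not_gt, if_neg h.ne', if_neg (by omega), if_neg h.not_gt]
      simp

theorem mem_regularSet_iff {x : Fin n → ℂ} : x ∈ regularSet n ↔
    (∀ i, x i ≠ 0) ∧ ∀ a b, a < b → b ≤ n → seg x (a + 1) b ≠ 1 := by
  refine and_congr_right fun _ => ⟨fun h a b hab hb => h _ _ (by omega) (by omega) hb,
    fun h j k hj hjk hk => ?_⟩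
  obtain ⟨a, rfl⟩ : ∃ a, j = a + 1 := ⟨j - 1, by omega⟩
  exact h a k (by omega) hk

theorem coord_ne_zero {x : Fin n → ℂ} (hx : ∀ i, x i ≠ 0) (k : ℕ) : coord x k ≠ 0 := by
  unfold coord
  split_ifs
  exacts [hx _, one_ne_zero]

theorem merge_mem_regularSet {j : ℕ} (hj : j ≤ n) {x : Fin (n + 1) → ℂ}
    (hx : x ∈ regularSet (n + 1)) : merge j x ∈ regularSet n := by
  rw [mem_regularSet_iff] at hx ⊢
  refine ⟨fun i => ?_, fun a b hab hb => ?_⟩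
  · rw [merge]
    split_ifs
    exacts [hx.1 _, mul_ne_zero (hx.1 _) (hx.1 _), hx.1 _]
  · rw [seg_merge hj x hab.le]
    refine hx.2 _ _ ?_ ?_ <;> unfold mergeShift <;> split_ifs <;> omega

/-- For `j ≤ n` the final break point `n` is shifted to `n + 1`, so tail products remain tail
products. -/
theorem merge_mem_convDomain {j : ℕ} (hj : j ≤ n) {x : Fin (n + 1) → ℂ}
    (hx : x ∈ convDomain (n + 1)) : merge j x ∈ convDomain n := by
  intro a ha
  rw [seg_merge hj x ha.le, show mergeShift j n = n + 1 by simp [mergeShift, hj]]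
  refine hx _ ?_
  unfold mergeShift
  split_ifs <;> omega

theorem analyticAt_apply (i : Fin n) (x : Fin n → ℂ) :
    AnalyticAt ℂ (fun x : Fin n → ℂ => x i) x :=
  (ContinuousLinearMap.proj (R := ℂ) (φ := fun _ : Fin n => ℂ) i).analyticAt x

theorem analyticAt_merge (j : ℕ) (x : Fin (n + 1) → ℂ) : AnalyticAt ℂ (merge (n := n) j) x := by
  refine AnalyticAt.pi fun k => ?_
  unfold merge
  split_ifs
  exacts [analyticAt_apply _ x, (analyticAt_apply _ x).mul (analyticAt_apply _ x),
    analyticAt_apply _ x]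

theorem continuous_merge (j : ℕ) : Continuous (merge (n := n) j) :=
  continuous_iff_continuousAt.2 fun x => (analyticAt_merge j x).continuousAt

theorem isOpen_regularSet (n : ℕ) : IsOpen (regularSet n) := by
  have : regularSet n = (⋂ i : Fin n, {x : Fin n → ℂ | x i ≠ 0}) ∩
      ⋂ a : Fin (n + 1), ⋂ b : Fin (n + 1), {x | a < b → seg x (a.val + 1) b.val ≠ 1} := by
    ext x
    rw [mem_regularSet_iff]
    simp only [Set.mem_inter_iff, Set.mem_iInter, Set.mem_ofPred_eq, Fin.forall_iff, Fin.lt_def]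
    refine and_congr_right fun _ => ⟨fun h a _ b hb hab => h a b hab (by omega),
      fun h a b hab hb => h a (by omega) b (by omega) hab⟩
  rw [this]
  refine (isOpen_iInter_of_finite fun i => ?_).inter
    (isOpen_iInter_of_finite fun a => isOpen_iInter_of_finite fun b => ?_)
  · exact isOpen_ne_fun (by fun_prop) (by fun_prop)
  · by_cases hab : a < b
    · simp only [hab, forall_const]
      exact isOpen_ne_fun (by fun_prop) (by fun_prop)
    · simp [hab]

end Merge

/-! ### Continuation of multiple logarithms in the complement of the divisors -/

section Existence

open unitInterval

variable {n : ℕ}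

theorem partialDeriv_eq_fderiv {f : (Fin n → ℂ) → ℂ} {x : Fin n → ℂ} (hf : DifferentiableAt ℂ f x)
    (j : Fin n) : partialDeriv f j x = fderiv ℂ f x (Pi.single j 1) := by
  have h : HasFDerivAt f (fderiv ℂ f x) (Function.update x j (x j)) := by
    rw [Function.update_eq_self]
    exact hf.hasFDerivAt
  exact (h.comp_hasDerivAt (x j) (hasDerivAt_update x j (x j))).deriv

/-- The continued partial derivatives of the multiple logarithm, in terms of continuations of the
multiple logarithm in one variable less. -/
noncomputable def logPartial (g : ℕ → (Fin n → ℂ) → ℂ) (j : Fin (n + 1)) (v : Fin (n + 1) → ℂ) : ℂ :=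
  (1 - v j)⁻¹ * (g j (merge j v) -
    if j = Fin.last n then 0 else (v j)⁻¹ * g (j + 1) (merge (j + 1) v))

theorem apply_ne_one_of_mem_regularSet {x : Fin n → ℂ} (hx : x ∈ regularSet n) (j : Fin n) :
    x j ≠ 1 := by
  have := (mem_regularSet_iff.1 hx).2 j (j + 1) (by omega) (by omega)
  rwa [seg_mul_coord _ le_rfl, seg_self, one_mul, coord_val] at this

theorem fderiv_multiLog {x : Fin (n + 1) → ℂ} (hx : x ∈ convDomain (n + 1))
    (hx' : x ∈ regularSet (n + 1)) : fderiv ℂ (multiLog (n + 1)) x =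
      ∑ j, logPartial (fun _ => multiLog n) j x •
        ContinuousLinearMap.proj (R := ℂ) (φ := fun _ : Fin (n + 1) => ℂ) j := by
  ext v
  have hv : v = ∑ j, v j • (Pi.single j 1 : Fin (n + 1) → ℂ) := by
    ext i
    simp [Finset.sum_apply, Pi.single_apply]
  conv_lhs => rw [hv, map_sum]
  simp only [FunLike.coe_sum, Finset.sum_apply, FunLike.coe_smul,
    Pi.smul_apply, ContinuousLinearMap.proj_apply]
  refine Finset.sum_congr rfl fun j _ => ?_
  rw [map_smul, ← partialDeriv_eq_fderiv (analyticAt_multiLog hx).differentiableAt, smul_eq_mul,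
    smul_eq_mul, mul_comm]
  congr 1
  have h1 : 1 - x j ≠ 0 := sub_ne_zero.2 (apply_ne_one_of_mem_regularSet hx' j).symm
  rw [logPartial, ← one_sub_mul_partialDeriv_multiLog j hx
    (fun i hi => merge_mem_convDomain hi hx) (hx'.1 j), inv_mul_cancel_left₀ h1]

theorem analyticAt_logPartial {g : ℕ → (Fin n → ℂ) → ℂ} {v : Fin (n + 1) → ℂ}
    (hg : ∀ i ≤ n, AnalyticAt ℂ (g i) (merge i v)) (hv : v ∈ regularSet (n + 1)) (j : Fin (n + 1)) :
    AnalyticAt ℂ (logPartial g j) v := by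
  have h : ∀ i ≤ n, AnalyticAt ℂ (fun v => g i (merge i v)) v := fun i hi =>
    (hg i hi).comp (analyticAt_merge i v)
  refine AnalyticAt.mul ((analyticAt_const.sub (analyticAt_apply j v)).inv
    (sub_ne_zero.2 (apply_ne_one_of_mem_regularSet hv j).symm)) ((h j (by omega)).sub ?_)
  by_cases hj : j = Fin.last n
  · simp only [if_pos hj]
    exact analyticAt_const
  · simp only [if_neg hj]
    have : j.val ≠ n := fun h => hj (Fin.ext h)
    exact ((analyticAt_apply j v).inv (hv.1 j)).mul (h (j + 1) (by omega))

theorem logPartial_eventuallyEq {g g' : ℕ → (Fin n → ℂ) → ℂ} {v : Fin (n + 1) → ℂ}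
    (h : ∀ i ≤ n, g i =ᶠ[𝓝 (merge i v)] g' i) (j : Fin (n + 1)) :
    logPartial g j =ᶠ[𝓝 v] logPartial g' j := by
  have h' : ∀ i ≤ n, ∀ᶠ w in 𝓝 v, g i (merge i w) = g' i (merge i w) := fun i hi =>
    (continuous_merge i).continuousAt.eventually (h i hi)
  by_cases hj : j = Fin.last n
  · filter_upwards [h' j (by omega)] with w hw
    simp only [logPartial, if_pos hj, hw]
  · have : j.val ≠ n := fun h => hj (Fin.ext h)
    filter_upwards [h' j (by omega), h' (j + 1) (by omega)] with w hw hw'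
    simp only [logPartial, if_neg hj, hw, hw']

/-- The multiple logarithm can be continued along every path in the complement of the divisors
that begins in the domain of convergence. -/
theorem exists_continuesTo_multiLog : ∀ {n : ℕ} {γ : I → Fin n → ℂ}, Continuous γ →
    (∀ t, γ t ∈ regularSet n) → γ 0 ∈ convDomain n → ∃ g, ContinuesTo (multiLog n) γ g := by
  intro n
  induction n with
  | zero =>
    intro γ _ _ _
    exact ⟨_, ContinuesTo.const fun t => analyticAt_multiLog fun a ha => absurd ha (Nat.not_lt_zero a)⟩
  | succ n ih =>
    intro γ hγ hS h0
    -- By induction `𝔏_n` continues along all merged paths; substituted in the formula for the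
    -- partial derivatives, these families continue the differential of `𝔏_{n+1}`. Indices beyond
    -- `n` receive a dummy family.
    have hex : ∀ i, ∃ G : I → (Fin n → ℂ) → ℂ, i ≤ n →
        IsContinuation (fun t => merge i (γ t)) G ∧ G 0 =ᶠ[𝓝 (merge i (γ 0))] multiLog n := by
      intro i
      by_cases hi : i ≤ n
      · obtain ⟨g, G, hG, hG0, -⟩ := ih (γ := fun t => merge i (γ t))
          ((continuous_merge i).comp hγ) (fun t => merge_mem_regularSet hi (hS t))
          (merge_mem_convDomain hi h0)
        exact ⟨G, fun _ => ⟨hG, hG0⟩⟩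
      · exact ⟨fun _ _ => 0, fun h => absurd h hi⟩
    choose G hG using hex
    refine exists_continuesTo_of_fderiv hγ (ω := fun t v => ∑ j, logPartial (fun i => G i t) j v •
        ContinuousLinearMap.proj (R := ℂ) (φ := fun _ : Fin (n + 1) => ℂ) j)
      ⟨fun t => ?_, fun t => ?_⟩ (analyticAt_multiLog h0) ?_
    · exact Finset.analyticAt_fun_sum _ fun j _ => (analyticAt_logPartial
        (fun i hi => (hG i hi).1.1 t) (hS t) j).smul analyticAt_const
    · have hev : ∀ i : Fin (n + 1), ∀ᶠ t' in 𝓝 t, G i t' =ᶠ[𝓝 (merge i (γ t'))] G i t :=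
        fun i => (hG i (by omega)).1.2 t
      filter_upwards [eventually_all.2 hev] with t' ht'
      have := fun j => logPartial_eventuallyEq (g := fun i => G i t') (g' := fun i => G i t)
        (fun i hi => ht' ⟨i, by omega⟩) j
      filter_upwards [eventually_all.2 this] with v hv
      simp only [hv]
    · have := fun j => logPartial_eventuallyEq (g := fun i => G i 0) (g' := fun _ => multiLog n)
        (fun i hi => (hG i hi).2) j
      filter_upwards [eventually_all.2 this, (isOpen_convDomain _).mem_nhds h0,
        (isOpen_regularSet _).mem_nhds (hS 0)] with v hv hv' hv''
      rw [fderiv_multiLog hv' hv'']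
      simp only [hv]

end Existence

/-! ### Logarithmic singularities in one variable -/

section OneVariable

open Metric

theorem exists_primitive_ball {h : ℂ → ℂ} {a : ℂ} {r : ℝ} (hh : DifferentiableOn ℂ h (ball a r)) :
    ∃ Q : ℂ → ℂ, ∀ u ∈ ball a r, HasDerivAt Q (h u) u := by
  obtain ⟨Q, hQ⟩ := (convex_ball a r).exists_forall_hasDerivWithinAt hh
  exact ⟨Q, fun u hu => (hQ u hu).hasDerivAt (isOpen_ball.mem_nhds hu)⟩

theorem eventually_eq_add_of_hasDerivAt {f g h : ℂ → ℂ} {u₀ : ℂ}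
    (hf : ∀ᶠ u in 𝓝 u₀, HasDerivAt f (h u) u) (hg : ∀ᶠ u in 𝓝 u₀, HasDerivAt g (h u) u) :
    ∀ᶠ u in 𝓝 u₀, f u = g u + (f u₀ - g u₀) := by
  obtain ⟨ε, hε, hb⟩ := eventually_nhds_iff_ball.1 (hf.and hg)
  filter_upwards [ball_mem_nhds u₀ hε] with u hu
  have hd : ∀ w ∈ ball u₀ ε, HasDerivAt (fun w => f w - g w) 0 w := fun w hw =>
    ((hb w hw).1.sub (hb w hw).2).congr_deriv (sub_self _)
  have := (convex_ball u₀ ε).is_const_of_fderivWithin_eq_zero (𝕜 := ℂ)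
    (fun w hw => (hd w hw).differentiableAt.differentiableWithinAt) (fun w hw => by
      rw [fderivWithin_of_isOpen isOpen_ball hw]
      ext
      simp [(hd w hw).deriv]) hu (mem_ball_self hε)
  linear_combination this

/-- Integration of functions with a logarithmic singularity at `1`. -/
theorem exists_log_expansion {r : ℝ} {u₀ : ℂ} (hu₀ : u₀ ∈ ball (1 : ℂ) r) (hu₁ : u₀ ≠ 1)
    {g ℓ P R T : ℂ → ℂ} (hP : DifferentiableOn ℂ P (ball 1 r)) (hR : DifferentiableOn ℂ R (ball 1 r))
    (hT : DifferentiableOn ℂ T (ball 1 r)) (hT₁ : T 1 = 0)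
    (hℓ : ∀ᶠ u in 𝓝 u₀, HasDerivAt ℓ (-(1 - u)⁻¹) u)
    (hg : ∀ᶠ u in 𝓝 u₀,
      HasDerivAt g (deriv P u * ℓ u + R u + (T u - P u) * (1 - u)⁻¹) u) :
    ∃ Q, DifferentiableOn ℂ Q (ball 1 r) ∧ ∀ᶠ u in 𝓝 u₀, g u = P u * ℓ u + Q u := by
  have hr : 0 < r := dist_nonneg.trans_lt hu₀
  have hds : DifferentiableOn ℂ (dslope T 1) (ball 1 r) :=
    (Complex.differentiableOn_dslope (ball_mem_nhds 1 hr)).2 hT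
  -- Subtracting the derivative of `P ℓ` removes `P' ℓ` and `P / (1 - u)` and leaves `R + T / (1 -
  -- u)`. As `T 1 = 0`, this is `R - dslope T 1`, which is holomorphic across `u = 1`.
  obtain ⟨Q, hQ⟩ := exists_primitive_ball (hR.sub hds)
  have h1 : ∀ᶠ u in 𝓝 u₀, HasDerivAt (fun u => g u - P u * ℓ u) (R u - dslope T 1 u) u := by
    filter_upwards [hℓ, hg, isOpen_ball.mem_nhds hu₀, isOpen_ne.mem_nhds hu₁] with u h1 h2 h3 h4
    have hPu := (hP.differentiableAt (isOpen_ball.mem_nhds h3)).hasDerivAt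
    refine (h2.sub (hPu.mul h1)).congr_deriv ?_
    rw [dslope_of_ne _ h4, slope_def_field, hT₁]
    have h5 : u - 1 ≠ 0 := sub_ne_zero.2 h4
    have h6 : 1 - u ≠ 0 := sub_ne_zero.2 (Ne.symm h4)
    have h7 : (1 - u)⁻¹ = -(u - 1)⁻¹ := by rw [← neg_sub, inv_neg]
    rw [h7, div_eq_mul_inv]
    ring
  have h2 : ∀ᶠ u in 𝓝 u₀, HasDerivAt Q (R u - dslope T 1 u) u := by
    filter_upwards [isOpen_ball.mem_nhds hu₀] with u hu using hQ u hu
  set c := g u₀ - P u₀ * ℓ u₀ - Q u₀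
  refine ⟨fun u => Q u + c,
    fun u hu => ((hQ u hu).differentiableAt.add_const c).differentiableWithinAt, ?_⟩
  filter_upwards [eventually_eq_add_of_hasDerivAt h1 h2] with u hu
  have hu' : g u - P u * ℓ u = Q u + c := hu
  rw [← hu']
  ring

end OneVariable

/-! ### The power series as a function of its last variable -/

section LastVariable

open Metric

variable {n : ℕ}

theorem hasDerivAt_multiLog_last {x : Fin (n + 1) → ℂ} (hx : x ∈ convDomain (n + 1))
    (h0 : x (Fin.last n) ≠ 0) (h1 : x (Fin.last n) ≠ 1) :
    HasDerivAt (fun t => multiLog (n + 1) (Function.update x (Fin.last n) t))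
      (multiLog n (merge n x) / (1 - x (Fin.last n))) (x (Fin.last n)) := by
  have h := one_sub_mul_partialDeriv_multiLog (Fin.last n) hx
    (fun i hi => merge_mem_convDomain hi hx) h0
  rw [if_pos rfl, sub_zero, Fin.val_last] at h
  rw [← h, mul_div_cancel_left₀ _ (sub_ne_zero.2 h1.symm)]
  refine DifferentiableAt.hasDerivAt ?_
  have ha := (analyticAt_multiLog hx).differentiableAt
  rw [← Function.update_eq_self (Fin.last n) x] at ha
  exact ha.comp (x (Fin.last n)) (hasDerivAt_update x (Fin.last n) _).differentiableAt

theorem hasDerivAt_multiLog_update {x : Fin (n + 1) → ℂ} {y : ℂ → ℂ} {y' u : ℂ}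
    (hy : HasDerivAt y y' u) (hx : Function.update x (Fin.last n) (y u) ∈ convDomain (n + 1))
    (h0 : y u ≠ 0) (h1 : y u ≠ 1) :
    HasDerivAt (fun t => multiLog (n + 1) (Function.update x (Fin.last n) (y t)))
      (multiLog n (merge n (Function.update x (Fin.last n) (y u))) / (1 - y u) * y') u := by
  have h := hasDerivAt_multiLog_last hx (by simpa using h0) (by simpa using h1)
  simp only [Function.update_self, Function.update_idem] at h
  exact h.comp u hy

/-- Multiply the last coordinate of a vector by `u`. -/
def scaleLast (v : Fin n → ℂ) (u : ℂ) : Fin n → ℂ := fun i => if i.val + 1 = n then v i * u else v i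

theorem scaleLast_eq_update (v : Fin (n + 1) → ℂ) (u : ℂ) :
    scaleLast v u = Function.update v (Fin.last n) (v (Fin.last n) * u) := by
  ext i
  by_cases hi : i = Fin.last n
  · subst hi
    simp [scaleLast]
  · have : i.val ≠ n := fun h => hi (Fin.ext h)
    simp [scaleLast, hi, this]

theorem scaleLast_one (v : Fin n → ℂ) : scaleLast v 1 = v := by
  ext i
  simp [scaleLast]

theorem analyticAt_scaleLast (v : Fin n → ℂ) (u : ℂ) : AnalyticAt ℂ (scaleLast v) u := by
  refine AnalyticAt.pi fun i => ?_
  unfold scaleLast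
  split_ifs
  exacts [analyticAt_const.mul analyticAt_id, analyticAt_const]

theorem coord_update_last (v : Fin (n + 1) → ℂ) (t : ℂ) (i : ℕ) :
    coord (Function.update v (Fin.last n) t) i = if i = n then t else coord v i := by
  by_cases hi : i < n + 1
  · rw [coord_of_lt _ hi, coord_of_lt _ hi]
    by_cases h : i = n
    · subst h
      rw [if_pos rfl]
      exact Function.update_self ..
    · rw [if_neg h, Function.update_of_ne]
      exact fun h' => h (congrArg Fin.val h')
  · rw [coord_of_le _ (by omega), coord_of_le _ (by omega), if_neg (by omega)]

theorem seg_update_last_of_le (v : Fin (n + 1) → ℂ) (t : ℂ) (a : ℕ) {b : ℕ} (hb : b ≤ n) :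
    seg (Function.update v (Fin.last n) t) (a + 1) b = seg v (a + 1) b := by
  rw [seg_succ, seg_succ]
  refine Finset.prod_congr rfl fun i hi => ?_
  rw [Finset.mem_Ico] at hi
  rw [coord_update_last, if_neg (by omega)]

theorem seg_update_last (v : Fin (n + 1) → ℂ) (t : ℂ) {a : ℕ} (ha : a ≤ n) :
    seg (Function.update v (Fin.last n) t) (a + 1) (n + 1) = seg v (a + 1) n * t := by
  rw [seg_mul_coord _ ha, seg_update_last_of_le _ _ _ le_rfl, coord_update_last, if_pos rfl]

theorem coord_last (v : Fin (n + 1) → ℂ) : coord v n = v (Fin.last n) := coord_val v (Fin.last n)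

theorem seg_scaleLast (v : Fin n → ℂ) (u : ℂ) {a : ℕ} (ha : a < n) :
    seg (scaleLast v u) (a + 1) n = seg v (a + 1) n * u := by
  obtain ⟨n, rfl⟩ : ∃ m, n = m + 1 := ⟨n - 1, by omega⟩
  rw [scaleLast_eq_update, seg_update_last _ _ (by omega), seg_mul_coord v (by omega), coord_last,
    mul_assoc]

theorem merge_update_last (v : Fin (n + 2) → ℂ) (t : ℂ) :
    merge (n + 1) (Function.update v (Fin.last (n + 1)) t) =
      Function.update (merge (n + 1) v) (Fin.last n) (v (Fin.last n).castSucc * t) := by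
  ext k
  by_cases hk : k = Fin.last n
  · subst hk
    rw [merge_last_last, Function.update_self, Function.update_self,
      Function.update_of_ne (Fin.castSucc_lt_last _).ne]
  · have h1 : k.val + 1 < n + 1 := by
      have : k.val ≠ n := fun h => hk (Fin.ext h)
      omega
    rw [Function.update_of_ne hk]
    simp only [merge, if_pos h1]
    rw [Function.update_of_ne (Fin.castSucc_lt_last _).ne]

theorem merge_scaleLast (v : Fin (n + 1) → ℂ) (u : ℂ) :
    merge n (scaleLast v u) = scaleLast (merge n v) u := by
  cases n with
  | zero => exact Subsingleton.elim _ _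
  | succ n =>
    rw [scaleLast_eq_update, merge_update_last, scaleLast_eq_update, merge_last_last, mul_assoc]

theorem seg_merge_last_of_lt (v : Fin (n + 1) → ℂ) {a b : ℕ} (hab : a ≤ b) (hb : b < n) :
    seg (merge n v) (a + 1) b = seg v (a + 1) b := by
  rw [seg_merge le_rfl v hab, mergeShift, mergeShift, if_pos hb, if_pos (by omega)]

theorem seg_merge_last (v : Fin (n + 1) → ℂ) {a : ℕ} (ha : a < n) :
    seg (merge n v) (a + 1) n = seg v (a + 1) (n + 1) := by
  rw [seg_merge le_rfl v ha.le, mergeShift, mergeShift, if_pos ha, if_neg (lt_irrefl _)]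

theorem merge_ne_zero {j : ℕ} {x : Fin (n + 1) → ℂ} (hx : ∀ i, x i ≠ 0) (i : Fin n) :
    merge j x i ≠ 0 := by
  rw [merge]
  split_ifs
  exacts [hx _, mul_ne_zero (hx _) (hx _), hx _]

theorem scaleLast_mem_convDomain {v : Fin n → ℂ} {u : ℂ}
    (h : ∀ a < n, ‖seg v (a + 1) n * u‖ < 1) : scaleLast v u ∈ convDomain n := fun a ha => by
  rw [seg_scaleLast v u ha]
  exact h a ha

/-- The power series of the multiple logarithm in its last variable extends to a disc that does
not meet the divisors. -/
theorem exists_extension_scaleLast {r : ℝ} {u₀ : ℂ} (hu₀ : u₀ ∈ ball (1 : ℂ) r) (h0 : u₀ ≠ 0) :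
    ∀ {n : ℕ} {v : Fin n → ℂ}, (∀ i, v i ≠ 0) →
    (∀ a < n, ∀ u ∈ ball (1 : ℂ) r, seg v (a + 1) n * u ≠ 1) →
    (∀ a < n, ‖seg v (a + 1) n * u₀‖ < 1) →
    ∃ Q, DifferentiableOn ℂ Q (ball 1 r) ∧ ∀ᶠ u in 𝓝 u₀, Q u = multiLog n (scaleLast v u) := by
  intro n
  induction n with
  | zero =>
    intro v _ _ _
    refine ⟨fun _ => multiLog 0 v, differentiableOn_const _, Eventually.of_forall fun u => ?_⟩
    rw [Subsingleton.elim (scaleLast v u) v]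
  | succ n ih =>
    intro v hv h1 h2
    -- The derivative in `u` is the function of the merged vector times `w / (1 - w * u)`, whose
    -- pole lies outside the disc. The extension is therefore a primitive of the extension found by
    -- induction.
    obtain ⟨Q, hQ, hQ'⟩ := ih (v := merge n v) (merge_ne_zero hv)
      (fun a ha u hu => by rw [seg_merge_last v ha]; exact h1 a (by omega) u hu)
      (fun a ha => by rw [seg_merge_last v ha]; exact h2 a (by omega))
    set w := v (Fin.last n)
    have hw : ∀ u ∈ ball (1 : ℂ) r, w * u ≠ 1 := by
      intro u hu
      have := h1 n (by omega) u hu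
      rwa [seg_mul_coord v le_rfl, seg_self, one_mul, coord_last] at this
    have hd : DifferentiableOn ℂ (fun u => Q u / (1 - w * u) * w) (ball 1 r) := by
      refine (hQ.div (by fun_prop) fun u hu => ?_).mul_const w
      exact sub_ne_zero.2 (hw u hu).symm
    obtain ⟨Q₁, hQ₁⟩ := exists_primitive_ball hd
    have hev : ∀ᶠ u in 𝓝 u₀, scaleLast v u ∈ convDomain (n + 1) :=
      (analyticAt_scaleLast v u₀).continuousAt.eventually
        ((isOpen_convDomain _).mem_nhds (scaleLast_mem_convDomain h2))
    have hg : ∀ᶠ u in 𝓝 u₀, HasDerivAt (fun u => multiLog (n + 1) (scaleLast v u))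
        (Q u / (1 - w * u) * w) u := by
      filter_upwards [hev, hQ', isOpen_ball.mem_nhds hu₀, isOpen_ne.mem_nhds h0] with u h3 h4 h5 h6
      rw [h4, ← merge_scaleLast]
      simp only [scaleLast_eq_update] at h3 ⊢
      exact hasDerivAt_multiLog_update (by simpa using (hasDerivAt_id u).const_mul w) h3
        (mul_ne_zero (hv _) h6) (hw u h5)
    set c := multiLog (n + 1) (scaleLast v u₀) - Q₁ u₀
    refine ⟨fun u => Q₁ u + c,
      fun u hu => ((hQ₁ u hu).differentiableAt.add_const c).differentiableWithinAt, ?_⟩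
    filter_upwards [eventually_eq_add_of_hasDerivAt hg
      (eventually_of_mem (isOpen_ball.mem_nhds hu₀) hQ₁)] with u hu
    exact hu.symm

/-- The part of the disc in which the series converges is an intersection of convex sets. It
contains both `u₀` and `1`, so the identity theorem carries the equality from one to the other. -/
theorem extension_scaleLast_one {r : ℝ} {u₀ : ℂ} (hu₀ : u₀ ∈ ball (1 : ℂ) r) {v : Fin n → ℂ}
    (h2 : ∀ a < n, ‖seg v (a + 1) n * u₀‖ < 1) (h3 : ∀ a < n, ‖seg v (a + 1) n‖ < 1)
    {Q : ℂ → ℂ} (hQ : DifferentiableOn ℂ Q (ball 1 r))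
    (hQ' : ∀ᶠ u in 𝓝 u₀, Q u = multiLog n (scaleLast v u)) : Q 1 = multiLog n v := by
  have hr : 0 < r := dist_nonneg.trans_lt hu₀
  let V : Set ℂ := ball 1 r ∩ ⋂ a : Fin n, {u | ‖seg v (a.val + 1) n * u‖ < 1}
  have hconv : Convex ℝ V := by
    refine (convex_ball _ _).inter (convex_iInter fun a => ?_)
    have : {u : ℂ | ‖seg v (a.val + 1) n * u‖ < 1} =
        (LinearMap.mulLeft ℝ (seg v (a.val + 1) n)) ⁻¹' ball 0 1 := by
      ext u
      simp
    rw [this]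
    exact (convex_ball _ _).linear_preimage _
  have h := AnalyticOnNhd.eqOn_of_preconnected_of_eventuallyEq (𝕜 := ℂ) (U := V) (z₀ := u₀)
    (f := Q) (g := fun u => multiLog n (scaleLast v u))
    (fun u hu => (hQ.analyticAt (isOpen_ball.mem_nhds hu.1)))
    (fun u hu => (analyticAt_multiLog (scaleLast_mem_convDomain fun a ha =>
      Set.mem_iInter.1 hu.2 ⟨a, ha⟩)).comp (analyticAt_scaleLast v u))
    hconv.isPreconnected ⟨hu₀, Set.mem_iInter.2 fun a => h2 a a.2⟩ hQ'
    ⟨mem_ball_self hr, Set.mem_iInter.2 fun a => by simpa using h3 a a.2⟩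
  simpa [scaleLast_one] using h

end LastVariable

/-! ### Slices in the last coordinate, the point `y(s)` and the coefficient of the logarithm -/

section Slices

open Metric unitInterval

/-- The point of the line through `v` in the direction of the last coordinate at which the product
`x_{a+1} ⋯ x_{n+1}` takes the value `u`. -/
noncomputable def slice {n : ℕ} (a : ℕ) (v : Fin (n + 1) → ℂ) (u : ℂ) : Fin (n + 1) → ℂ :=
  Function.update v (Fin.last n) (u / seg v (a + 1) n)

theorem seg_ne_zero {n : ℕ} {v : Fin n → ℂ} (hv : ∀ i, v i ≠ 0) (a b : ℕ) :
    seg v (a + 1) b ≠ 0 := by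
  rw [seg_succ]
  exact Finset.prod_ne_zero_iff.2 fun i _ => coord_ne_zero hv i

section

variable {n a : ℕ} {v : Fin (n + 1) → ℂ}

theorem seg_slice_of_le (u : ℂ) (i : ℕ) {b : ℕ} (hb : b ≤ n) :
    seg (slice a v u) (i + 1) b = seg v (i + 1) b :=
  seg_update_last_of_le v _ i hb

theorem seg_slice (hv : ∀ i, v i ≠ 0) (ha : a ≤ n) (u : ℂ) :
    seg (slice a v u) (a + 1) (n + 1) = u := by
  rw [slice, seg_update_last v _ ha, mul_div_cancel₀]
  exact seg_ne_zero hv a n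

theorem slice_seg (hv : ∀ i, v i ≠ 0) (ha : a ≤ n) : slice a v (seg v (a + 1) (n + 1)) = v := by
  rw [slice, seg_mul_coord v ha, mul_div_cancel_left₀ _ (seg_ne_zero hv a n), coord_last,
    Function.update_eq_self]

theorem analyticAt_slice (u : ℂ) : AnalyticAt ℂ (slice a v) u := by
  refine AnalyticAt.pi fun i => ?_
  unfold slice
  by_cases hi : i = Fin.last n
  · subst hi
    simp only [Function.update_self]
    exact analyticAt_id.div_const
  · simp only [Function.update_of_ne hi]
    exact analyticAt_const

theorem hasDerivAt_slice (u : ℂ) :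
    HasDerivAt (slice a v) (Pi.single (Fin.last n) (seg v (a + 1) n)⁻¹) u := by
  have h := (hasDerivAt_update v (Fin.last n) (u / seg v (a + 1) n)).scomp u
    ((hasDerivAt_id u).div_const (seg v (a + 1) n))
  refine h.congr_deriv ?_
  ext i
  by_cases hi : i = Fin.last n
  · subst hi
    simp
  · simp [hi]

end

theorem merge_slice {n a : ℕ} (ha : a ≤ n) {v : Fin (n + 2) → ℂ} (hv : ∀ i, v i ≠ 0) (u : ℂ) :
    merge (n + 1) (slice a v u) = slice a (merge (n + 1) v) u := by
  rw [slice, slice, merge_update_last, seg_merge_last_of_lt v ha (Nat.lt_succ_self n),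
    seg_mul_coord v ha]
  congr 1
  have h1 := hv (Fin.last n).castSucc
  have h2 := seg_ne_zero hv a n
  rw [show coord v n = v (Fin.last n).castSucc from coord_val v (Fin.last n).castSucc]
  field_simp

/-- The first `a` coordinates. -/
def firstCoords {n : ℕ} (a : ℕ) (v : Fin n → ℂ) : Fin a → ℂ := fun i => coord v i

/-- The point `y(s)`, `s = a + 1`, as a vector with any number of coordinates. -/
noncomputable def yVec {n : ℕ} (a k : ℕ) (v : Fin n → ℂ) : Fin k → ℂ :=
  fun i => (1 - seg v (a + 1) (a + 1 + i.val + 1)) / (1 - seg v (a + 1) (a + 1 + i.val))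

/-- The product of consecutive quotients telescopes. -/
theorem seg_yVec {n a k : ℕ} {v : Fin n → ℂ} (h : ∀ i < k, seg v (a + 1) (a + 1 + i) ≠ 1)
    {i j : ℕ} (hij : i ≤ j) (hj : j ≤ k) : i < k →
    seg (yVec a k v) (i + 1) j =
      (1 - seg v (a + 1) (a + 1 + j)) / (1 - seg v (a + 1) (a + 1 + i)) := by
  intro hi
  induction j, hij using Nat.le_induction with
  | base => rw [seg_self, div_self (sub_ne_zero.2 (h i hi).symm)]
  | succ j hij ih =>
    rw [seg_mul_coord _ hij, ih (by omega), coord_of_lt _ (show j < k by omega), yVec]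
    have h1 := sub_ne_zero.2 (h i hi).symm
    have h2 := sub_ne_zero.2 (h j (by omega)).symm
    simp only
    rw [show a + 1 + j + 1 = a + 1 + (j + 1) by ring]
    field_simp

/-- Multiplying the last two quotients cancels the factor `1 - x_s ⋯ x_{n-1}`, which is what merging
the last two coordinates of `v` does to `y(s)`. When `k = 0`, both sides are empty vectors. -/
theorem merge_yVec {a k : ℕ} {v : Fin (a + k + 2) → ℂ}
    (h : ∀ i < k + 1, seg v (a + 1) (a + 1 + i) ≠ 1) :
    merge k (yVec a (k + 1) v) = yVec a k (merge (a + k + 1) v) := by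
  ext i
  have hi := i.2
  have h2 : seg (merge (a + k + 1) v) (a + 1) (a + 1 + i.val) = seg v (a + 1) (a + 1 + i.val) :=
    seg_merge_last_of_lt v (by omega) (by omega)
  by_cases hik : i.val + 1 = k
  · have h1 : seg (merge (a + k + 1) v) (a + 1) (a + 1 + i.val + 1) =
        seg v (a + 1) (a + 1 + i.val + 2) := by
      rw [show a + 1 + i.val + 1 = a + k + 1 by omega, seg_merge_last v (by omega)]
      congr 1
      omega
    rw [merge, if_neg (by omega), if_pos hik]
    simp only [yVec, h1, h2, Fin.val_castSucc, Fin.val_succ]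
    have h3 := sub_ne_zero.2 (h (i.val + 1) (by omega)).symm
    rw [show a + 1 + (i.val + 1) = a + 1 + i.val + 1 by ring] at *
    rw [show a + 1 + i.val + 1 + 1 = a + 1 + i.val + 2 by ring]
    field_simp
  · have h1 : seg (merge (a + k + 1) v) (a + 1) (a + 1 + i.val + 1) =
        seg v (a + 1) (a + 1 + i.val + 1) :=
      seg_merge_last_of_lt v (by omega) (by omega)
    rw [merge, if_pos (by omega)]
    simp only [yVec, h1, h2, Fin.val_castSucc]

/-- Along a slice only the last numerator of `y(s)` varies. It equals `1 - u`, so the last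
coordinate vanishes at `u = 1`. -/
theorem yVec_slice {a k : ℕ} {v : Fin (a + k + 2) → ℂ} (hv : ∀ i, v i ≠ 0) (u : ℂ) :
    yVec a (k + 1) (slice a v u) = Function.update (yVec a (k + 1) v) (Fin.last k)
      ((1 - u) / (1 - seg v (a + 1) (a + 1 + k))) := by
  ext i
  have hi := i.2
  have h2 : seg (slice a v u) (a + 1) (a + 1 + i.val) = seg v (a + 1) (a + 1 + i.val) :=
    seg_slice_of_le u a (by omega)
  by_cases hik : i = Fin.last k
  · subst hik
    rw [Function.update_self]
    simp only [yVec, h2]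
    rw [show a + 1 + (Fin.last k).val + 1 = a + k + 1 + 1 by simp; ring, seg_slice hv (by omega)]
    simp
  · have hik' : i.val ≠ k := fun h => hik (Fin.ext h)
    rw [Function.update_of_ne hik]
    simp only [yVec, h2]
    rw [show seg (slice a v u) (a + 1) (a + 1 + i.val + 1) = seg v (a + 1) (a + 1 + i.val + 1) from
      seg_slice_of_le u a (by omega)]

/-- The disc `|1 - u| < r` in the slice through `v` meets none of the divisors but `u = 1`. -/
def DiscAdmissible {n : ℕ} (a : ℕ) (v : Fin (n + 1) → ℂ) (r : ℝ) : Prop :=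
  r ≤ 1 ∧ (∀ k, a < k → k ≤ n → r ≤ ‖1 - seg v (a + 1) k‖) ∧
    ∀ j < a, r ≤ ‖1 - (seg v (j + 1) a)⁻¹‖

theorem DiscAdmissible.seg_ne {n a : ℕ} {v : Fin (n + 1) → ℂ} {r : ℝ} (h : DiscAdmissible a v r)
    {u : ℂ} (hu : u ∈ ball (1 : ℂ) r) {k : ℕ} (hk : a < k) (hk' : k ≤ n) : seg v (a + 1) k ≠ u := by
  rintro rfl
  have := h.2.1 k hk hk'
  rw [mem_ball, dist_comm, dist_eq_norm] at hu
  linarith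

theorem DiscAdmissible.ne_zero {n a : ℕ} {v : Fin (n + 1) → ℂ} {r : ℝ} (h : DiscAdmissible a v r)
    {u : ℂ} (hu : u ∈ ball (1 : ℂ) r) : u ≠ 0 := by
  rintro rfl
  have := h.1
  rw [mem_ball, dist_comm, dist_eq_norm, sub_zero, norm_one] at hu
  linarith

theorem DiscAdmissible.mergeLast {n a : ℕ} (ha : a ≤ n) {v : Fin (n + 2) → ℂ} {r : ℝ}
    (h : DiscAdmissible a v r) : DiscAdmissible a (merge (n + 1) v) r := by
  refine ⟨h.1, fun k hk hk' => ?_, fun j hj => ?_⟩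
  · rw [seg_merge_last_of_lt v hk.le (by omega)]
    exact h.2.1 k hk (by omega)
  · rw [seg_merge_last_of_lt v hj.le (by omega)]
    exact h.2.2 j hj

/-- By telescoping, the tail products of `y(s)` are the quotients `(1 - x_s ⋯ x_n) / (1 - x_s ⋯
x_j)`. The second condition on the tube says exactly that these are smaller than `1` in absolute
value. -/
theorem yVec_mem_convDomain {a k : ℕ} {v : Fin (a + k + 1) → ℂ}
    (h : ∀ i < k, seg v (a + 1) (a + 1 + i) ≠ 1)
    (h' : ∀ i < k, ‖1 - seg v (a + 1) (a + k + 1)‖ < ‖1 - seg v (a + 1) (a + 1 + i)‖) :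
    yVec a k v ∈ convDomain k := by
  intro i hi
  rw [seg_yVec h hi.le le_rfl hi, norm_div, show a + 1 + k = a + k + 1 by ring]
  exact (div_lt_one ((norm_nonneg _).trans_lt (h' i hi))).2 (h' i hi)

theorem DiscAdmissible.yVec_slice_mem {a k : ℕ} {v : Fin (a + k + 1) → ℂ} {r : ℝ}
    (h : DiscAdmissible a v r) (hv : v ∈ regularSet (a + k + 1)) {u : ℂ} (hu : u ∈ ball (1 : ℂ) r) :
    yVec a k (slice a v u) ∈ convDomain k := by
  refine yVec_mem_convDomain (fun i hi => ?_) fun i hi => ?_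
  · rw [seg_slice_of_le u a (by omega)]
    exact (mem_regularSet_iff.1 hv).2 _ _ (by omega) (by omega)
  · rw [seg_slice hv.1 (by omega), seg_slice_of_le u a (by omega)]
    rw [mem_ball, dist_comm, dist_eq_norm] at hu
    exact hu.trans_le (h.2.1 _ (by omega) (by omega))

/-- The coefficient of the logarithm at the divisor `x_{a+1} ⋯ x_n = 1`. -/
noncomputable def logCoeff {n : ℕ} (a k : ℕ) (w : Fin n → ℂ) : ℂ :=
  -(multiLog a (firstCoords a w) * multiLog k (yVec a k w))

theorem firstCoords_slice {n a : ℕ} (ha : a ≤ n) (v : Fin (n + 1) → ℂ) (u : ℂ) :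
    firstCoords a (slice a v u) = firstCoords a v := by
  ext i
  rw [firstCoords, slice, coord_update_last, if_neg (by omega)]
  rfl

theorem firstCoords_merge {n a : ℕ} (ha : a < n) (v : Fin (n + 1) → ℂ) :
    firstCoords a (merge n v) = firstCoords a v := by
  ext i
  rw [firstCoords, coord_merge le_rfl, if_pos (by omega)]
  rfl

theorem DiscAdmissible.differentiableOn_logCoeff {a k : ℕ} {v : Fin (a + k + 1) → ℂ} {r : ℝ}
    (h : DiscAdmissible a v r) (hv : v ∈ regularSet (a + k + 1)) :
    DifferentiableOn ℂ (fun u => logCoeff a k (slice a v u)) (ball 1 r) := by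
  simp only [logCoeff, firstCoords_slice (show a ≤ a + k by omega)]
  refine (DifferentiableOn.const_mul ?_ _).neg
  cases k with
  | zero =>
    have : ∀ u, yVec a 0 (slice a v u) = yVec a 0 v := fun u => Subsingleton.elim _ _
    simp only [this]
    exact differentiableOn_const _
  | succ k =>
    intro u hu
    have h1 := (analyticAt_multiLog (h.yVec_slice_mem hv hu)).differentiableAt
    simp only [yVec_slice hv.1] at h1 ⊢
    refine (h1.comp u ?_).differentiableWithinAt
    have hy : HasDerivAt (fun u => (1 - u) / (1 - seg v (a + 1) (a + 1 + k)))
        (-1 / (1 - seg v (a + 1) (a + 1 + k))) u := ((hasDerivAt_id u).const_sub 1).div_const _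
    exact ((hasDerivAt_update (yVec a (k + 1) v) (Fin.last k) _).scomp u hy).differentiableAt

/-- With last coordinate `y = (1 - u) / (1 - τ)`, the factor `y' / (1 - y)` from the derivative of
`𝔏_{k+1}` is `1 / (τ - u)`, the same factor as for the continued `𝔏_n` on the slice. So the
coefficient of the logarithm obeys the recursion that the expansion requires. -/
theorem DiscAdmissible.deriv_logCoeff {a k : ℕ} {v : Fin (a + k + 2) → ℂ} {r : ℝ}
    (h : DiscAdmissible a v r) (hv : v ∈ regularSet (a + k + 2)) {u : ℂ} (hu : u ∈ ball (1 : ℂ) r)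
    (hu1 : u ≠ 1) :
    deriv (fun u => logCoeff a (k + 1) (slice a v u)) u =
      logCoeff a k (slice a (merge (a + k + 1) v) u) /
        (seg v (a + 1) (a + k + 1) - u) := by
  simp only [logCoeff, firstCoords_slice (show a ≤ a + (k + 1) by omega),
    firstCoords_slice (show a ≤ a + k by omega), firstCoords_merge (show a < a + k + 1 by omega)]
  have hmem := h.yVec_slice_mem (k := k + 1) hv hu
  set τ := seg v (a + 1) (a + k + 1)
  have hτ : seg v (a + 1) (a + 1 + k) = τ := by rw [show a + 1 + k = a + k + 1 by ring]
  have hτ1 : τ ≠ 1 := (mem_regularSet_iff.1 hv).2 _ _ (by omega) (by omega)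
  have hτu : τ ≠ u := h.seg_ne hu (by omega) (by omega)
  have e1 : 1 - τ ≠ 0 := sub_ne_zero.2 hτ1.symm
  have e2 : τ - u ≠ 0 := sub_ne_zero.2 hτu
  have e3 : 1 - u ≠ 0 := sub_ne_zero.2 hu1.symm
  have hm : merge k (yVec a (k + 1) (slice a v u)) =
      yVec a k (slice a (merge (a + k + 1) v) u) := by
    rw [merge_yVec, merge_slice (by omega) hv.1]
    intro i hi
    rw [seg_slice_of_le u a (by omega)]
    exact (mem_regularSet_iff.1 hv).2 _ _ (by omega) (by omega)
  rw [← hm]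
  simp only [yVec_slice hv.1, hτ] at hmem ⊢
  have hy : HasDerivAt (fun u => (1 - u) / (1 - τ)) (-1 / (1 - τ)) u :=
    ((hasDerivAt_id u).const_sub 1).div_const _
  have hd := hasDerivAt_multiLog_update hy hmem (div_ne_zero e3 e1) (fun h1 => hτu (by
    rw [div_eq_one_iff_eq e1] at h1
    linear_combination h1))
  rw [((hd.const_mul (multiLog a (firstCoords a v))).fun_neg).deriv]
  have e4 : 1 - (1 - u) / (1 - τ) = -(τ - u) / (1 - τ) := by
    field_simp
    ring
  rw [e4]
  field_simp

end Slices

/-! ### The expansion of the continued multiple logarithm near the divisor -/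

section Expansion

open Metric unitInterval

variable {n : ℕ}

/-- The derivative of the continued multiple logarithm in its last variable. -/
theorem ContinuesTo.eventually_fderiv_last {γ : I → Fin (n + 1) → ℂ} (hγ : Continuous γ)
    (hS : ∀ t, γ t ∈ regularSet (n + 1)) (h0 : γ 0 ∈ convDomain (n + 1))
    {L : (Fin (n + 1) → ℂ) → ℂ} {L₁ : (Fin n → ℂ) → ℂ} (hL : ContinuesTo (multiLog (n + 1)) γ L)
    (hL₁ : ContinuesTo (multiLog n) (fun t => merge n (γ t)) L₁) :
    ∀ᶠ v in 𝓝 (γ 1), fderiv ℂ L v (Pi.single (Fin.last n) 1) =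
      L₁ (merge n v) / (1 - v (Fin.last n)) := by
  obtain ⟨F, hF, hF0, hF1⟩ := hL
  obtain ⟨G, hG, hG0, hG1⟩ := hL₁
  let e : (Fin (n + 1) → ℂ) := Pi.single (Fin.last n) 1
  have hA : GermContinuation γ fun t v => fderiv ℂ (F t) v e := by
    refine ⟨fun t => ?_, fun t => ?_⟩
    · have he := ContinuousLinearMap.analyticAt (𝕜 := ℂ) (E := (Fin (n + 1) → ℂ) →L[ℂ] ℂ) (F := ℂ)
        (ContinuousLinearMap.apply ℂ ℂ e) (fderiv ℂ (F t) (γ t))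
      have hc : AnalyticAt ℂ (fun v => ContinuousLinearMap.apply ℂ ℂ e (fderiv ℂ (F t) v)) (γ t) :=
        he.comp (hF.1 t).fderiv
      exact hc
    filter_upwards [hF.2 t] with t' ht'
    filter_upwards [ht'.fderiv (𝕜 := ℂ)] with v hv
    rw [hv]
  have hB : GermContinuation γ fun t v => G t (merge n v) / (1 - v (Fin.last n)) := by
    refine ⟨fun t => ?_, fun t => ?_⟩
    · exact ((hG.1 t).comp (analyticAt_merge n _)).div
        (analyticAt_const.sub (analyticAt_apply _ _))
        (sub_ne_zero.2 (apply_ne_one_of_mem_regularSet (hS t) _).symm)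
    · filter_upwards [hG.2 t] with t' ht'
      filter_upwards [(continuous_merge n).continuousAt.eventually ht'] with v hv
      rw [hv]
  -- At the start of the path the equation is the one for the power series; the identity principle
  -- carries it to the end.
  have hAB : (fun v => fderiv ℂ (F 0) v e) =ᶠ[𝓝 (γ 0)]
      fun v => G 0 (merge n v) / (1 - v (Fin.last n)) := by
    filter_upwards [hF0.fderiv (𝕜 := ℂ), (continuous_merge n).continuousAt.eventually hG0,
      (isOpen_convDomain _).mem_nhds h0, (isOpen_regularSet _).mem_nhds (hS 0)] with v h1 h2 h3 h4
    rw [h1, h2, ← partialDeriv_eq_fderiv (analyticAt_multiLog h3).differentiableAt,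
      eq_div_iff (sub_ne_zero.2 (apply_ne_one_of_mem_regularSet h4 _).symm), mul_comm]
    have := one_sub_mul_partialDeriv_multiLog (Fin.last n) h3
      (fun i hi => merge_mem_convDomain hi h3) (h4.1 _)
    simpa using this
  filter_upwards [GermContinuation.eventuallyEq hγ hA hB hAB 1, hF1.fderiv (𝕜 := ℂ),
    (continuous_merge n).continuousAt.eventually hG1] with v h1 h2 h3
  rw [← h2, ← h3]
  exact h1

/-- The derivative of a germ along a slice. -/
theorem eventually_hasDerivAt_slice {a : ℕ} (ha : a ≤ n) {z : Fin (n + 1) → ℂ}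
    (hz : z ∈ regularSet (n + 1)) {L : (Fin (n + 1) → ℂ) → ℂ} {L₁ : (Fin n → ℂ) → ℂ}
    (hL : AnalyticAt ℂ L z) (h : ∀ᶠ v in 𝓝 z, fderiv ℂ L v (Pi.single (Fin.last n) 1) =
      L₁ (merge n v) / (1 - v (Fin.last n))) :
    ∀ᶠ v in 𝓝 z, ∀ᶠ u in 𝓝 (seg v (a + 1) (n + 1)), HasDerivAt (fun u => L (slice a v u))
      (L₁ (merge n (slice a v u)) / (seg v (a + 1) n - u)) u := by
  filter_upwards [eventually_eventually_nhds.2 (h.and hL.eventually_analyticAt),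
    (isOpen_regularSet _).mem_nhds hz] with v hv hvS
  have hsl : slice a v (seg v (a + 1) (n + 1)) = v := slice_seg hvS.1 ha
  have hc : ContinuousAt (slice a v) (seg v (a + 1) (n + 1)) := (analyticAt_slice _).continuousAt
  rw [ContinuousAt, hsl] at hc
  filter_upwards [hc.eventually hv] with u hu
  have h1 := hu.2.differentiableAt.hasFDerivAt.comp_hasDerivAt u (hasDerivAt_slice u)
  refine h1.congr_deriv ?_
  set τ := seg v (a + 1) n
  have hτ : τ ≠ 0 := seg_ne_zero hvS.1 a n
  have h2 : (Pi.single (Fin.last n) τ⁻¹ : Fin (n + 1) → ℂ) = τ⁻¹ • Pi.single (Fin.last n) 1 := by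
    ext i
    by_cases hi : i = Fin.last n
    · subst hi
      simp
    · simp [hi]
  rw [h2, map_smul, hu.1, smul_eq_mul]
  have h3 : slice a v u (Fin.last n) = u / τ := Function.update_self ..
  rw [h3, ← div_eq_inv_mul, div_div]
  congr 1
  field_simp

theorem slice_self {m : ℕ} (v : Fin (m + 1) → ℂ) (u : ℂ) :
    slice m v u = Function.update v (Fin.last m) u := by
  rw [slice, seg_self, div_one]

theorem firstCoords_ne_zero {a : ℕ} {v : Fin n → ℂ} (hv : ∀ i, v i ≠ 0) (i : Fin a) :
    firstCoords a v i ≠ 0 := coord_ne_zero hv _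

theorem seg_firstCoords {a : ℕ} (v : Fin n → ℂ) {i j : ℕ} (hj : j ≤ a) :
    seg (firstCoords a v) (i + 1) j = seg v (i + 1) j := by
  rw [seg_succ, seg_succ]
  refine Finset.prod_congr rfl fun l hl => ?_
  rw [Finset.mem_Ico] at hl
  rw [coord_of_lt _ (show l < a by omega)]
  rfl

theorem merge_slice_self {a : ℕ} (v : Fin (a + 1) → ℂ) (u : ℂ) :
    merge a (slice a v u) = scaleLast (firstCoords a v) u := by
  ext i
  have hi := i.2
  have h1 : firstCoords a v i = v i.castSucc := coord_val v i.castSucc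
  rw [slice_self, merge, scaleLast, h1]
  by_cases h : i.val + 1 = a
  · rw [if_neg (by omega), if_pos h, if_pos h,
      Function.update_of_ne (Fin.castSucc_lt_last i).ne,
      show i.succ = Fin.last a from Fin.ext (by simpa using h), Function.update_self]
  · rw [if_pos (by omega), if_neg h, Function.update_of_ne (Fin.castSucc_lt_last i).ne]

theorem multiLog_eq_zero {x : Fin n → ℂ} (i : Fin n) (hi : x i = 0) : multiLog n x = 0 := by
  rw [multiLog, polylogSeries]
  refine (tsum_congr fun k => ?_).trans tsum_zero
  exact Finset.prod_eq_zero (Finset.mem_univ i) (by rw [hi, zero_pow (k.2.2 i).ne', zero_div])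

/-- Near the divisor `x_{a+1} ⋯ x_n = 1` the continued multiple logarithm is the sum of a
holomorphic function and of a holomorphic multiple of `log (1 - x_{a+1} ⋯ x_n)`. -/
theorem eventually_log_expansion (a k : ℕ) : ∀ {γ : I → Fin (a + k + 1) → ℂ}, Continuous γ →
    (∀ t, γ t ∈ regularSet (a + k + 1)) → γ 0 ∈ convDomain (a + k + 1) →
    (∀ t, ∀ j < a, ‖seg (γ t) (j + 1) (a + k + 1)‖ < 1) →
    (∀ j < a, ‖seg (γ 1) (j + 1) a‖ < 1) →
    ∀ {L : (Fin (a + k + 1) → ℂ) → ℂ}, ContinuesTo (multiLog (a + k + 1)) γ L →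
    ∀ᶠ v in 𝓝 (γ 1), ∀ r, DiscAdmissible a v r → seg v (a + 1) (a + k + 1) ∈ ball (1 : ℂ) r →
    ∀ ℓ : ℂ → ℂ, (∀ᶠ u in 𝓝 (seg v (a + 1) (a + k + 1)), HasDerivAt ℓ (-(1 - u)⁻¹) u) →
    ∃ Q, DifferentiableOn ℂ Q (ball 1 r) ∧ ∀ᶠ u in 𝓝 (seg v (a + 1) (a + k + 1)),
      L (slice a v u) = logCoeff a k (slice a v u) * ℓ u + Q u := by
  induction k with
  | zero =>
    intro γ hγ hS h0 hseg hco L hL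
    have hmem : ∀ t, merge a (γ t) ∈ convDomain a := fun t j hj => by
      rw [seg_merge_last _ hj]
      exact hseg t j hj
    -- By `hseg` the merged path stays in the domain of convergence, so the branch of `𝔏_a` at its
    -- end is still the power series.
    have hL₁ : ContinuesTo (multiLog a) (fun t => merge a (γ t)) (multiLog a) :=
      ContinuesTo.const fun t => analyticAt_multiLog (hmem t)
    have hder := eventually_hasDerivAt_slice (a := a) le_rfl (hS 1) hL.analyticAt_right
      (hL.eventually_fderiv_last hγ hS h0 hL₁)
    have hev : ∀ᶠ v in 𝓝 (γ 1), ∀ j : Fin a, ‖seg v (j.val + 1) a‖ < 1 ∧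
        ‖seg v (j.val + 1) (a + 1)‖ < 1 := by
      refine eventually_all.2 fun j => ?_
      have hc : ∀ b, Continuous fun v : Fin (a + 1) → ℂ => ‖seg v (j.val + 1) b‖ := by fun_prop
      exact ((hc a).continuousAt.eventually (gt_mem_nhds (hco j j.2))).and
        ((hc (a + 1)).continuousAt.eventually (gt_mem_nhds (hseg 1 j j.2)))
    filter_upwards [hder, hev, (isOpen_regularSet _).mem_nhds (hS 1)] with v hv hvj hvS r hr hu ℓ hℓ
    simp only [add_zero] at hu hℓ ⊢
    set u₀ := seg v (a + 1) (a + 1)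
    have hu₁ : u₀ ≠ 1 := (mem_regularSet_iff.1 hvS).2 _ _ (by omega) (by omega)
    have hsplit : ∀ j < a, seg v (j + 1) a * u₀ = seg v (j + 1) (a + 1) := fun j hj =>
      seg_mul_seg v hj.le (by omega)
    have hc1 : ∀ j < a, ∀ u ∈ ball (1 : ℂ) r, seg (firstCoords a v) (j + 1) a * u ≠ 1 := by
      intro j hj u hu h1
      rw [seg_firstCoords v le_rfl] at h1
      have h2 := hr.2.2 j hj
      rw [inv_eq_of_mul_eq_one_right h1] at h2
      rw [mem_ball, dist_comm, dist_eq_norm] at hu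
      linarith
    have hc2 : ∀ j < a, ‖seg (firstCoords a v) (j + 1) a * u₀‖ < 1 := by
      intro j hj
      rw [seg_firstCoords v le_rfl, hsplit j hj]
      exact (hvj ⟨j, hj⟩).2
    obtain ⟨Q₀, hQ₀, hQ₀'⟩ := exists_extension_scaleLast hu (hr.ne_zero hu)
      (firstCoords_ne_zero hvS.1) hc1 hc2
    have hQ1 := extension_scaleLast_one hu hc2 (fun j hj => by
      rw [seg_firstCoords v le_rfl]
      exact (hvj ⟨j, hj⟩).1) hQ₀ hQ₀'
    have hP : ∀ u, logCoeff a 0 (slice a v u) = -multiLog a (firstCoords a v) := by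
      intro u
      have h1 : multiLog 0 (yVec a 0 (slice a v u)) = 1 := by
        simp [multiLog, polylogSeries, Subsingleton.strictMono]
      rw [logCoeff, firstCoords_slice le_rfl, h1, mul_one]
    simp only [hP]
    -- The derivative is `Q₀ u / (1 - u)`. Splitting off the value `Q₀ 1 = 𝔏_a(x_1, …, x_a)` leaves
    -- a `T` that vanishes at `1`, and the constant becomes `-P`.
    refine exists_log_expansion (g := fun u => L (slice a v u))
      (P := fun _ => -multiLog a (firstCoords a v)) (R := fun _ => 0)
      (T := fun u => Q₀ u - multiLog a (firstCoords a v)) hu hu₁ (differentiableOn_const _)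
      (differentiableOn_const _) (hQ₀.sub_const _) (by rw [hQ1, sub_self]) hℓ ?_
    filter_upwards [hv, hQ₀'] with u h1 h2
    refine h1.congr_deriv ?_
    rw [merge_slice_self, ← h2, add_zero, seg_self]
    simp [div_eq_mul_inv]
  | succ k ih =>
    intro γ hγ hS h0 hseg hco L hL
    have hγm : Continuous fun t => merge (a + k + 1) (γ t) := (continuous_merge _).comp hγ
    have hSm : ∀ t, merge (a + k + 1) (γ t) ∈ regularSet (a + k + 1) := fun t =>
      merge_mem_regularSet le_rfl (hS t)
    have h0m : merge (a + k + 1) (γ 0) ∈ convDomain (a + k + 1) := merge_mem_convDomain le_rfl h0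
    obtain ⟨L₁, hL₁⟩ := exists_continuesTo_multiLog hγm hSm h0m
    have hder := eventually_hasDerivAt_slice (a := a) (n := a + k + 1) (by omega) (hS 1)
      hL.analyticAt_right (hL.eventually_fderiv_last hγ hS h0 hL₁)
    have hexp := (continuous_merge (n := a + k + 1) (a + k + 1)).continuousAt.eventually
      (ih hγm hSm h0m (fun t j hj => by
        rw [seg_merge_last _ (by omega)]
        exact hseg t j hj) (fun j hj => by
        rw [seg_merge_last_of_lt _ hj.le (by omega)]
        exact hco j hj) hL₁)
    filter_upwards [hder, hexp, (isOpen_regularSet _).mem_nhds (hS 1)] with v hv hve hvS r hr hu ℓ hℓ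
    have hum : seg (merge (a + k + 1) v) (a + 1) (a + k + 1) = seg v (a + 1) (a + k + 1 + 1) :=
      seg_merge_last v (by omega)
    change ∀ r, _ → seg (merge (a + k + 1) v) (a + 1) (a + k + 1) ∈ ball (1 : ℂ) r → _ at hve
    rw [hum] at hve
    obtain ⟨Q, hQ, hQ'⟩ := hve r (hr.mergeLast (n := a + k) (by omega)) hu ℓ hℓ
    have hu₁ : seg v (a + 1) (a + k + 1 + 1) ≠ 1 :=
      (mem_regularSet_iff.1 hvS).2 _ _ (by omega) (by omega)
    have hPd := hr.differentiableOn_logCoeff (k := k + 1) hvS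
    have hr0 : 0 < r := dist_nonneg.trans_lt hu
    have hP1 : logCoeff a (k + 1) (slice a v 1) = 0 := by
      rw [logCoeff, yVec_slice hvS.1, multiLog_eq_zero (Fin.last k) (by simp), mul_zero, neg_zero]
    -- Dividing the expansion of `L₁` by `τ - u` gives `P' ℓ + R`, with no pole at `1`. The choice
    -- `T = P`, allowed by `P 1 = 0`, makes the polar term zero.
    refine exists_log_expansion (g := fun u => L (slice a v u))
      (P := fun u => logCoeff a (k + 1) (slice a v u))
      (R := fun u => Q u / (seg v (a + 1) (a + k + 1) - u))
      (T := fun u => logCoeff a (k + 1) (slice a v u)) hu hu₁ hPd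
      (hQ.div (by fun_prop) fun u hu => sub_ne_zero.2 (hr.seg_ne hu (by omega) le_rfl))
      hPd hP1 hℓ ?_
    filter_upwards [hv, hQ', isOpen_ball.mem_nhds hu, isOpen_ne.mem_nhds hu₁] with u h1 h2 h3 h4
    refine h1.congr_deriv ?_
    rw [hr.deriv_logCoeff hvS h3 h4, merge_slice (n := a + k) (by omega) hvS.1, h2]
    ring

end Expansion

/-! ### The effect of a small loop around the divisor -/

section LocalMonodromy

open Metric unitInterval

theorem eq_of_exp_eq_of_norm_sub_lt {x y : ℂ} (h : Complex.exp x = Complex.exp y)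
    (hxy : ‖x - y‖ < 2 * Real.pi) : x = y := by
  obtain ⟨m, hm⟩ := Complex.exp_eq_exp_iff_exists_int.1 h
  have h1 : ‖x - y‖ = |(m : ℝ)| * (2 * Real.pi) := by
    rw [hm, add_sub_cancel_left, norm_mul, Complex.norm_intCast]
    simp [abs_of_pos Real.pi_pos]
  rw [h1] at hxy
  have h2 : |(m : ℝ)| < 1 := by
    by_contra! h
    nlinarith [Real.pi_pos]
  have h3 : m = 0 := Int.abs_lt_one_iff.1 (by exact_mod_cast h2)
  simpa [h3] using hm

/-- The branch of `log (1 - u)`, up to an additive constant, that takes the value `θ t` at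
`u = w t`. -/
noncomputable def logBranch (θ w : I → ℂ) (t : I) (u : ℂ) : ℂ :=
  θ t + Complex.log ((1 - u) / (1 - w t))

theorem logBranch_self {θ w : I → ℂ} (hw : ∀ t, w t ≠ 1) (t : I) :
    logBranch θ w t (w t) = θ t := by
  rw [logBranch, div_self (sub_ne_zero.2 (hw t).symm), Complex.log_one, add_zero]

theorem hasDerivAt_logBranch {θ w : I → ℂ} (hw : ∀ t, w t ≠ 1) (t : I) {u : ℂ}
    (hu : (1 - u) / (1 - w t) ∈ Complex.slitPlane) :
    HasDerivAt (logBranch θ w t) (-(1 - u)⁻¹) u := by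
  have h1 := (((hasDerivAt_id u).const_sub 1).div_const (1 - w t)).clog hu
  refine (h1.const_add (θ t)).congr_deriv ?_
  have h2 := sub_ne_zero.2 (hw t).symm
  have h3 : 1 - u ≠ 0 := fun h => Complex.slitPlane_ne_zero hu (by rw [h, zero_div])
  simp only [id]
  field_simp

theorem eventually_mem_slitPlane {w : I → ℂ} (hw : ∀ t, w t ≠ 1) (t : I) :
    ∀ᶠ u in 𝓝 (w t), (1 - u) / (1 - w t) ∈ Complex.slitPlane := by
  have hc : Continuous fun u => (1 - u) / (1 - w t) := by fun_prop
  refine hc.continuousAt.eventually (Complex.isOpen_slitPlane.mem_nhds ?_)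
  beta_reduce
  rw [div_self (sub_ne_zero.2 (hw t).symm)]
  exact Complex.one_mem_slitPlane

/-- All branches have exponential `μ * (1 - u)`. The difference of two of them is continuous in the
parameter and the point and starts from zero, so it is below `2π` nearby and hence zero. The factor
`μ` allows for `θ` being a logarithm along a loop of which `w` is a rescaling. -/
theorem germContinuation_logBranch {θ w : I → ℂ} (hθ : Continuous θ) (hwc : Continuous w)
    (hw : ∀ t, w t ≠ 1) {μ : ℂ} (h : ∀ t, Complex.exp (θ t) = μ * (1 - w t)) :
    GermContinuation w (logBranch θ w) := by
  have hw' : ∀ t, 1 - w t ≠ 0 := fun t => sub_ne_zero.2 (hw t).symm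
  refine ⟨fun t => ?_, fun t => ?_⟩
  · refine Complex.analyticAt_iff_eventually_differentiableAt.2 ?_
    filter_upwards [eventually_mem_slitPlane hw t] with u hu
    exact (hasDerivAt_logBranch hw t hu).differentiableAt
  · have hd : ContinuousAt (fun q : I × ℂ => logBranch θ w q.1 q.2 - logBranch θ w t q.2)
        (t, w t) := by
      have h1 : (1 - w t) / (1 - w t) ∈ Complex.slitPlane := by
        rw [div_self (hw' t)]
        exact Complex.one_mem_slitPlane
      have hq : ContinuousAt (fun q : I × ℂ => (1 - q.2) / (1 - w q.1)) (t, w t) :=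
        ContinuousAt.div (by fun_prop) (by fun_prop) (hw' t)
      have hq' : ContinuousAt (fun q : I × ℂ => (1 - q.2) / (1 - w t)) (t, w t) := by fun_prop
      exact ((by fun_prop : ContinuousAt (fun q : I × ℂ => θ q.1) (t, w t)).add
        (hq.clog h1)).sub (continuousAt_const.add (hq'.clog h1))
    have hev : ∀ᶠ q : I × ℂ in 𝓝 (t, w t), logBranch θ w q.1 q.2 = logBranch θ w t q.2 := by
      have h0 : ∀ᶠ q : I × ℂ in 𝓝 (t, w t),
          logBranch θ w q.1 q.2 - logBranch θ w t q.2 ∈ ball (0 : ℂ) (2 * Real.pi) :=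
        hd.eventually (isOpen_ball.mem_nhds (by simp [Real.pi_pos]))
      have h1 : ∀ᶠ q : I × ℂ in 𝓝 (t, w t), q.2 ≠ 1 :=
        continuousAt_snd.eventually_ne (hw t)
      filter_upwards [h0, h1] with q hq hq1
      have hq2 : 1 - q.2 ≠ 0 := sub_ne_zero.2 hq1.symm
      refine eq_of_exp_eq_of_norm_sub_lt ?_ (by simpa using hq)
      have key : ∀ s, Complex.exp (logBranch θ w s q.2) = μ * (1 - q.2) := fun s => by
        rw [logBranch, Complex.exp_add, h, Complex.exp_log (div_ne_zero hq2 (hw' s))]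
        have := hw' s
        field_simp
      rw [key, key]
    have hcw : ContinuousAt (fun t' => (t', w t')) t := by fun_prop
    filter_upwards [hcw.eventually (eventually_eventually_nhds.2 hev)] with t' ht'
    exact (by fun_prop : ContinuousAt (fun u : ℂ => (t', u)) (w t')).eventually ht'

/-- By compactness `‖1 - u t‖` attains its maximum, and finitely many strict inequalities leave room
for one radius above it. -/
theorem exists_radius {a m : ℕ} {z : Fin (m + 1) → ℂ} {u : I → ℂ} (hu : Continuous u)
    (h1 : ∀ t, ‖1 - u t‖ < 1) (h2 : ∀ t, ∀ k, a < k → k ≤ m → ‖1 - u t‖ < ‖1 - seg z (a + 1) k‖)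
    (h3 : ∀ t, ∀ j < a, ‖1 - u t‖ < ‖1 - (seg z (j + 1) a)⁻¹‖) :
    ∃ r, (∀ t, ‖1 - u t‖ < r) ∧ r < 1 ∧ (∀ k, a < k → k ≤ m → r < ‖1 - seg z (a + 1) k‖) ∧
      ∀ j < a, r < ‖1 - (seg z (j + 1) a)⁻¹‖ := by
  obtain ⟨t₀, -, ht₀⟩ := isCompact_univ.exists_isMaxOn Set.univ_nonempty
    (f := fun t => ‖1 - u t‖) (by fun_prop)
  have e1 : ∀ᶠ r in 𝓝[>] ‖1 - u t₀‖, r < 1 := nhdsWithin_le_nhds (gt_mem_nhds (h1 t₀))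
  have e2 : ∀ᶠ r in 𝓝[>] ‖1 - u t₀‖, ∀ k ∈ Finset.Ioc a m, r < ‖1 - seg z (a + 1) k‖ := by
    refine (Finset.eventually_all _).2 fun k hk => nhdsWithin_le_nhds (gt_mem_nhds ?_)
    rw [Finset.mem_Ioc] at hk
    exact h2 t₀ k hk.1 hk.2
  have e3 : ∀ᶠ r in 𝓝[>] ‖1 - u t₀‖, ∀ j ∈ Finset.range a, r < ‖1 - (seg z (j + 1) a)⁻¹‖ :=
    (Finset.eventually_all _).2 fun j hj => nhdsWithin_le_nhds
      (gt_mem_nhds (h3 t₀ j (Finset.mem_range.1 hj)))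
  obtain ⟨r, ⟨⟨hr, hr1⟩, hr2⟩, hr3⟩ := (((eventually_mem_nhdsWithin.and e1).and e2).and e3).exists
  exact ⟨r, fun t => (ht₀ (Set.mem_univ t)).trans_lt hr, hr1,
    fun k hk hk' => hr2 k (Finset.mem_Ioc.2 ⟨hk, hk'⟩), fun j hj => hr3 j (Finset.mem_range.2 hj)⟩

/-- Finitely many open conditions: one radius serves the slices through all points near `z`. -/
theorem eventually_discAdmissible {a m : ℕ} {z : Fin (m + 1) → ℂ} (hz : ∀ i, z i ≠ 0) {r : ℝ}
    (h1 : r < 1) (h2 : ∀ k, a < k → k ≤ m → r < ‖1 - seg z (a + 1) k‖)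
    (h3 : ∀ j < a, r < ‖1 - (seg z (j + 1) a)⁻¹‖) : ∀ᶠ v in 𝓝 z, DiscAdmissible a v r := by
  have e2 : ∀ᶠ v in 𝓝 z, ∀ k ∈ Finset.Ioc a m, r < ‖1 - seg v (a + 1) k‖ := by
    refine (Finset.eventually_all _).2 fun k hk => ?_
    rw [Finset.mem_Ioc] at hk
    have hc : Continuous fun v : Fin (m + 1) → ℂ => ‖1 - seg v (a + 1) k‖ := by fun_prop
    exact hc.continuousAt.eventually (lt_mem_nhds (h2 k hk.1 hk.2))
  have e3 : ∀ᶠ v in 𝓝 z, ∀ j ∈ Finset.range a, r < ‖1 - (seg v (j + 1) a)⁻¹‖ := by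
    refine (Finset.eventually_all _).2 fun j hj => ?_
    have hs : ContinuousAt (fun v : Fin (m + 1) → ℂ => (seg v (j + 1) a)⁻¹) z :=
      ContinuousAt.inv₀ (by fun_prop) (seg_ne_zero hz j a)
    have hc : ContinuousAt (fun v : Fin (m + 1) → ℂ => ‖1 - (seg v (j + 1) a)⁻¹‖) z := by fun_prop
    exact hc.eventually (lt_mem_nhds (h3 j (Finset.mem_range.1 hj)))
  filter_upwards [e2, e3] with v h4 h5
  exact ⟨h1.le, fun k hk hk' => (h4 k (Finset.mem_Ioc.2 ⟨hk, hk'⟩)).le,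
    fun j hj => (h5 j (Finset.mem_range.2 hj)).le⟩

/-- The values of the last coordinate function `x_{a+1} ⋯ x_n` along the loop at `v` that is
parallel to a given loop at `z`, along which it takes the values `u`. -/
noncomputable def parallel {n : ℕ} (a : ℕ) (z : Fin n → ℂ) (u : I → ℂ) (v : Fin n → ℂ)
    (t : I) : ℂ :=
  1 - (1 - seg v (a + 1) n) / (1 - seg z (a + 1) n) * (1 - u t)

theorem continuous_parallel {n a : ℕ} {z : Fin n → ℂ} {u : I → ℂ} (hu : Continuous u) :
    Continuous (Function.uncurry (parallel a z u)) := by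
  unfold parallel Function.uncurry
  fun_prop

theorem continuous_parallel_apply {n a : ℕ} {z : Fin n → ℂ} {u : I → ℂ} (hu : Continuous u)
    (v : Fin n → ℂ) : Continuous (parallel a z u v) := by
  unfold parallel
  fun_prop

theorem parallel_self {n a : ℕ} {z : Fin n → ℂ} {u : I → ℂ} (hz : seg z (a + 1) n ≠ 1) (t : I) :
    parallel a z u z t = u t := by
  rw [parallel, div_self (sub_ne_zero.2 hz.symm)]
  ring

/-- The scaling factor in `parallel` is chosen so that a loop that begins and ends at `z` becomes
one that begins and ends at `v`. -/
theorem parallel_of_eq {n a : ℕ} {z : Fin n → ℂ} {u : I → ℂ} (hz : seg z (a + 1) n ≠ 1)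
    (v : Fin n → ℂ) {t : I} (ht : u t = seg z (a + 1) n) :
    parallel a z u v t = seg v (a + 1) n := by
  rw [parallel, ht, div_mul_cancel₀ _ (sub_ne_zero.2 hz.symm)]
  ring

theorem continuousAt_slice_uncurry {n a : ℕ} {z : Fin (n + 1) → ℂ} (hz : ∀ i, z i ≠ 0) (u : ℂ) :
    ContinuousAt (fun q : (Fin (n + 1) → ℂ) × ℂ => slice a q.1 q.2) (z, u) := by
  unfold slice
  refine ContinuousAt.update continuousAt_fst _ (ContinuousAt.div continuousAt_snd ?_
    (seg_ne_zero hz a n))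
  fun_prop

/-- The loop at `v` that is parallel to a given loop at `z`. -/
noncomputable def parallelLoop {n : ℕ} (a : ℕ) (z : Fin (n + 1) → ℂ) (u : I → ℂ)
    (v : Fin (n + 1) → ℂ) (t : I) : Fin (n + 1) → ℂ :=
  slice a v (parallel a z u v t)

/-- Loops parallel to a given small loop, with the germs that continuation along them produces. -/
theorem eventually_exists_parallel_continuation {a m : ℕ} (ha : a ≤ m) {z : Fin (m + 1) → ℂ}
    (hz : z ∈ regularSet (m + 1))
    {L Lc : (Fin (m + 1) → ℂ) → ℂ} (hLan : AnalyticAt ℂ L z)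
    (hcL : Continuable Subtype.val L (⟨z, hz⟩ : regularSet (m + 1)))
    {c : Path (⟨z, hz⟩ : regularSet (m + 1)) ⟨z, hz⟩} {u : I → ℂ} (huc : Continuous u)
    (hcu : ∀ t, (c t : Fin (m + 1) → ℂ) = slice a z (u t))
    (hLc : ContinuesTo L (fun t => (c t : Fin (m + 1) → ℂ)) Lc) :
    ∀ᶠ v in 𝓝 z, ∃ G,
      IsContinuation (parallelLoop a z u v) G ∧
        G 0 =ᶠ[𝓝 v] L ∧ G 1 v = Lc v := by
  have hz1 : seg z (a + 1) (m + 1) ≠ 1 :=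
    (mem_regularSet_iff.1 hz).2 _ _ (by omega) le_rfl
  have hseg_c : ∀ t, seg (c t : Fin (m + 1) → ℂ) (a + 1) (m + 1) = u t := fun t => by
    rw [hcu, seg_slice hz.1 (by omega)]
  have hu0 : u 0 = seg z (a + 1) (m + 1) := by
    rw [← hseg_c, c.source]
  have hu1' : u 1 = seg z (a + 1) (m + 1) := by
    rw [← hseg_c, c.target]
  have hwc : Continuous (Function.uncurry (parallel a z u)) := continuous_parallel huc
  have hwv : ∀ v : Fin (m + 1) → ℂ, Continuous (parallel a z u v) := continuous_parallel_apply huc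
  have hHz : parallelLoop a z u z = fun t => (c t : Fin (m + 1) → ℂ) := by
    funext t
    change slice a z (parallel a z u z t) = _
    rw [hcu, parallel_self hz1]
  have hHc : ∀ t, ContinuousAt (Function.uncurry (parallelLoop a z u)) (z, t) := by
    intro t
    exact ContinuousAt.comp (f := fun q : (Fin (m + 1) → ℂ) × I => (q.1, parallel a z u q.1 q.2))
      (g := fun q : (Fin (m + 1) → ℂ) × ℂ => slice a q.1 q.2)
      (x := (z, t))
      (continuousAt_slice_uncurry hz.1 _) (continuousAt_fst.prodMk hwc.continuousAt)
  have hHv : ∀ v : Fin (m + 1) → ℂ, Continuous (parallelLoop a z u v) := fun v =>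
    (continuous_iff_continuousAt.2 fun u => (analyticAt_slice u).continuousAt).comp (hwv v)
  -- Compactness of the interval: the parallel loops at points near `z` avoid the divisors at all
  -- times at once.
  have hHR : ∀ᶠ v in 𝓝 z, ∀ t ∈ Set.univ,
      parallelLoop a z u v t ∈ regularSet (m + 1) := by
    refine isCompact_univ.eventually_forall_of_forall_eventually fun t _ => ?_
    have hmem : Function.uncurry (parallelLoop a z u) (z, t) ∈ regularSet (m + 1) := by
      change parallelLoop a z u z t ∈ _
      rw [hHz]
      exact (c t).2
    have h : ∀ᶠ q in 𝓝 (z, t), Function.uncurry (parallelLoop a z u) q ∈ regularSet (m + 1) :=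
      (hHc t).eventually ((isOpen_regularSet _).mem_nhds hmem)
    exact h
  have hsub : Continuous (Subtype.val : regularSet (m + 1) → Fin (m + 1) → ℂ) :=
    continuous_subtype_val
  have := (isOpen_regularSet (m + 1)).locallyPathConnectedSpace
  have hcontL : ∀ᶠ v in 𝓝 z, ∃ hv : v ∈ regularSet (m + 1),
      Continuable Subtype.val L ⟨v, hv⟩ := by
    have h := hcL.eventually hsub hLan
    rw [show 𝓝 z = _ from ((isOpen_regularSet (m + 1)).isOpenEmbedding_subtypeVal.map_nhds_eq
      ⟨z, hz⟩).symm, eventually_map]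
    exact h.mono fun x hx => ⟨x.2, hx⟩
  have hH0 : ∀ v ∈ regularSet (m + 1), parallelLoop a z u v 0 = v := fun v hv => by
    change slice a v (parallel _ _ _ _ _) = v
    rw [parallel_of_eq hz1 v hu0, slice_seg hv.1 (by omega)]
  have hH1 : ∀ v ∈ regularSet (m + 1), parallelLoop a z u v 1 = v := fun v hv => by
    change slice a v (parallel _ _ _ _ _) = v
    rw [parallel_of_eq hz1 v hu1', slice_seg hv.1 (by omega)]
  have hG : ∀ᶠ v in 𝓝 z, ∃ G, IsContinuation (parallelLoop a z u v) G ∧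
      G 0 =ᶠ[𝓝 (parallelLoop a z u v 0)] L := by
    filter_upwards [hHR, hcontL] with v hv ⟨hvR, hvL⟩
    let P : Path (⟨v, hvR⟩ : regularSet (m + 1)) ⟨v, hvR⟩ :=
      { toFun := fun t => ⟨parallelLoop a z u v t, hv t (Set.mem_univ t)⟩
        continuous_toFun := (hHv v).subtype_mk _
        source' := Subtype.ext (hH0 v hvR)
        target' := Subtype.ext (hH1 v hvR) }
    obtain ⟨g, G, hG, hG0, -⟩ := hvL _ P
    exact ⟨G, hG, hG0⟩
  have hG' : ∀ v, ∃ G, (∃ G, IsContinuation (parallelLoop a z u v) G ∧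
      G 0 =ᶠ[𝓝 (parallelLoop a z u v 0)] L) →
      IsContinuation (parallelLoop a z u v) G ∧ G 0 =ᶠ[𝓝 (parallelLoop a z u v 0)] L := fun v => by
    by_cases h : ∃ G, IsContinuation (parallelLoop a z u v) G ∧ G 0 =ᶠ[𝓝 (parallelLoop a z u v 0)] L
    · exact ⟨h.choose, fun _ => h.choose_spec⟩
    · exact ⟨fun _ => L, fun h' => absurd h' h⟩
  choose G hG' using hG'
  replace hG := hG.mono hG'
  have := locallyConnectedSpace_unitInterval
  have hHz0 : parallelLoop a z u z 0 = z := hH0 z hz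
  have hHz1 : parallelLoop a z u z 1 = z := hH1 z hz
  -- Continuation along the parallel loop at `v` ends with the germ of `Lc`, so the value of `Lc` at
  -- `v` can be computed inside the slice through `v`.
  have hnear : ∀ᶠ v in 𝓝 z, G v 1 =ᶠ[𝓝 (parallelLoop a z u v 1)] G z 1 := by
    refine GermContinuation.eventuallyEq_nearby hHc (Eventually.of_forall hHv)
      (hG.mono fun v h => h.1) (t₀ := 0) ?_ 1
    have hz0 := hG.self_of_nhds.2
    rw [hHz0] at hz0
    filter_upwards [hG, eventually_eventually_nhds.2 hz0,
      (isOpen_regularSet _).mem_nhds hz] with v hv hv0 hvR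
    rw [hH0 v hvR] at hv ⊢
    exact hv.2.trans (EventuallyEq.symm hv0)
  have hLc' : G z 1 =ᶠ[𝓝 z] Lc := by
    have h : ContinuesTo L (fun t => (c t : Fin (m + 1) → ℂ)) (G z 1) := by
      rw [← hHz]
      exact ⟨G z, hG.self_of_nhds.1, hG.self_of_nhds.2, EventuallyEq.rfl⟩
    have := h.unique (by fun_prop) hLc
    simpa using this
  filter_upwards [hG, hnear, hLc', (isOpen_regularSet _).mem_nhds hz] with v hvG hvn hvLc hvR
  rw [hH0 v hvR] at hvG
  refine ⟨G v, hvG.1, hvG.2, ?_⟩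
  rw [hH1 v hvR] at hvn
  rw [← hvLc]
  exact hvn.self_of_nhds

/-- The effect on the multiple logarithm of a small loop around `x_{a+1} ⋯ x_n = 1`. -/
theorem eventually_sub_eq_mul_logCoeff {a k : ℕ} {b z : regularSet (a + k + 1)}
    (hb : (b : Fin (a + k + 1) → ℂ) ∈ convDomain (a + k + 1)) {γ : Path b z}
    (hseg : ∀ t, ∀ j < a, ‖seg (γ t : Fin (a + k + 1) → ℂ) (j + 1) (a + k + 1)‖ < 1)
    (hco : ∀ j < a, ‖seg (z : Fin (a + k + 1) → ℂ) (j + 1) a‖ < 1)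
    {L Lc : (Fin (a + k + 1) → ℂ) → ℂ}
    (hL : ContinuesTo (multiLog (a + k + 1)) (fun t => (γ t : Fin (a + k + 1) → ℂ)) L)
    {c : Path z z} {u : I → ℂ} (huc : Continuous u)
    (hcu : ∀ t, (c t : Fin (a + k + 1) → ℂ) = slice a z (u t))
    (h1 : ∀ t, ‖1 - u t‖ < 1)
    (h2 : ∀ t, ∀ j, a < j → j ≤ a + k →
      ‖1 - u t‖ < ‖1 - seg (z : Fin (a + k + 1) → ℂ) (a + 1) j‖)
    (h3 : ∀ t, ∀ j < a, ‖1 - u t‖ < ‖1 - (seg (z : Fin (a + k + 1) → ℂ) (j + 1) a)⁻¹‖)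
    (hLc : ContinuesTo L (fun t => (c t : Fin (a + k + 1) → ℂ)) Lc)
    {θ : I → ℂ} (hθc : Continuous θ) (hθ : ∀ t, Complex.exp (θ t) = 1 - u t) :
    ∀ᶠ v in 𝓝 (z : Fin (a + k + 1) → ℂ), Lc v - L v = (θ 1 - θ 0) * logCoeff a k v := by
  have hz1 : seg (z : Fin (a + k + 1) → ℂ) (a + 1) (a + k + 1) ≠ 1 :=
    (mem_regularSet_iff.1 z.2).2 _ _ (by omega) le_rfl
  have hu1 : ∀ t, 1 - u t ≠ 0 := fun t => hθ t ▸ Complex.exp_ne_zero _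
  have hseg_c : ∀ t, seg (c t : Fin (a + k + 1) → ℂ) (a + 1) (a + k + 1) = u t := fun t => by
    rw [hcu, seg_slice z.2.1 (by omega)]
  have hu0 : u 0 = seg (z : Fin (a + k + 1) → ℂ) (a + 1) (a + k + 1) := by
    rw [← hseg_c, c.source]
  have hu1' : u 1 = seg (z : Fin (a + k + 1) → ℂ) (a + 1) (a + k + 1) := by
    rw [← hseg_c, c.target]
  obtain ⟨r, hr0, hr1, hr2, hr3⟩ := exists_radius huc h1 h2 h3
  have hLan : AnalyticAt ℂ L z := by simpa using hL.analyticAt_right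
  have hcont : Continuable Subtype.val (multiLog (a + k + 1)) b := fun x p =>
    exists_continuesTo_multiLog (by fun_prop) (fun t => (p t).2) (by simpa using hb)
  have hG := eventually_exists_parallel_continuation (m := a + k) (by omega) z.2 hLan
    (hcont.move continuous_subtype_val hL) huc hcu hLc
  have hr : ∀ᶠ v in 𝓝 (z : Fin (a + k + 1) → ℂ), ∀ t ∈ Set.univ, ‖1 - parallel a z u v t‖ < r := by
    refine isCompact_univ.eventually_forall_of_forall_eventually fun t _ => ?_
    have hn : Continuous fun q : (Fin (a + k + 1) → ℂ) × I =>
        ‖1 - Function.uncurry (parallel a z u) q‖ := by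
      have := continuous_parallel (a := a) (z := (z : Fin (a + k + 1) → ℂ)) huc
      fun_prop
    have hlt : ‖1 - Function.uncurry (parallel a (z : Fin (a + k + 1) → ℂ) u)
        ((z : Fin (a + k + 1) → ℂ), t)‖ < r := by
      rw [Function.uncurry_apply_pair, parallel_self hz1 t]
      exact hr0 t
    have h : ∀ᶠ q in 𝓝 ((z : Fin (a + k + 1) → ℂ), t),
        ‖1 - Function.uncurry (parallel a (z : Fin (a + k + 1) → ℂ) u) q‖ < r :=
      hn.continuousAt.eventually (gt_mem_nhds hlt)
    exact h
  have hexp := eventually_log_expansion a k (γ := fun t => (γ t : Fin (a + k + 1) → ℂ))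
    (by fun_prop) (fun t => (γ t).2) (by simpa using hb) hseg (by simpa using hco) hL
  simp only [Path.target] at hexp
  filter_upwards [hexp, hG, hr, (isOpen_regularSet _).mem_nhds z.2,
    eventually_discAdmissible z.2.1 hr1 hr2 hr3] with v hve ⟨G, hvG, hvG0, hvG1⟩ hvw hvR hvr
  obtain ⟨w, hw⟩ : ∃ w, w = parallel a (z : Fin (a + k + 1) → ℂ) u v := ⟨_, rfl⟩
  unfold parallelLoop at hvG
  rw [← hw] at hvG hvw
  have hwc : Continuous w :=
    hw ▸ continuous_parallel_apply huc v
  have hw0 : w 0 = seg v (a + 1) (a + k + 1) := hw ▸ parallel_of_eq hz1 v hu0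
  have hw1 : w 1 = seg v (a + 1) (a + k + 1) := hw ▸ parallel_of_eq hz1 v hu1'
  have hvu1 : seg v (a + 1) (a + k + 1) ≠ 1 :=
    (mem_regularSet_iff.1 hvR).2 _ _ (by omega) le_rfl
  have hwr : ∀ t, w t ∈ ball (1 : ℂ) r := fun t => by
    rw [mem_ball, dist_comm, dist_eq_norm]
    exact hvw t (Set.mem_univ t)
  have hwsub : ∀ t, 1 - w t = (1 - seg v (a + 1) (a + k + 1)) /
      (1 - seg (z : Fin (a + k + 1) → ℂ) (a + 1) (a + k + 1)) * (1 - u t) := fun t => by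
    simp [hw, parallel]
  have hz1' := sub_ne_zero.2 hz1.symm
  have hvu1' := sub_ne_zero.2 hvu1.symm
  have hwne : ∀ t, w t ≠ 1 := fun t h => by
    have := hwsub t
    rw [h, sub_self] at this
    exact mul_ne_zero (div_ne_zero hvu1' hz1') (hu1 t) this.symm
  obtain ⟨ℓ, hℓe⟩ : ∃ ℓ, ℓ = logBranch θ w := ⟨_, rfl⟩
  have hℓ : GermContinuation w ℓ := by
    rw [hℓe]
    -- `θ` is a logarithm of `1 - u`, and `1 - u` is this constant `μ` times `1 - w`.
    refine germContinuation_logBranch hθc hwc hwne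
      (μ := (1 - seg (z : Fin (a + k + 1) → ℂ) (a + 1) (a + k + 1)) /
        (1 - seg v (a + 1) (a + k + 1))) fun t => ?_
    rw [hθ, hwsub]
    field_simp
  have hu_ball := hwr 0
  rw [hw0] at hu_ball
  obtain ⟨Q, hQ, hQ'⟩ := hve r hvr hu_ball (ℓ 0) (by
    have := eventually_mem_slitPlane hwne 0
    rw [hw0] at this
    filter_upwards [this] with u hu
    rw [hℓe]
    exact hasDerivAt_logBranch hwne 0 (by rwa [hw0]))
  have hP := hvr.differentiableOn_logCoeff (k := k) hvR
  have hfam : GermContinuation w fun t u => logCoeff a k (slice a v u) * ℓ t u + Q u := by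
    refine ⟨fun t => ?_, fun t => ?_⟩
    · exact ((hP.analyticAt (isOpen_ball.mem_nhds (hwr t))).mul (hℓ.1 t)).add
        (hQ.analyticAt (isOpen_ball.mem_nhds (hwr t)))
    · filter_upwards [hℓ.2 t] with t' ht'
      filter_upwards [ht'] with u hu
      rw [hu]
  have hfam' : GermContinuation w fun t u => G t (slice a v u) :=
    hvG.comp_analytic (γ := w) (φ := slice a v) fun t => analyticAt_slice _
  -- The coefficient and `Q` are single-valued on the disc that contains the loop, so only `ℓ`
  -- changes along it: its value at the base point passes from `θ 0` to `θ 1`.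
  have hend := GermContinuation.eventuallyEq hwc hfam' hfam (t₀ := 0) (by
    have h0 : ∀ᶠ u in 𝓝 (w 0), G 0 (slice a v u) = L (slice a v u) :=
      (analyticAt_slice _).continuousAt.eventually (p := fun y => G 0 y = L y)
        (by rwa [hw0, slice_seg hvR.1 (by omega)])
    rw [hw0] at h0 ⊢
    filter_upwards [h0, hQ'] with u e1 e2
    rw [e1, e2]) 1
  have hsv := slice_seg (a := a) hvR.1 (by omega)
  have e1 := hend.self_of_nhds
  have e2 := hQ'.self_of_nhds
  have e4 : ℓ 1 (w 1) = θ 1 := hℓe ▸ logBranch_self hwne 1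
  have e5 : ℓ 0 (w 0) = θ 0 := hℓe ▸ logBranch_self hwne 0
  beta_reduce at e1
  rw [e4, hw1, hsv] at e1
  rw [hw0] at e5
  rw [e5, hsv] at e2
  rw [← hvG1, e1, e2]
  ring

end LocalMonodromy

/-! ### Logarithmic increments and conjugate loops -/

section LogIncrements

open unitInterval

variable {X : Type*} [TopologicalSpace X] {f : X → ℂ} {x y z : X}

theorem exists_logIncrement (hf : Continuous f) (hf0 : ∀ x, f x ≠ 0) (P : Path x y) :
    ∃ w, LogIncrement (fun t => f (P t)) w := by
  obtain ⟨e, he⟩ : ∃ e, Complex.exp e = f x := ⟨_, Complex.exp_log (hf0 x)⟩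
  obtain ⟨θ, hθ, -⟩ := Complex.isCoveringMap_exp.exists_path_lifts
    ⟨fun t => ⟨f (P t), hf0 _⟩, by fun_prop⟩ e (Subtype.ext (by simp [he]))
  exact ⟨_, θ, fun t => congrArg Subtype.val (congrFun hθ t), rfl⟩

/-- Logarithms along a path are its lifts through the covering `exp`, and lifts of homotopic paths
from the same point have the same end. -/
theorem LogIncrement.of_homotopic (hf : Continuous f) (hf0 : ∀ x, f x ≠ 0) {P Q : Path x y}
    (h : P.Homotopic Q) {w : ℂ} (hP : LogIncrement (fun t => f (P t)) w) :
    LogIncrement (fun t => f (Q t)) w := by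
  obtain ⟨θ, hθ, rfl⟩ := hP
  let F : C(X, {z : ℂ // z ≠ 0}) := ⟨fun x => ⟨f x, hf0 x⟩, by fun_prop⟩
  have h0 : (P.map F.continuous) 0 = (⟨_, Complex.exp_ne_zero (θ 0)⟩ : {z : ℂ // z ≠ 0}) :=
    Subtype.ext (hθ 0).symm
  have h1 : (Q.map F.continuous) 0 = (⟨_, Complex.exp_ne_zero (θ 0)⟩ : {z : ℂ // z ≠ 0}) := by
    rw [← h0, Path.source, Path.source]
  have key : Complex.isCoveringMap_exp.liftPath (P.map F.continuous) (θ 0) h0 1 =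
      Complex.isCoveringMap_exp.liftPath (Q.map F.continuous) (θ 0) h1 1 :=
    Complex.isCoveringMap_exp.liftPath_apply_one_eq_of_homotopicRel (h.map F) (θ 0) h0 h1
  have hθ' : θ = Complex.isCoveringMap_exp.liftPath (P.map F.continuous) (θ 0) h0 :=
    (Complex.isCoveringMap_exp.eq_liftPath_iff' h0).2 ⟨funext fun t => Subtype.ext (hθ t), rfl⟩
  refine ⟨Complex.isCoveringMap_exp.liftPath (Q.map F.continuous) (θ 0) h1, fun t => ?_, ?_⟩
  · exact congrArg Subtype.val
      (congrFun (Complex.isCoveringMap_exp.liftPath_lifts (Q.map F.continuous) (θ 0) h1) t)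
  · rw [← key, ← hθ', Complex.isCoveringMap_exp.liftPath_zero]

theorem LogIncrement.unique {g : I → ℂ} {w w' : ℂ} (h : LogIncrement g w)
    (h' : LogIncrement g w') : w = w' := by
  obtain ⟨θ, hθ, rfl⟩ := h
  obtain ⟨θ', hθ', rfl⟩ := h'
  have h0 : Complex.exp (θ 0 - θ' 0) = 1 := by
    rw [Complex.exp_sub, hθ, ← hθ' 0, div_self (Complex.exp_ne_zero _)]
  have := Complex.isCoveringMap_exp.eq_of_comp_eq θ.continuous
    (show Continuous fun t => θ' t + (θ 0 - θ' 0) by fun_prop)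
    (funext fun t => Subtype.ext (by simp [Complex.exp_add, h0, hθ, hθ'])) 0 (by ring)
  rw [congrFun this 1]
  ring

theorem LogIncrement.symm {P : Path x y} {w : ℂ} (h : LogIncrement (fun t => f (P t)) w) :
    LogIncrement (fun t => f (P.symm t)) (-w) := by
  obtain ⟨θ, hθ, rfl⟩ := h
  refine ⟨⟨fun t => θ (σ t), by fun_prop⟩, fun t => hθ (σ t), ?_⟩
  simp

theorem LogIncrement.trans {P : Path x y} {Q : Path y z} {w w' : ℂ}
    (h : LogIncrement (fun t => f (P t)) w) (h' : LogIncrement (fun t => f (Q t)) w') :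
    LogIncrement (fun t => f ((P.trans Q) t)) (w + w') := by
  obtain ⟨θ, hθ, rfl⟩ := h
  obtain ⟨θ', hθ', rfl⟩ := h'
  have h0 : Complex.exp (θ 1 - θ' 0) = 1 := by
    have h1 : Complex.exp (θ 1) = Complex.exp (θ' 0) := by
      rw [hθ, hθ']
      simp
    rw [Complex.exp_sub, h1, div_self (Complex.exp_ne_zero _)]
  let A : Path (θ 0) (θ 1) := ⟨θ, rfl, rfl⟩
  -- The second logarithm is shifted by a period of `exp` so that it begins where the first one
  -- ends.
  let B : Path (θ 1) (θ' 1 + (θ 1 - θ' 0)) :=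
    ⟨⟨fun t => θ' t + (θ 1 - θ' 0), by fun_prop⟩, by simp, by simp⟩
  refine ⟨(A.trans B).toContinuousMap, fun t => ?_, ?_⟩
  · change Complex.exp ((A.trans B) t) = _
    beta_reduce
    rw [Path.trans_apply A, Path.trans_apply P]
    split_ifs
    · exact hθ _
    · change Complex.exp (θ' _ + (θ 1 - θ' 0)) = _
      rw [Complex.exp_add, h0, mul_one]
      exact hθ' _
  · change (A.trans B) 1 - (A.trans B) 0 = _
    rw [Path.source, Path.target]
    ring

/-- A loop and its conjugates have the same logarithmic increment. -/
theorem LogIncrement.of_conj (hf : Continuous f) (hf0 : ∀ x, f x ≠ 0) {b : X} {p : Path b x}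
    {γ : Path b z} {q : Path x x} {c : Path z z}
    (h : q.Homotopic (p.symm.trans ((γ.trans (c.trans γ.symm)).trans p))) {w : ℂ}
    (hq : LogIncrement (fun t => f (q t)) w) : LogIncrement (fun t => f (c t)) w := by
  obtain ⟨wp, hp⟩ := exists_logIncrement hf hf0 p
  obtain ⟨wg, hg⟩ := exists_logIncrement hf hf0 γ
  obtain ⟨wc, hc⟩ := exists_logIncrement hf hf0 c
  have h1 := (hp.symm.trans ((hg.trans (hc.trans hg.symm)).trans hp)).of_homotopic hf hf0 h.symm
  have h2 : wc = w := by
    rw [hq.unique h1]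
    ring
  exact h2 ▸ hc

open Path.Homotopic in
theorem homotopic_trans_symm_trans {b : X} (γ : Path b z) (p : Path b x) :
    (γ.trans (γ.symm.trans p)).Homotopic p := by
  rw [← Path.Homotopic.Quotient.eq]
  simp only [Quotient.mk_trans, Quotient.mk_symm]
  rw [← Quotient.trans_assoc, Quotient.trans_symm, Quotient.refl_trans]

-- The path `p` cancels against the initial `p⁻¹` of the conjugated loop. This isolates the part
-- from `z` to `x` as `γ⁻¹p`, the path along which both sides of the formula are continued.
open Path.Homotopic in
theorem homotopic_trans_of_conj {b : X} {p : Path b x} {γ : Path b z} {q : Path x x} {c : Path z z}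
    (h : q.Homotopic (p.symm.trans ((γ.trans (c.trans γ.symm)).trans p))) :
    ((γ.trans c).trans (γ.symm.trans p)).Homotopic (p.trans q) := by
  rw [← Path.Homotopic.Quotient.eq] at h ⊢
  simp only [Quotient.mk_trans, Quotient.mk_symm] at h ⊢
  rw [h, ← Quotient.trans_assoc (Path.Homotopic.Quotient.mk p), Quotient.trans_symm,
    Quotient.refl_trans]
  simp only [Quotient.trans_assoc]

end LogIncrements

/-! ### Transport of the local formula to the end point -/

section Monodromy

open unitInterval

variable {n a k : ℕ}

theorem norm_seg_lt_one {v : Fin n → ℂ} {b : ℕ} (hab : a < b)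
    (h : ∀ i, a ≤ i → i < b → ‖coord v i‖ < 1) : ‖seg v (a + 1) b‖ < 1 := by
  rw [seg_succ, norm_prod]
  calc ∏ i ∈ Finset.Ico a b, ‖coord v i‖ < ∏ _i ∈ Finset.Ico a b, (1 : ℝ) := by
        by_cases h0 : ∀ i ∈ Finset.Ico a b, 0 < ‖coord v i‖
        · exact Finset.prod_lt_prod_of_nonempty h0
            (fun i hi => h i (Finset.mem_Ico.1 hi).1 (Finset.mem_Ico.1 hi).2)
            (Finset.nonempty_Ico.2 hab)
        · push Not at h0
          obtain ⟨i, hi, hi0⟩ := h0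
          rw [Finset.prod_eq_zero (f := fun i => ‖coord v i‖) hi (le_antisymm hi0 (norm_nonneg _)),
            Finset.prod_const_one]
          exact one_pos
    _ = 1 := Finset.prod_const_one

theorem norm_coord_lt_one_of_mem_baseDomain {v : Fin n → ℂ} (hv : v ∈ baseDomain n) {i : ℕ}
    (hi : i < n) : ‖coord v i‖ < 1 := by
  rw [coord_of_lt _ hi]
  have h1 := hv ⟨i, hi⟩
  have h2 : ‖v ⟨i, hi⟩‖ ≤ ‖v ⟨i, hi⟩ - 1 / 2‖ + ‖(1 / 2 : ℂ)‖ := by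
    simpa using norm_add_le (v ⟨i, hi⟩ - 1 / 2) (1 / 2)
  have h3 : ‖(1 / 2 : ℂ)‖ = 1 / 2 := by norm_num
  linarith

theorem mem_convDomain_of_coord {v : Fin n → ℂ} (h : ∀ i < n, ‖coord v i‖ < 1) :
    v ∈ convDomain n := fun _ ha => norm_seg_lt_one ha fun i _ hi => h i hi

theorem firstCoords_mem_convDomain {v : Fin n → ℂ} (h : ∀ i < a, ‖coord v i‖ < 1) :
    firstCoords a v ∈ convDomain a :=
  mem_convDomain_of_coord fun i hi => by
    rw [coord_of_lt _ hi]
    exact h i hi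

theorem analyticAt_firstCoords (v : Fin n → ℂ) : AnalyticAt ℂ (firstCoords a) v := by
  refine AnalyticAt.pi fun i => ?_
  by_cases hi : i.val < n
  · simp only [firstCoords, coord_of_lt _ hi]
    exact analyticAt_apply _ _
  · simp only [firstCoords, coord_of_le _ (not_lt.1 hi)]
    exact analyticAt_const

theorem firstCoords_mem_regularSet (ha : a ≤ n) {v : Fin n → ℂ} (hv : v ∈ regularSet n) :
    firstCoords a v ∈ regularSet a := by
  refine mem_regularSet_iff.2 ⟨firstCoords_ne_zero hv.1, fun i j hij hj => ?_⟩
  rw [seg_firstCoords v hj]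
  exact (mem_regularSet_iff.1 hv).2 i j hij (hj.trans ha)

section

variable {v : Fin (a + k + 1) → ℂ}

theorem seg_ne_one (hv : v ∈ regularSet (a + k + 1)) {i : ℕ} (hi : i ≤ k) :
    seg v (a + 1) (a + 1 + i) ≠ 1 :=
  (mem_regularSet_iff.1 hv).2 _ _ (by omega) (by omega)

theorem analyticAt_yVec (hv : v ∈ regularSet (a + k + 1)) : AnalyticAt ℂ (yVec a k) v := by
  refine AnalyticAt.pi fun i => ?_
  exact (analyticAt_const.sub (analyticAt_seg _ _ v)).div
    (analyticAt_const.sub (analyticAt_seg _ _ v)) (sub_ne_zero.2 (seg_ne_one hv i.2.le).symm)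

/-- If a product of consecutive coordinates of `y(s)` is `1`, then two of the products `x_s ⋯ x_j`
coincide, and their quotient is a product of consecutive coordinates of `v` equal to `1`. -/
theorem yVec_mem_regularSet (hv : v ∈ regularSet (a + k + 1)) : yVec a k v ∈ regularSet k := by
  refine mem_regularSet_iff.2 ⟨fun i => ?_, fun i j hij hj h => ?_⟩
  · exact div_ne_zero (sub_ne_zero.2 (seg_ne_one (i := i + 1) hv i.2).symm)
      (sub_ne_zero.2 (seg_ne_one hv i.2.le).symm)
  · rw [seg_yVec (fun i hi => seg_ne_one hv hi.le) hij.le hj (by omega),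
      div_eq_one_iff_eq (sub_ne_zero.2 (seg_ne_one hv (by omega)).symm), sub_right_inj,
      ← seg_mul_seg v (show a ≤ a + 1 + i by omega) (show a + 1 + i ≤ a + 1 + j by omega),
      mul_eq_left₀ (seg_ne_zero hv.1 _ _)] at h
    exact (mem_regularSet_iff.1 hv).2 _ _ (by omega) (by omega) h

end

theorem continuous_yVec_subtype :
    Continuous fun v : regularSet (a + k + 1) => yVec a k (v : Fin (a + k + 1) → ℂ) :=
  continuous_iff_continuousAt.2 fun v =>
    (analyticAt_yVec v.2).continuousAt.comp continuous_subtype_val.continuousAt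

theorem continuous_firstCoords : Continuous (firstCoords a : (Fin n → ℂ) → Fin a → ℂ) :=
  continuous_iff_continuousAt.2 fun v => (analyticAt_firstCoords v).continuousAt

theorem eq_slice_of_forall_lt (ha : a ≤ n) {v w : Fin (n + 1) → ℂ} (hv : ∀ i, v i ≠ 0)
    (h : ∀ i : Fin (n + 1), i.val + 1 < n + 1 → w i = v i) :
    w = slice a v (seg w (a + 1) (n + 1)) := by
  have h1 : w = Function.update v (Fin.last n) (w (Fin.last n)) := by
    ext i
    by_cases hi : i = Fin.last n
    · subst hi
      simp
    · rw [Function.update_of_ne hi]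
      refine h i ?_
      have := Fin.val_lt_last hi
      omega
  have h2 : seg w (a + 1) n = seg v (a + 1) n := by
    rw [h1]
    exact seg_update_last_of_le v _ a le_rfl
  rw [slice, seg_mul_coord w ha, h2, mul_div_cancel_left₀ _ (seg_ne_zero hv a n), coord_last]
  exact h1

/-- The monodromy of the multiple logarithm around `x_{a+1} ⋯ x_n = 1`. -/
theorem monodromy (hn : n = a + k + 1) {b x z : regularSet n}
    (hb : (b : Fin n → ℂ) ∈ baseDomain n) (p : Path b x) (γ : Path b z)
    (q : Path x x) (hq : TurnsAroundOnly (a + 1) p γ q)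
    (hw : LogIncrement (fun t => 1 - seg (q t : Fin n → ℂ) (a + 1) n)
      (2 * Real.pi * Complex.I)) :
    (∃ L, ContinuesTo (multiLog n) (fun t => (p t : Fin n → ℂ)) L) ∧
    (∃ L', ContinuesTo (multiLog n)
      (fun t => ((p.trans q) t : Fin n → ℂ)) L') ∧
    (∃ A, ContinuesTo (multiLog a) (fun t => firstCoords a (p t : Fin n → ℂ)) A) ∧
    (∃ B, ContinuesTo (multiLog k)
      (fun t => yVec a k ((γ.symm.trans p) t : Fin n → ℂ)) B) ∧
    ∀ (L L' : (Fin n → ℂ) → ℂ) (A : (Fin a → ℂ) → ℂ) (B : (Fin k → ℂ) → ℂ),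
      ContinuesTo (multiLog n) (fun t => (p t : Fin n → ℂ)) L →
      ContinuesTo (multiLog n) (fun t => ((p.trans q) t : Fin n → ℂ)) L' →
      ContinuesTo (multiLog a) (fun t => firstCoords a (p t : Fin n → ℂ)) A →
      ContinuesTo (multiLog k)
        (fun t => yVec a k ((γ.symm.trans p) t : Fin n → ℂ)) B →
      ∀ᶠ v in 𝓝 (x : Fin n → ℂ),
        L' v - L v = -(2 * Real.pi * Complex.I) * A (firstCoords a v) * B (yVec a k v) := by
  subst hn
  obtain ⟨happ, c, htube, hclast, hconj⟩ := hq
  have hbc : (b : Fin (a + k + 1) → ℂ) ∈ convDomain (a + k + 1) :=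
    mem_convDomain_of_coord fun i hi => norm_coord_lt_one_of_mem_baseDomain hb hi
  have hval : Continuous (Subtype.val : regularSet (a + k + 1) → Fin (a + k + 1) → ℂ) :=
    continuous_subtype_val
  have hcont : Continuable Subtype.val (multiLog (a + k + 1)) b := fun y P =>
    exists_continuesTo_multiLog (by fun_prop) (fun t => (P t).2) (by simpa using hbc)
  let φ : regularSet (a + k + 1) → Fin a → ℂ := fun v => firstCoords a (v : Fin (a + k + 1) → ℂ)
  have hφ : Continuous φ := continuous_firstCoords.comp hval
  have hcontA : Continuable φ (multiLog a) b := fun y P =>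
    exists_continuesTo_multiLog (by fun_prop)
      (fun t => firstCoords_mem_regularSet (by omega) (P t).2) (by
        rw [Path.source]
        exact firstCoords_mem_convDomain fun i hi =>
          norm_coord_lt_one_of_mem_baseDomain hb (by omega))
  have hcoord : ∀ t, ∀ i < a, ‖coord (γ t : Fin (a + k + 1) → ℂ) i‖ < 1 := fun t i hi => by
    rw [coord_of_lt _ (by omega)]
    exact (happ t).1 _ (by simpa using hi)
  have hyz : yVec a k (z : Fin (a + k + 1) → ℂ) ∈ convDomain k := by
    have h := htube 0
    rw [Path.source] at h
    exact yVec_mem_convDomain (fun i hi => seg_ne_one z.2 hi.le) fun i hi =>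
      h.2.1 _ (by omega) (by omega)
  have hcontB : Continuable (fun v : regularSet (a + k + 1) => yVec a k (v : Fin (a + k + 1) → ℂ))
      (multiLog k) z := fun y P =>
    exists_continuesTo_multiLog (continuous_yVec_subtype.comp P.continuous)
      (fun t => yVec_mem_regularSet (P t).2) (by
        rw [Path.source]
        exact hyz)
  refine ⟨hcont x p, hcont x (p.trans q), hcontA x p, hcontB x (γ.symm.trans p),
    fun L L' A B hL hL' hA hB => ?_⟩
  obtain ⟨Lz, hLz⟩ := hcont z γ
  have hcontz := hcont.move hval hLz
  obtain ⟨Lc, hLc⟩ := hcontz z c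
  obtain ⟨M, hM⟩ := hcontz x (γ.symm.trans p)
  have hγc := hcont.trans hval hLz hLc
  obtain ⟨M', hM'⟩ := (hcont.move hval hγc) x (γ.symm.trans p)
  have hLM := hcont.eventuallyEq_of_homotopic hval (homotopic_trans_symm_trans γ p)
    (hcont.trans hval hLz hM) hL
  have hLM' := hcont.eventuallyEq_of_homotopic hval (homotopic_trans_of_conj hconj)
    (hcont.trans hval hγc hM') hL'
  -- Along `γ` the first `a` coordinates stay in the unit disc and `𝔏_a` remains its power series.
  -- Hence continuing the power series from `z` along `γ⁻¹p` gives the same branch as continuing it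
  -- from `b` along `p`.
  have hγA : ContinuesTo (multiLog a) (fun t => φ (γ t)) (multiLog a) :=
    ContinuesTo.const fun t => analyticAt_multiLog (firstCoords_mem_convDomain (hcoord t))
  obtain ⟨A', hA'⟩ := (hcontA.move hφ hγA) x (γ.symm.trans p)
  have hAA := hcontA.eventuallyEq_of_homotopic hφ (homotopic_trans_symm_trans γ p)
    (hcontA.trans hφ hγA hA') hA
  have hA'' : ContinuesTo (multiLog a) (fun t => φ ((γ.symm.trans p) t)) A :=
    hA'.congr_right (by simpa using hAA)
  -- The right-hand side of the formula as a single germ in all variables, continued from `z` along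
  -- `γ⁻¹p`.
  have hprod := (ContinuesTo.const (f := fun _ => -(2 * Real.pi * Complex.I))
    (γ := fun t => ((γ.symm.trans p) t : Fin (a + k + 1) → ℂ)) fun t => analyticAt_const).mul
    ((hA''.comp_analytic (γ := fun t => ((γ.symm.trans p) t : Fin (a + k + 1) → ℂ))
      fun t => analyticAt_firstCoords _).mul
      (hB.comp_analytic (γ := fun t => ((γ.symm.trans p) t : Fin (a + k + 1) → ℂ))
        fun t => analyticAt_yVec ((γ.symm.trans p) t).2))
  obtain ⟨θ, hθ, hθw⟩ := hw.of_conj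
    (f := fun v : regularSet (a + k + 1) => 1 - seg (v : Fin (a + k + 1) → ℂ) (a + 1) (a + k + 1))
    (by fun_prop) (fun v => sub_ne_zero.2
      ((mem_regularSet_iff.1 v.2).2 _ _ (by omega) le_rfl).symm) hconj
  have hcz : ∀ t, (c t : Fin (a + k + 1) → ℂ) =
      slice a z (seg (c t : Fin (a + k + 1) → ℂ) (a + 1) (a + k + 1)) := fun t =>
    eq_slice_of_forall_lt (by omega) z.2.1 (hclast t)
  have hsegc : ∀ t i j, j ≤ a + k →
      seg (c t : Fin (a + k + 1) → ℂ) (i + 1) j = seg (z : Fin (a + k + 1) → ℂ) (i + 1) j :=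
    fun t i j hj => by
      rw [hcz]
      exact seg_slice_of_le _ i hj
  have hloc := eventually_sub_eq_mul_logCoeff hbc
    (fun t j hj => (happ t).2 (j + 1) (by omega) (by omega))
    (fun j hj => norm_seg_lt_one hj fun i _ hi => by simpa using hcoord 1 i hi) hLz
    (u := fun t => seg (c t : Fin (a + k + 1) → ℂ) (a + 1) (a + k + 1)) (by fun_prop) hcz
    (fun t => (htube t).1)
    (fun t j hj hj' => by
      rw [← hsegc t a j hj']
      exact (htube t).2.1 j hj (by omega))
    (fun t j hj => by
      rw [← hsegc t j a (by omega)]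
      exact (htube t).2.2 (j + 1) (by omega) (by omega)) hLc θ.continuous hθ
  have hdiff := hM'.sub hM
  have hstart : (fun v => Lc v - Lz v) =ᶠ[𝓝 (z : Fin (a + k + 1) → ℂ)] fun v =>
      -(2 * Real.pi * Complex.I) * (multiLog a (firstCoords a v) * multiLog k (yVec a k v)) := by
    filter_upwards [hloc] with v hv
    rw [hv, hθw, logCoeff]
    ring
  -- The difference of the two branches and the right-hand side start from the same germ at `z` and
  -- are continued along the same path.
  have hend := (hdiff.congr_left (by simpa using hstart)).unique (by fun_prop) hprod
  simp only [Path.target] at hend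
  filter_upwards [hend, hLM, hLM'] with v h1 h2 h3
  rw [← h2, ← h3, h1]
  ring

theorem fin_take_eq_firstCoords (ha : a ≤ n) (v : Fin n → ℂ) :
    Fin.take a ha v = firstCoords a v := by
  ext i
  rw [firstCoords, coord_of_lt _ (i.2.trans_le ha)]
  rfl

end Monodromy
end MultiLog

theorem mainTheorem3 (n s : ℕ) (hs : 1 ≤ s) (hsn : s ≤ n)
    (b x z : MultiLog.regularSet n) (hb : (b : Fin n → ℂ) ∈ MultiLog.baseDomain n)
    (p : Path b x) (γ : Path b z) (q : Path x x)
    (hq : MultiLog.TurnsAroundOnly s p γ q)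
    (hw : MultiLog.LogIncrement (fun t => 1 - MultiLog.seg (q t : Fin n → ℂ) s n)
      (2 * Real.pi * Complex.I)) :
    -- the branches exist: of `𝔏_n` along `p`, of `𝔏_n` along `p` followed by `q`,
    -- of `𝔏_{s-1}` along the first `s - 1` coordinates of `p`, and of `𝔏_{n-s}` along the
    -- image under `y(s)` of `γ` reversed followed by `p`
    (∃ L, MultiLog.ContinuesTo (MultiLog.multiLog n) (fun t => (p t : Fin n → ℂ)) L) ∧
    (∃ L', MultiLog.ContinuesTo (MultiLog.multiLog n)
      (fun t => ((p.trans q) t : Fin n → ℂ)) L') ∧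
    (∃ A, MultiLog.ContinuesTo (MultiLog.multiLog (s - 1))
      (fun t => Fin.take (s - 1) (by omega) (p t : Fin n → ℂ)) A) ∧
    (∃ B, MultiLog.ContinuesTo (MultiLog.multiLog (n - s))
      (fun t => MultiLog.yPoint s ((γ.symm.trans p) t : Fin n → ℂ)) B) ∧
    -- and they satisfy the monodromy formula near the end point `x`
    ∀ (L L' : (Fin n → ℂ) → ℂ) (A : (Fin (s - 1) → ℂ) → ℂ) (B : (Fin (n - s) → ℂ) → ℂ),
      MultiLog.ContinuesTo (MultiLog.multiLog n) (fun t => (p t : Fin n → ℂ)) L →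
      MultiLog.ContinuesTo (MultiLog.multiLog n)
        (fun t => ((p.trans q) t : Fin n → ℂ)) L' →
      MultiLog.ContinuesTo (MultiLog.multiLog (s - 1))
        (fun t => Fin.take (s - 1) (by omega) (p t : Fin n → ℂ)) A →
      MultiLog.ContinuesTo (MultiLog.multiLog (n - s))
        (fun t => MultiLog.yPoint s ((γ.symm.trans p) t : Fin n → ℂ)) B →
      ∀ᶠ v in nhds (x : Fin n → ℂ),
        L' v - L v = -(2 * Real.pi * Complex.I) *
          A (Fin.take (s - 1) (by omega) v) * B (MultiLog.yPoint s v) := by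
  obtain ⟨a, rfl⟩ : ∃ a, s = a + 1 := ⟨s - 1, by omega⟩
  have h := MultiLog.monodromy (k := n - (a + 1)) (by omega) hb p γ q hq hw
  simp only [← MultiLog.fin_take_eq_firstCoords (show a ≤ n by omega)] at h
  -- By definition `yPoint (a + 1)` is `yVec a (n - (a + 1))`, and `a + 1 - 1` reduces to `a`.
  exact h
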